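/- Consider the two-component Pavlov–Mikhalev system $$u_{yy}=u_{xt}-u_xu_{xy}+u_yu_{xx},\qquad v_{yy}=v_{xt}-u_xv_{xy}-2v_yu_{xx}+2v_xu_{xy}+u_yv_{xx}.$$ Let $\mathcal E$ be its infinite prolongation, with internal coordinates $x,y,t$, $u_{0,k,l}=\partial_x^k\partial_t^l u$, $u_{1,k,l}=\partial_y\partial_x^k\partial_t^l u$, $v_{0,k,l}$, $v_{1,k,l}$ ($k,l\ge 0$); let $\mathcal F(\mathcal E)$ be the algebra of smooth functions depending on finitely many of these coordinates, and let $D_x,D_y,D_t$ be the total derivatives on $\mathcal E$ (so that $D_y$ sends $u_{1,k,l}$ and $v_{1,k,l}$ to $D_x^kD_t^l$ of the right-hand sides above). A symmetry of $\mathcal E$ is a derivation $Z$ of the real algebra $\mathcal F(\mathcal E)$ with $Z(x)=Z(y)=Z(t)=0$ and $[Z,\mathcal C]\subset\mathcal C$, where $\mathcal C$ is the $\mathcal F(\mathcal E)$-module spanned by $D_x,D_y,D_t$; symmetries form a Lie algebra $\operatorname{sym}(\mathcal E)$ under the commutator. For $\phi=(\phi^u,\phi^v)\in\mathcal F(\mathcal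 E)^2$ let $\mathrm{Ev}_\phi=\sum_{i,k,l}\bigl(D_x^kD_t^lD_y^i(\phi^u)\,\partial/\partial u_{i,k,l}+D_x^kD_t^lD_y^i(\phi^v)\,\partial/\partial v_{i,k,l}\bigr)$, and let $\{\phi,\psi\}=\mathrm{Ev}_\phi(\psi)-\mathrm{Ev}_\psi(\phi)$ (componentwise) be the Jacobi bracket. For an arbitrary smooth function $\vartheta=\vartheta(t)$, $t\in\mathbb R$, define the following pairs. - $\phi_1=(yu_x-2x,\ yv_x)$; - $\phi_2=(2xu_x+yu_y-3u,\ 2xv_x+yv_y)$; - $\phi_3[\vartheta]=(\vartheta,0)$; - $\phi_4[\vartheta]=(u_x\vartheta-y\vartheta_t,\ v_x\vartheta)$; - $\phi_5[\vartheta]=(u_y\vartheta+(yu_x-x)\vartheta_t-\tfrac12y^2\vartheta_{tt},\ v_y\vartheta+yv_x\vartheta_t)$; - $\phi_6[\vartheta]=(u_t\vartheta+(xu_x+yu_y-u)\vartheta_t+\tfrac12(y^2u_x-2xy)\vartheta_{tt}-\tfrac16y^3\vartheta_{ttt},\ v_t\vartheta+(xv_x+yv_y+2v)\vartheta_t+\tfrac12y^2v_x\vartheta_{tt})$;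 and $\phi_i=(0,\phi_i^v)$ for $i=7,\dots,18$, where - $\phi_7^v=v$; - $\phi_8^v=u_{xxx}$; - $\phi_9^v=u_xu_{xxx}+u_{xxy}+\tfrac12u_{xx}^2$; - $\phi_{10}^v=u_{xxt}+u_xu_{xxy}+u_xu_{xx}^2+u_{xy}u_{xx}+(u_x^2+u_y)u_{xxx}$; - $\phi_{11}^v=u_x(u_x^2+2u_y)u_{xxx}+(u_x^2+u_y)u_{xxy}+2u_xu_{xxt}+\tfrac12(3u_x^2+2u_y)u_{xx}^2+(2u_xu_{xy}+u_{xt})u_{xx}+\tfrac12u_{xy}^2+u_{xyt}$; - $\phi_{12}^v=(3u_x^2+2u_y)u_{xxt}+u_x(u_x^2+2u_y)u_{xxy}+u_{xtt}+(2u_x^3+3u_xu_y)u_{xx}^2+u_{xx}(u_{yt}+3u_xu_{xt}+(3u_x^2+2u_y)u_{xy})+(u_x^4+3u_x^2u_y+u_y^2)u_{xxx}+u_xu_{xy}^2+u_{xt}u_{xy}+2u_xu_{xyt}$; - $\phi_{13}^v=(u_x^4+3u_x^2u_y+u_y^2)u_{xxy}+(4u_x^3+6u_xu_y)u_{xxt}+3u_xu_{xtt}+u_{ytt}+\tfrac12(5u_x^4+12u_x^2u_y+3u_y^2)u_{xx}^2+((4u_x^3+6u_xu_y)u_{xy}+u_{xt}(6u_x^2+3u_y)+3u_{yt}u_x)u_{xx}+(u_x^5+4u_x^3u_y+3u_xu_y^2)u_{xxx}+(3u_x^2+2u_y)u_{xyt}+\tfrac12(3u_x^2+2u_y)u_{xy}^2+u_{xy}(3u_xu_{xt}+u_{yt})+\tfrac32u_{xt}^2$;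 - $\phi_{14}^v=(5u_x^4+12u_x^2u_y+3u_y^2)u_{xxt}+u_x(u_x^2+u_y)(u_x^2+3u_y)u_{xxy}+(6u_x^2+3u_y)u_{xtt}+3u_xu_{ytt}+(3u_x^5+10u_x^3u_y+6u_xu_y^2)u_{xx}^2+((5u_x^4+12u_x^2u_y+3u_y^2)u_{xy}+(10u_x^3+12u_xu_y)u_{xt}+3(2u_x^2+u_y)u_{yt})u_{xx}+(u_x^6+5u_x^4u_y+6u_x^2u_y^2+u_y^3)u_{xxx}+(4u_x^3+6u_xu_y)u_{xyt}+u_{ttt}+(2u_x^3+3u_xu_y)u_{xy}^2+u_{xy}(3u_{yt}u_x+u_{xt}(6u_x^2+3u_y))+6u_xu_{xt}^2+3u_{yt}u_{xt}$; - $\phi_{15}^v[\vartheta]=\vartheta$; - $\phi_{16}^v[\vartheta]=u_x\vartheta+\tfrac12y\vartheta_t$; - $\phi_{17}^v[\vartheta]=(\tfrac32u_x^2+u_y)\vartheta+(yu_x+\tfrac12x)\vartheta_t+\tfrac14y^2\vartheta_{tt}$; - $\phi_{18}^v[\vartheta]=(2u_x^3+3u_xu_y+u_t)\vartheta+(\tfrac32yu_x^2+xu_x+yu_y+\tfrac12u)\vartheta_t+\tfrac12y(yu_x+x)\vartheta_{tt}+\tfrac1{12}y^3\vartheta_{ttt}$.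 Then the symmetries of $\mathcal E$ are exactly the fields $\mathrm{Ev}_\phi$ with $$\phi=\sum_{i\in\{1,2,7,\dots,14\}}c_i\phi_i+\sum_{i\in\{3,\dots,6,15,\dots,18\}}\phi_i[\vartheta_i],\qquad c_i\in\mathbb R,\ \vartheta_i\in C^\infty(\mathbb R),$$ the $c_i$ and $\vartheta_i$ being uniquely determined by the symmetry, and $[\mathrm{Ev}_\phi,\mathrm{Ev}_\psi]=\mathrm{Ev}_{\{\phi,\psi\}}$ whenever $\mathrm{Ev}_\phi$ and $\mathrm{Ev}_\psi$ are symmetries. Identify symmetries with their generating sections $\phi$, and let $\mathfrak s(2)=\langle\phi_1,\phi_2\rangle$, $\mathfrak a(1)=\langle\phi_7\rangle$, $\mathfrak a(7)=\langle\phi_8,\dots,\phi_{14}\rangle$, $\mathfrak{at}(4)=\langle\phi_{15}[\vartheta],\dots,\phi_{18}[\vartheta]\rangle$, $\mathfrak{gt}(4)=\langle\phi_3[\vartheta],\dots,\phi_6[\vartheta]\rangle$ (real spans, $\vartheta$ arbitrary). Then $$\operatorname{sym}(\mathcal E)=(\mathfrak s(2)\oplus\mathfrak a(1))\ltimes\mathfrak{gt}(4)\ltimes(\mathfrak{at}(4)\oplus\mathfrak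 a(7)),$$ an iterated semidirect product of Lie algebras (the ideals on the right; with either placement of the parentheses). Here $\mathfrak s(2)$ is a $2$-dimensional solvable Lie algebra with $\{\phi_2,\phi_1\}=\phi_1$; $\mathfrak a(1)$, $\mathfrak{at}(4)$, $\mathfrak a(7)$ are Abelian, with $\dim\mathfrak a(1)=1$ and $\dim\mathfrak a(7)=7$. The structure of $\mathfrak{gt}(4)$ is, for arbitrary smooth functions $\vartheta,\bar\vartheta$ of $t$, $\{\phi_3[\vartheta],\phi_6[\bar\vartheta]\}=\phi_3[\vartheta_t\bar\vartheta-\vartheta\bar\vartheta_t]$, $\{\phi_4[\vartheta],\phi_5[\bar\vartheta]\}=\phi_3[\vartheta\bar\vartheta_t-\vartheta_t\bar\vartheta]$, $\{\phi_4[\vartheta],\phi_6[\bar\vartheta]\}=\phi_4[\vartheta_t\bar\vartheta-\vartheta\bar\vartheta_t]$, $\{\phi_5[\vartheta],\phi_5[\bar\vartheta]\}=\phi_4[\vartheta_t\bar\vartheta-\vartheta\bar\vartheta_t]$, $\{\phi_5[\vartheta],\phi_6[\bar\vartheta]\}=\phi_5[\vartheta_t\bar\vartheta-\vartheta\bar\vartheta_t]$,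 $\{\phi_6[\vartheta],\phi_6[\bar\vartheta]\}=\phi_6[\vartheta_t\bar\vartheta-\vartheta\bar\vartheta_t]$. The actions of $\mathfrak s(2)$ and $\mathfrak a(1)$ are $\{\phi_1,\phi_4[\vartheta]\}=-2\phi_3[\vartheta]$, $\{\phi_1,\phi_5[\vartheta]\}=\phi_4[\vartheta]$, $\{\phi_1,\phi_9\}=-\phi_8$, $\{\phi_1,\phi_{10}\}=-2\phi_9$, $\{\phi_1,\phi_{11}\}=-3\phi_{10}$, $\{\phi_1,\phi_{12}\}=-4\phi_{11}$, $\{\phi_1,\phi_{13}\}=-5\phi_{12}$, $\{\phi_1,\phi_{14}\}=-6\phi_{13}$, $\{\phi_1,\phi_{16}[\vartheta]\}=-2\phi_{15}[\vartheta]$, $\{\phi_1,\phi_{17}[\vartheta]\}=-5\phi_{16}[\vartheta]$, $\{\phi_1,\phi_{18}[\vartheta]\}=-6\phi_{17}[\vartheta]$; $\{\phi_2,\phi_3[\vartheta]\}=3\phi_3[\vartheta]$, $\{\phi_2,\phi_4[\vartheta]\}=2\phi_4[\vartheta]$, $\{\phi_2,\phi_5[\vartheta]\}=\phi_5[\vartheta]$,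 $\{\phi_2,\phi_8\}=3\phi_8$, $\{\phi_2,\phi_9\}=2\phi_9$, $\{\phi_2,\phi_{10}\}=\phi_{10}$, $\{\phi_2,\phi_{12}\}=-\phi_{12}$, $\{\phi_2,\phi_{13}\}=-2\phi_{13}$, $\{\phi_2,\phi_{14}\}=-3\phi_{14}$, $\{\phi_2,\phi_{16}[\vartheta]\}=-\phi_{16}[\vartheta]$, $\{\phi_2,\phi_{17}[\vartheta]\}=-2\phi_{17}[\vartheta]$, $\{\phi_2,\phi_{18}[\vartheta]\}=-3\phi_{18}[\vartheta]$; and $\{\phi_7,\phi_i\}=-\phi_i$ for all $i=8,\dots,18$. The action of $\mathfrak{gt}(4)$ on $\mathfrak a(7)\oplus\mathfrak{at}(4)$ is $\{\phi_3[\vartheta],\phi_{14}\}=\phi_{15}[\vartheta_{ttt}]$, $\{\phi_3[\vartheta],\phi_{18}[\bar\vartheta]\}=\phi_{15}[\vartheta\bar\vartheta_t/2+\vartheta_t\bar\vartheta]$; $\{\phi_4[\vartheta],\phi_{13}\}=-\phi_{15}[\vartheta_{ttt}]$, $\{\phi_4[\vartheta],\phi_{14}\}=-2\phi_{16}[\vartheta_{ttt}]$,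 $\{\phi_4[\vartheta],\phi_{17}[\bar\vartheta]\}=-\phi_{15}[\vartheta_t\bar\vartheta+\vartheta\bar\vartheta_t/2]$, $\{\phi_4[\vartheta],\phi_{18}[\bar\vartheta]\}=-\phi_{16}[2\vartheta_t\bar\vartheta+\vartheta\bar\vartheta_t]$; $\{\phi_5[\vartheta],\phi_{12}\}=-\phi_{15}[\vartheta_{ttt}]$, $\{\phi_5[\vartheta],\phi_{13}\}=-2\phi_{16}[\vartheta_{ttt}]$, $\{\phi_5[\vartheta],\phi_{14}\}=-2\phi_{17}[\vartheta_{ttt}]$, $\{\phi_5[\vartheta],\phi_{16}[\bar\vartheta]\}=-\phi_{15}[\vartheta_t\bar\vartheta+\vartheta\bar\vartheta_t/2]$, $\{\phi_5[\vartheta],\phi_{17}[\bar\vartheta]\}=-\phi_{16}[2\vartheta_t\bar\vartheta+\vartheta\bar\vartheta_t]$, $\{\phi_5[\vartheta],\phi_{18}[\bar\vartheta]\}=-\phi_{17}[2\vartheta_t\bar\vartheta+\vartheta\bar\vartheta_t]$; $\{\phi_6[\vartheta],\phi_{11}\}=-\phi_{15}[\vartheta_{ttt}]$, $\{\phi_6[\vartheta],\phi_{12}\}=-2\phi_{16}[\vartheta_{ttt}]$,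 $\{\phi_6[\vartheta],\phi_{13}\}=-2\phi_{17}[\vartheta_{ttt}]$, $\{\phi_6[\vartheta],\phi_{14}\}=-2\phi_{18}[\vartheta_{ttt}]$, and $\{\phi_6[\vartheta],\phi_j[\bar\vartheta]\}=-\phi_j[2\vartheta_t\bar\vartheta+\vartheta\bar\vartheta_t]$ for $j=15,16,17,18$. All brackets of generators that are not obtained from these by antisymmetry vanish. -/

import Mathlib

open scoped ContDiff

noncomputable section

namespace PavlovMikhalev

/-! ## The infinitely prolonged equation and its algebra of smooth functions -/

/-- Internal coordinates of the equation `E`: the independent variables `x, y, t`, and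
`u0 k l = ∂ₓᵏ∂ₜˡ u`, `u1 k l = ∂_y ∂ₓᵏ∂ₜˡ u`, `v0 k l = ∂ₓᵏ∂ₜˡ v`, `v1 k l = ∂_y ∂ₓᵏ∂ₜˡ v`. -/
inductive Coord : Type
  | x : Coord
  | y : Coord
  | t : Coord
  | u0 (k l : ℕ) : Coord
  | u1 (k l : ℕ) : Coord
  | v0 (k l : ℕ) : Coord
  | v1 (k l : ℕ) : Coord

/-- Points of `E`, written in internal coordinates. -/
abbrev Point : Type := Coord → ℝ

/-- `f` is a smooth function of the finitely many coordinates in `s`. -/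
def SmoothIn (s : Finset Coord) (f : Point → ℝ) : Prop :=
  ∃ g : (s → ℝ) → ℝ, ContDiff ℝ ∞ g ∧ ∀ p : Point, f p = g (fun i => p i)

theorem SmoothIn.mono {s s' : Finset Coord} (h : s ⊆ s') {f : Point → ℝ}
    (hf : SmoothIn s f) : SmoothIn s' f := by
  obtain ⟨g, hg, hfg⟩ := hf
  refine ⟨fun q => g (fun i => q ⟨i, h i.2⟩), ?_, fun p => hfg p⟩
  exact hg.comp (contDiff_pi.2 fun i => contDiff_apply ℝ ℝ (⟨i.1, h i.2⟩ : s'))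

/-- The smooth functions on `E` inside all functions: each of them depends, smoothly, on finitely many
coordinates. -/
def smoothSubalgebra : Subalgebra ℝ (Point → ℝ) where
  carrier := {f | ∃ s : Finset Coord, SmoothIn s f}
  mul_mem' := by
    classical
    rintro f f' ⟨s, hf⟩ ⟨s', hf'⟩
    obtain ⟨g, hg, h⟩ := hf.mono (Finset.subset_union_left (s₂ := s'))
    obtain ⟨g', hg', h'⟩ := hf'.mono (Finset.subset_union_right (s₁ := s))
    exact ⟨s ∪ s', fun q => g q * g' q, hg.mul hg', fun p => by simp [h, h']⟩
  add_mem' := by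
    classical
    rintro f f' ⟨s, hf⟩ ⟨s', hf'⟩
    obtain ⟨g, hg, h⟩ := hf.mono (Finset.subset_union_left (s₂ := s'))
    obtain ⟨g', hg', h'⟩ := hf'.mono (Finset.subset_union_right (s₁ := s))
    exact ⟨s ∪ s', fun q => g q + g' q, hg.add hg', fun p => by simp [h, h']⟩
  algebraMap_mem' r := ⟨∅, fun _ => r, contDiff_const, fun _ => rfl⟩

/-- The commutative real algebra of smooth functions on `E`. -/
def FE : Type := smoothSubalgebra

instance : CommRing FE := inferInstanceAs (CommRing smoothSubalgebra)

instance : Algebra ℝ FE := inferInstanceAs (Algebra ℝ smoothSubalgebra)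

/-- Vector fields on `E`: the `ℝ`-linear derivations of `FE`. -/
abbrev VF : Type := Derivation ℝ FE FE

/-- A coordinate as an element of `FE`. -/
def co (c : Coord) : FE :=
  ⟨fun p => p c, {c}, fun q => q ⟨c, Finset.mem_singleton_self c⟩,
    contDiff_apply ℝ ℝ _, fun _ => rfl⟩

open Classical in
/-- The partial derivative of `f` along the coordinate `c`. -/
def pdFun (c : Coord) (f : Point → ℝ) (p : Point) : ℝ :=
  deriv (fun r => f (Function.update p c r)) (p c)

open Classical in
theorem SmoothIn.pd_notMem {s : Finset Coord} {f : Point → ℝ} (hf : SmoothIn s f) {c : Coord}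
    (hc : c ∉ s) : pdFun c f = 0 := by
  obtain ⟨g, -, h⟩ := hf
  funext p
  have : (fun r => f (Function.update p c r)) = fun _ => f p := by
    funext r
    rw [h, h]
    congr 1
    funext i
    rw [Function.update_of_ne]
    rintro rfl
    exact hc i.2
  simp [pdFun, this]

open Classical in
theorem SmoothIn.hasDerivAt {s : Finset Coord} {f : Point → ℝ} {g : (s → ℝ) → ℝ}
    (hg : ContDiff ℝ ∞ g) (h : ∀ p : Point, f p = g (fun i => p i)) {c : Coord} (hc : c ∈ s)
    (p : Point) : HasDerivAt (fun r => f (Function.update p c r))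
      (fderiv ℝ g (fun i => p i) (Pi.single ⟨c, hc⟩ 1)) (p c) := by
  have e : (fun r => f (Function.update p c r)) =
      fun r => g (Function.update (fun i : s => p i) ⟨c, hc⟩ r) := by
    funext r
    rw [h]
    congr 1
    funext i
    by_cases hi : i = ⟨c, hc⟩
    · subst hi; simp
    · rw [Function.update_of_ne hi, Function.update_of_ne]
      exact fun hh => hi (Subtype.ext hh)
  rw [e]
  have h1 : HasDerivAt (fun r : ℝ => Function.update (fun i : s => p i) ⟨c, hc⟩ r)
      (Pi.single ⟨c, hc⟩ 1) (p c) := hasDerivAt_update _ _ _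
  have h2 : HasFDerivAt g (fderiv ℝ g (fun i => p i))
      (Function.update (fun i : s => p i) ⟨c, hc⟩ (p c)) := by
    have : Function.update (fun i : s => p i) ⟨c, hc⟩ (p c) = fun i : s => p i :=
      Function.update_eq_self (⟨c, hc⟩ : s) (fun i : s => p i)
    rw [this]
    exact (hg.differentiable (by simp)).differentiableAt.hasFDerivAt
  exact h2.comp_hasDerivAt _ h1

open Classical in
theorem differentiableAt_slice {f : Point → ℝ} (hf : f ∈ smoothSubalgebra) (c : Coord) (p : Point) :
    DifferentiableAt ℝ (fun r => f (Function.update p c r)) (p c) := by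
  obtain ⟨s, hs⟩ := hf
  obtain ⟨g, hg, h⟩ := hs.mono (Finset.subset_insert c s)
  exact (SmoothIn.hasDerivAt hg h (Finset.mem_insert_self c s) p).differentiableAt

theorem SmoothIn.pd {s : Finset Coord} {f : Point → ℝ} (hf : SmoothIn s f) (c : Coord) :
    SmoothIn s (pdFun c f) := by
  classical
  by_cases hc : c ∈ s
  · obtain ⟨g, hg, h⟩ := hf
    refine ⟨fun q => fderiv ℝ g q (Pi.single ⟨c, hc⟩ 1), ?_, fun p => ?_⟩
    · exact (hg.fderiv_right (m := ∞) (by simp)).clm_apply contDiff_const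
    · have := (SmoothIn.hasDerivAt hg h hc p).deriv
      rw [pdFun]
      convert this
  · rw [hf.pd_notMem hc]
    exact ⟨fun _ => 0, contDiff_const, fun _ => rfl⟩

/-- The partial derivative along the coordinate `c` as a vector field on `E`. -/
def pd (c : Coord) : VF :=
  Derivation.mk'
    { toFun := fun f => ⟨pdFun c f.1, f.2.imp fun _ h => h.pd c⟩
      map_add' := fun f g => Subtype.ext <| funext fun p =>
        deriv_add (differentiableAt_slice f.2 c p) (differentiableAt_slice g.2 c p)
      map_smul' := fun r f => Subtype.ext <| funext fun p =>
        deriv_const_mul r (differentiableAt_slice f.2 c p) }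
    (fun f g => Subtype.ext <| funext fun p => by
      classical
      have h := deriv_mul (differentiableAt_slice f.2 c p) (differentiableAt_slice g.2 c p)
      simp only [Function.update_eq_self] at h
      change pdFun c (fun q => f.1 q * g.1 q) p = f.1 p * pdFun c g.1 p + g.1 p * pdFun c f.1 p
      refine Eq.trans h ?_
      simp only [pdFun]
      ring)

theorem pd_support (a : Coord → FE) (f : FE) :
    (Function.support fun c => a c * pd c f).Finite := by
  obtain ⟨s, hs⟩ := f.2
  refine s.finite_toSet.subset fun c hc => ?_
  by_contra hcs
  refine hc ?_
  have : pd c f = 0 := Subtype.ext (show pdFun c f.1 = 0 from hs.pd_notMem hcs)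
  simp [this]

/-- The vector field `∑ a_c ∂/∂c` with prescribed components; the sum is finite on each function. -/
def vf (a : Coord → FE) : VF :=
  Derivation.mk'
    { toFun := fun f => ∑ᶠ c, a c * pd c f
      map_add' := fun f g => by
        rw [← finsum_add_distrib (pd_support a f) (pd_support a g)]
        simp only [map_add, mul_add]
      map_smul' := fun r f => by
        simp only [RingHom.id_apply]
        rw [smul_finsum]
        simp only [Derivation.map_smul, mul_smul_comm] }
    (fun f g => by
      change ∑ᶠ c, a c * pd c (f * g) = f * (∑ᶠ c, a c * pd c g) + g * ∑ᶠ c, a c * pd c f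
      rw [mul_finsum' _ _ (pd_support a g), mul_finsum' _ _ (pd_support a f),
        ← finsum_add_distrib]
      · refine finsum_congr fun c => ?_
        rw [Derivation.leibniz, smul_eq_mul, smul_eq_mul]
        ring
      · exact (pd_support a g).subset fun c hc h => hc (by simp [h])
      · exact (pd_support a f).subset fun c hc h => hc (by simp [h]))

/-! ## Names of the coordinates of low order -/

/-- The independent variable `x`. -/
def X : FE := co .x
/-- The independent variable `y`. -/
def Y : FE := co .y
/-- The unknown function `u`. -/
def u : FE := co (.u0 0 0)
/-- The unknown function `v`. -/
def v : FE := co (.v0 0 0)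
def u_x : FE := co (.u0 1 0)
def u_y : FE := co (.u1 0 0)
def u_t : FE := co (.u0 0 1)
def v_x : FE := co (.v0 1 0)
def v_y : FE := co (.v1 0 0)
def v_t : FE := co (.v0 0 1)
def u_xx : FE := co (.u0 2 0)
def u_xy : FE := co (.u1 1 0)
def u_xt : FE := co (.u0 1 1)
def u_yt : FE := co (.u1 0 1)
def v_xx : FE := co (.v0 2 0)
def v_xy : FE := co (.v1 1 0)
def v_xt : FE := co (.v0 1 1)
def u_xxx : FE := co (.u0 3 0)
def u_xxy : FE := co (.u1 2 0)
def u_xxt : FE := co (.u0 2 1)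
def u_xyt : FE := co (.u1 1 1)
def u_xtt : FE := co (.u0 1 2)
def u_ytt : FE := co (.u1 0 2)
def u_ttt : FE := co (.u0 0 3)

/-! ## Total derivatives on the equation -/

/-- The right-hand side of `u_yy = u_xt - u_x u_xy + u_y u_xx`. -/
def rhsU : FE := u_xt - u_x * u_xy + u_y * u_xx

/-- The right-hand side of `v_yy = v_xt - u_x v_xy - 2 v_y u_xx + 2 v_x u_xy + u_y v_xx`. -/
def rhsV : FE := v_xt - u_x * v_xy - 2 * v_y * u_xx + 2 * v_x * u_xy + u_y * v_xx

/-- The total derivative with respect to `x`. -/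
def Dx : VF := vf fun
  | .x => 1
  | .y => 0
  | .t => 0
  | .u0 k l => co (.u0 (k + 1) l)
  | .u1 k l => co (.u1 (k + 1) l)
  | .v0 k l => co (.v0 (k + 1) l)
  | .v1 k l => co (.v1 (k + 1) l)

/-- The total derivative with respect to `t`. -/
def Dt : VF := vf fun
  | .x => 0
  | .y => 0
  | .t => 1
  | .u0 k l => co (.u0 k (l + 1))
  | .u1 k l => co (.u1 k (l + 1))
  | .v0 k l => co (.v0 k (l + 1))
  | .v1 k l => co (.v1 k (l + 1))

/-- The total derivative with respect to `y`. -/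
def Dy : VF := vf fun
  | .x => 0
  | .y => 1
  | .t => 0
  | .u0 k l => co (.u1 k l)
  | .u1 k l => Dx^[k] (Dt^[l] rhsU)
  | .v0 k l => co (.v1 k l)
  | .v1 k l => Dx^[k] (Dt^[l] rhsV)

/-! ## Symmetries -/

/-- The Cartan distribution on `E`, as a module of vector fields. -/
def Cartan : Submodule FE (VF) := Submodule.span FE {Dx, Dy, Dt}

/-- The Lie algebra of (infinitesimal) symmetries of `E`: the vector fields that are vertical with
respect to the projection to the space of independent variables and preserve the Cartan
distribution. -/
def symE : LieSubalgebra ℝ (VF) where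
  carrier := {Z | (Z (co .x) = 0 ∧ Z (co .y) = 0 ∧ Z (co .t) = 0) ∧ ∀ C ∈ Cartan, ⁅Z, C⁆ ∈ Cartan}
  add_mem' := by
    rintro Z W ⟨⟨h1, h2, h3⟩, h⟩ ⟨⟨k1, k2, k3⟩, k⟩
    refine ⟨by simp [*], fun C hC => ?_⟩
    rw [add_lie]
    exact Cartan.add_mem (h C hC) (k C hC)
  zero_mem' := ⟨by simp, fun C _ => by rw [zero_lie]; exact Cartan.zero_mem⟩
  smul_mem' := by
    rintro r Z ⟨⟨h1, h2, h3⟩, h⟩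
    refine ⟨by simp [*], fun C hC => ?_⟩
    rw [smul_lie, ← algebraMap_smul FE r ⁅Z, C⁆]
    exact Cartan.smul_mem _ (h C hC)
  lie_mem' := by
    rintro Z W ⟨⟨h1, h2, h3⟩, h⟩ ⟨⟨k1, k2, k3⟩, k⟩
    refine ⟨by simp [Derivation.commutator_apply, *], fun C hC => ?_⟩
    rw [lie_lie]
    exact Cartan.sub_mem (h _ (k C hC)) (k _ (h C hC))

/-- Pairs `φ = (φᵘ, φᵛ)` of functions on `E`. -/
abbrev Section : Type := FE × FE

/-- The evolutionary vector field `∑ D_σ(φᵘ) ∂/∂u_σ + ∑ D_σ(φᵛ) ∂/∂v_σ` with generating section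
`φ`, the sums being over the internal coordinates. -/
def Ev (φ : Section) : VF := vf fun
  | .x => 0
  | .y => 0
  | .t => 0
  | .u0 k l => Dx^[k] (Dt^[l] φ.1)
  | .u1 k l => Dx^[k] (Dt^[l] (Dy φ.1))
  | .v0 k l => Dx^[k] (Dt^[l] φ.2)
  | .v1 k l => Dx^[k] (Dt^[l] (Dy φ.2))

/-- The Jacobi bracket `{φ, ψ} = Ev_φ(ψ) - Ev_ψ(φ)` (componentwise). -/
def jacobi (φ ψ : Section) : Section := (Ev φ ψ.1 - Ev ψ φ.1, Ev φ ψ.2 - Ev ψ φ.2)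

/-! ## Smooth functions of `t` -/

/-- The algebra of smooth functions `ϑ(t)` on the real line. -/
def TFun : Subalgebra ℝ (ℝ → ℝ) where
  carrier := {f | ContDiff ℝ ∞ f}
  mul_mem' := fun {f g} (hf : ContDiff ℝ ∞ f) (hg : ContDiff ℝ ∞ g) => hf.mul hg
  add_mem' := fun {f g} (hf : ContDiff ℝ ∞ f) (hg : ContDiff ℝ ∞ g) => hf.add hg
  algebraMap_mem' r := show ContDiff ℝ ∞ fun _ : ℝ => r from contDiff_const

/-- The derivative of a smooth function of `t`. -/
def d (ϑ : TFun) : TFun := ⟨deriv ϑ.1, (contDiff_infty_iff_deriv.1 ϑ.2).2⟩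

/-- A smooth function of `t` as a function on `E`. -/
def lift (ϑ : TFun) : FE :=
  ⟨fun p => ϑ.1 (p .t), {.t}, fun q => ϑ.1 (q ⟨.t, Finset.mem_singleton_self _⟩),
    ContDiff.comp (show ContDiff ℝ ∞ ϑ.1 from ϑ.2) (contDiff_apply ℝ ℝ _), fun _ => rfl⟩

/-! ## The generators -/

def phi1 : Section := (Y * u_x - 2 * X, Y * v_x)

def phi2 : Section := (2 * X * u_x + Y * u_y - 3 * u, 2 * X * v_x + Y * v_y)

def phi3 (ϑ : TFun) : Section := (lift ϑ, 0)

def phi4 (ϑ : TFun) : Section := (u_x * lift ϑ - Y * lift (d ϑ), v_x * lift ϑ)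

def phi5 (ϑ : TFun) : Section :=
  (u_y * lift ϑ + (Y * u_x - X) * lift (d ϑ) - (1 / 2 : ℝ) • (Y ^ 2 * lift (d (d ϑ))),
    v_y * lift ϑ + Y * v_x * lift (d ϑ))

def phi6 (ϑ : TFun) : Section :=
  (u_t * lift ϑ + (X * u_x + Y * u_y - u) * lift (d ϑ)
      + (1 / 2 : ℝ) • ((Y ^ 2 * u_x - 2 * X * Y) * lift (d (d ϑ)))
      - (1 / 6 : ℝ) • (Y ^ 3 * lift (d (d (d ϑ)))),
    v_t * lift ϑ + (X * v_x + Y * v_y + 2 * v) * lift (d ϑ)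
      + (1 / 2 : ℝ) • (Y ^ 2 * v_x * lift (d (d ϑ))))

def phi7 : Section := (0, v)

def phi8 : Section := (0, u_xxx)

def phi9 : Section := (0, u_x * u_xxx + u_xxy + (1 / 2 : ℝ) • u_xx ^ 2)

def phi10 : Section :=
  (0, u_xxt + u_x * u_xxy + u_x * u_xx ^ 2 + u_xy * u_xx + (u_x ^ 2 + u_y) * u_xxx)

def phi11 : Section :=
  (0, u_x * (u_x ^ 2 + 2 * u_y) * u_xxx + (u_x ^ 2 + u_y) * u_xxy + 2 * u_x * u_xxt
    + (1 / 2 : ℝ) • ((3 * u_x ^ 2 + 2 * u_y) * u_xx ^ 2)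
    + (2 * u_x * u_xy + u_xt) * u_xx + (1 / 2 : ℝ) • u_xy ^ 2 + u_xyt)

def phi12 : Section :=
  (0, (3 * u_x ^ 2 + 2 * u_y) * u_xxt + u_x * (u_x ^ 2 + 2 * u_y) * u_xxy + u_xtt
    + (2 * u_x ^ 3 + 3 * u_x * u_y) * u_xx ^ 2
    + u_xx * (u_yt + 3 * u_x * u_xt + (3 * u_x ^ 2 + 2 * u_y) * u_xy)
    + (u_x ^ 4 + 3 * u_x ^ 2 * u_y + u_y ^ 2) * u_xxx
    + u_x * u_xy ^ 2 + u_xt * u_xy + 2 * u_x * u_xyt)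

def phi13 : Section :=
  (0, (u_x ^ 4 + 3 * u_x ^ 2 * u_y + u_y ^ 2) * u_xxy
    + (4 * u_x ^ 3 + 6 * u_x * u_y) * u_xxt + 3 * u_x * u_xtt + u_ytt
    + (1 / 2 : ℝ) • ((5 * u_x ^ 4 + 12 * u_x ^ 2 * u_y + 3 * u_y ^ 2) * u_xx ^ 2)
    + ((4 * u_x ^ 3 + 6 * u_x * u_y) * u_xy + u_xt * (6 * u_x ^ 2 + 3 * u_y)
        + 3 * u_yt * u_x) * u_xx
    + (u_x ^ 5 + 4 * u_x ^ 3 * u_y + 3 * u_x * u_y ^ 2) * u_xxx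
    + (3 * u_x ^ 2 + 2 * u_y) * u_xyt
    + (1 / 2 : ℝ) • ((3 * u_x ^ 2 + 2 * u_y) * u_xy ^ 2)
    + u_xy * (3 * u_x * u_xt + u_yt) + (3 / 2 : ℝ) • u_xt ^ 2)

def phi14 : Section :=
  (0, (5 * u_x ^ 4 + 12 * u_x ^ 2 * u_y + 3 * u_y ^ 2) * u_xxt
    + u_x * (u_x ^ 2 + u_y) * (u_x ^ 2 + 3 * u_y) * u_xxy
    + (6 * u_x ^ 2 + 3 * u_y) * u_xtt + 3 * u_x * u_ytt
    + (3 * u_x ^ 5 + 10 * u_x ^ 3 * u_y + 6 * u_x * u_y ^ 2) * u_xx ^ 2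
    + ((5 * u_x ^ 4 + 12 * u_x ^ 2 * u_y + 3 * u_y ^ 2) * u_xy
        + (10 * u_x ^ 3 + 12 * u_x * u_y) * u_xt + 3 * (2 * u_x ^ 2 + u_y) * u_yt) * u_xx
    + (u_x ^ 6 + 5 * u_x ^ 4 * u_y + 6 * u_x ^ 2 * u_y ^ 2 + u_y ^ 3) * u_xxx
    + (4 * u_x ^ 3 + 6 * u_x * u_y) * u_xyt + u_ttt
    + (2 * u_x ^ 3 + 3 * u_x * u_y) * u_xy ^ 2
    + u_xy * (3 * u_yt * u_x + u_xt * (6 * u_x ^ 2 + 3 * u_y))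
    + 6 * u_x * u_xt ^ 2 + 3 * u_yt * u_xt)

def phi15 (ϑ : TFun) : Section := (0, lift ϑ)

def phi16 (ϑ : TFun) : Section := (0, u_x * lift ϑ + (1 / 2 : ℝ) • (Y * lift (d ϑ)))

def phi17 (ϑ : TFun) : Section :=
  (0, ((3 / 2 : ℝ) • u_x ^ 2 + u_y) * lift ϑ + (Y * u_x + (1 / 2 : ℝ) • X) * lift (d ϑ)
    + (1 / 4 : ℝ) • (Y ^ 2 * lift (d (d ϑ))))

def phi18 (ϑ : TFun) : Section :=
  (0, (2 * u_x ^ 3 + 3 * u_x * u_y + u_t) * lift ϑ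
    + ((3 / 2 : ℝ) • (Y * u_x ^ 2) + X * u_x + Y * u_y + (1 / 2 : ℝ) • u) * lift (d ϑ)
    + (1 / 2 : ℝ) • (Y * (Y * u_x + X) * lift (d (d ϑ)))
    + (1 / 12 : ℝ) • (Y ^ 3 * lift (d (d (d ϑ)))))

/-- The generators in one list: `gen i ϑ` is `φᵢ[ϑ]` when `φᵢ` depends on a function of `t`, and
`φᵢ` (whatever `ϑ`) when it does not. The indices are `1, …, 18`. -/
def gen : ℕ → TFun → Section
  | 1, _ => phi1
  | 2, _ => phi2
  | 3, ϑ => phi3 ϑ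
  | 4, ϑ => phi4 ϑ
  | 5, ϑ => phi5 ϑ
  | 6, ϑ => phi6 ϑ
  | 7, _ => phi7
  | 8, _ => phi8
  | 9, _ => phi9
  | 10, _ => phi10
  | 11, _ => phi11
  | 12, _ => phi12
  | 13, _ => phi13
  | 14, _ => phi14
  | 15, ϑ => phi15 ϑ
  | 16, ϑ => phi16 ϑ
  | 17, ϑ => phi17 ϑ
  | 18, ϑ => phi18 ϑ
  | _, _ => 0

/-- The general combination of the generators, with ten real parameters and eight smooth functions
of `t` as parameters. -/
def combination (c : Fin 10 → ℝ) (ϑ : Fin 8 → TFun) : Section :=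
  c 0 • phi1 + c 1 • phi2 + phi3 (ϑ 0) + phi4 (ϑ 1) + phi5 (ϑ 2) + phi6 (ϑ 3)
    + c 2 • phi7 + c 3 • phi8 + c 4 • phi9 + c 5 • phi10 + c 6 • phi11 + c 7 • phi12
    + c 8 • phi13 + c 9 • phi14
    + phi15 (ϑ 4) + phi16 (ϑ 5) + phi17 (ϑ 6) + phi18 (ϑ 7)

/-- The real span of the evolutionary fields of the generators with indices in `I`, the functions
`ϑ` being arbitrary. -/
def spanGen (I : Set ℕ) : Submodule ℝ (VF) :=
  Submodule.span ℝ {Z | ∃ i ∈ I, ∃ ϑ : TFun, Z = Ev (gen i ϑ)}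

/-- `𝔰(2) = ⟨φ₁, φ₂⟩`. -/
def s2 : Submodule ℝ (VF) := spanGen {1, 2}
/-- `𝔞(1) = ⟨φ₇⟩`. -/
def a1 : Submodule ℝ (VF) := spanGen {7}
/-- `𝔞(7) = ⟨φ₈, …, φ₁₄⟩`. -/
def a7 : Submodule ℝ (VF) := spanGen (Set.Icc 8 14)
/-- `𝔞𝔱(4) = ⟨φ₁₅[ϑ], …, φ₁₈[ϑ]⟩`. -/
def at4 : Submodule ℝ (VF) := spanGen (Set.Icc 15 18)
/-- `𝔤𝔱(4) = ⟨φ₃[ϑ], …, φ₆[ϑ]⟩`. -/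
def gt4 : Submodule ℝ (VF) := spanGen (Set.Icc 3 6)

/-- The pairs `(i, j)` with `i ≤ j` for which some bracket of `φᵢ` and `φⱼ` is listed as nonzero. -/
def listedPairs : Set (ℕ × ℕ) :=
  {(1, 2),
    (1, 4), (1, 5), (1, 9), (1, 10), (1, 11), (1, 12), (1, 13), (1, 14), (1, 16), (1, 17), (1, 18),
    (2, 3), (2, 4), (2, 5), (2, 8), (2, 9), (2, 10), (2, 12), (2, 13), (2, 14), (2, 16), (2, 17),
    (2, 18),
    (3, 6), (4, 5), (4, 6), (5, 5), (5, 6), (6, 6),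
    (7, 8), (7, 9), (7, 10), (7, 11), (7, 12), (7, 13), (7, 14), (7, 15), (7, 16), (7, 17), (7, 18),
    (3, 14), (3, 18),
    (4, 13), (4, 14), (4, 17), (4, 18),
    (5, 12), (5, 13), (5, 14), (5, 16), (5, 17), (5, 18),
    (6, 11), (6, 12), (6, 13), (6, 14), (6, 15), (6, 16), (6, 17), (6, 18)}

/-! ## Internal direct and semidirect sums -/

/-- `V` is closed under the bracket. -/
def IsSubalg {L : Type*} [LieRing L] [LieAlgebra ℝ L] (V : Submodule ℝ L) : Prop :=
  ∀ a ∈ V, ∀ b ∈ V, ⁅a, b⁆ ∈ V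

/-- The bracket vanishes on `V`. -/
def IsAbelianOn {L : Type*} [LieRing L] [LieAlgebra ℝ L] (V : Submodule ℝ L) : Prop :=
  ∀ a ∈ V, ∀ b ∈ V, ⁅a, b⁆ = 0

/-- `G` is the internal direct sum `A ⊕ B` of Lie algebras. -/
structure IsDirectSum {L : Type*} [LieRing L] [LieAlgebra ℝ L] (G A B : Submodule ℝ L) :
    Prop where
  left : IsSubalg A
  right : IsSubalg B
  commute : ∀ a ∈ A, ∀ b ∈ B, ⁅a, b⁆ = 0
  disjoint : Disjoint A B
  sup_eq : A ⊔ B = G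

/-- `G` is the internal semidirect product `H ⋉ N` of Lie algebras, `N` being the ideal. -/
structure IsSemidirect {L : Type*} [LieRing L] [LieAlgebra ℝ L] (G H N : Submodule ℝ L) :
    Prop where
  left : IsSubalg H
  right : IsSubalg N
  act : ∀ h ∈ H, ∀ n ∈ N, ⁅h, n⁆ ∈ N
  disjoint : Disjoint H N
  sup_eq : H ⊔ N = G

end PavlovMikhalev

end

open PavlovMikhalev

open scoped ContDiff
open PavlovMikhalev

namespace PavlovMikhalev

set_option linter.unusedSimpArgs false
set_option maxRecDepth 10000

/-! ### Hadamard's lemma -/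

section Hadamard

open MeasureTheory intervalIntegral

variable {E F : Type} [NormedAddCommGroup E] [NormedSpace ℝ E] [FiniteDimensional ℝ E]
  [NormedAddCommGroup F] [NormedSpace ℝ F]

/-! By Hadamard's lemma a derivation of the algebra of smooth functions is determined by its values
on the coordinates (`VF.ext`). A symmetry Z kills x, y, t, and so do its brackets with the total
derivatives; since these brackets lie in the Cartan module, they vanish. Hence Z commutes with the
total derivatives, Z = `Ev φ` with φ = (Zu, Zv), and what remains is the linearized system
(`mem_symE_iff`). It is triangular: the u-component solves `linOp (-1) f = 0`, and (0, f) is a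
symmetry exactly when `linOp 2 f = 0`.

The order of a solution is controlled by its principal symbol. The characteristic conic η² = ξτ -
u_x ξη + u_y ξ² is rational: for ξ = 1 it is parametrized by η = λ - u_x, τ = λ² - u_x λ - u_y. The
derivatives of f of leading order N along the jets of one unknown, restricted to the conic, form a
polynomial Φ(λ), the `symbol`; comparing the parity of degrees, Φ = 0 forces all these derivatives
to vanish (`comp_add_mul_comp_eq_zero`). The two leading orders of `linOp c f = 0` combine into the
transport equation ((λ - u_x)² + u_y) D_x Φ - (2λ - u_x) D_y Φ + D_t Φ = κ (u_xx (λ - u_x) - u_xy) Φ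
with κ = c - w - N, where w is -1 for u and 2 for v (`symbol_transport`).

Its coefficients are found from the top power of λ downwards, each by an integration in x. A
right-hand side is integrable only if the Euler operators annihilate it, and these obstructions
force Φ = 0 when κ ≠ 0 (`Transport.eq_zero`) and constant coefficients when κ = 0
(`Transport.exists_const`).

The values of κ then decide everything. For c = -1 they are -3 - N along v and -N along u, so the
u-component is free of v and of first order in u. For c = 2 they are -N along v, so that v enters
only through a constant multiple of v, which is φ₇; and 3 - N along u, so that the order in u is at
most three. At N = 3 the symbol has degree at most 6 and constant coefficients, while φ₈, …, φ₁₄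
have the symbols 1, λ, …, λ⁶. After subtracting them κ = 1 at N = 2, and order one is left.

For u the transport equation requires N ≥ 2, so order one is treated directly: the derivatives of f
along u_t, u_y, u_x are integrated in x, and the linearized equation restricts the integration
constants, which are functions of y and t (`exists_u_component`, `exists_v_component`). What
survives is a function of t for each of φ₃, …, φ₆ and φ₁₅, …, φ₁₈, and two constants for φ₁ and φ₂.
The same derivatives and the symbol of order three recover the parameters, whence uniqueness.

The brackets are polynomial identities in jet coordinates. The sections φ₈, …, φ₁₈ have no
u-component and do not involve v, so they commute with each other, and φ₇ acts on them by -1.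
Disjointness of the summands comes from uniqueness, the remaining properties of the decomposition
from the table. -/

theorem hasFDerivAt_integral_unitInterval {G : E × ℝ → F} (hG : ContDiff ℝ ∞ G) (x : E) :
    HasFDerivAt (fun y => ∫ s in (0 : ℝ)..1, G (y, s))
      (∫ s in (0 : ℝ)..1, (fderiv ℝ G (x, s)).comp (ContinuousLinearMap.inl ℝ E ℝ)) x := by
  have hc : Continuous fun z : E × ℝ =>
      (fderiv ℝ G z).comp (ContinuousLinearMap.inl ℝ E ℝ) :=
    (hG.continuous_fderiv (by simp)).clm_comp continuous_const
  have : ProperSpace E := FiniteDimensional.proper ℝ E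
  -- The derivative is bounded on the compact product of a closed ball and [0, 1]; this constant
  -- dominates the differentiated integrand.
  obtain ⟨C, hC⟩ := ((isCompact_closedBall x 1).prod (isCompact_Icc (a := (0 : ℝ)) (b := 1))
    ).exists_bound_of_continuousOn hc.continuousOn
  refine hasFDerivAt_integral_of_dominated_of_fderiv_le (s := Metric.ball x 1) (bound := fun _ => C)
    (F' := fun y s => (fderiv ℝ G (y, s)).comp (ContinuousLinearMap.inl ℝ E ℝ))
    (Metric.ball_mem_nhds x one_pos) ?_ ?_ ?_ ?_ ?_ ?_
  · exact Filter.Eventually.of_forall fun y =>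
      (hG.continuous.comp (by fun_prop : Continuous fun s : ℝ => (y, s))).aestronglyMeasurable
  · exact (hG.continuous.comp (by fun_prop : Continuous fun s : ℝ => (x, s))).intervalIntegrable _ _
  · exact (hc.comp (by fun_prop : Continuous fun s : ℝ => (x, s))).aestronglyMeasurable
  · refine Filter.Eventually.of_forall fun s hs y hy => hC (y, s) ⟨Metric.ball_subset_closedBall hy, ?_⟩
    rw [Set.uIoc_of_le zero_le_one] at hs
    exact Set.Ioc_subset_Icc_self hs
  · exact intervalIntegrable_const
  · refine Filter.Eventually.of_forall fun s _ y _ => ?_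
    have h1 : HasFDerivAt G (fderiv ℝ G (y, s)) (y, s) :=
      (hG.differentiable (by simp)).differentiableAt.hasFDerivAt
    exact h1.comp y (hasFDerivAt_prodMk_left y s)

theorem contDiff_integral_unitInterval {G : E × ℝ → F} (hG : ContDiff ℝ ∞ G) :
    ContDiff ℝ ∞ fun y => ∫ s in (0 : ℝ)..1, G (y, s) := by
  refine contDiff_infty.2 fun n => ?_
  -- The derivative is an integral of the same kind with values in a space of linear maps, so the
  -- target has to vary in the induction.
  induction n generalizing F with
  | zero =>
    refine contDiff_zero.2 ?_
    exact continuous_iff_continuousAt.2 fun x =>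
      (hasFDerivAt_integral_unitInterval hG x).continuousAt
  | succ n ih =>
    refine contDiff_succ_iff_hasFDerivAt.2 ⟨_, ?_, fun x => hasFDerivAt_integral_unitInterval hG x⟩
    exact ih (G := fun z => (fderiv ℝ G z).comp (ContinuousLinearMap.inl ℝ E ℝ))
      ((hG.fderiv_right (m := ∞) (by simp)).clm_comp contDiff_const)

/-- Hadamard's lemma on `ℝⁿ`. -/
theorem exists_hadamard {ι : Type} [Fintype ι] [DecidableEq ι] {g : (ι → ℝ) → ℝ} (hg : ContDiff ℝ ∞ g) (a : ι → ℝ) :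
    ∃ h : ι → (ι → ℝ) → ℝ, (∀ i, ContDiff ℝ ∞ (h i)) ∧
      (∀ i, h i a = fderiv ℝ g a (Pi.single i 1)) ∧
      ∀ q, g q = g a + ∑ i, (q i - a i) * h i q := by
  -- The fundamental theorem of calculus along the segment from a to q: h_i(q) is the average of ∂_i
  -- g over this segment.
  refine ⟨fun i q => ∫ s in (0 : ℝ)..1, fderiv ℝ g (a + s • (q - a)) (Pi.single i 1),
    fun i => ?_, fun i => by simp, fun q => ?_⟩
  · refine contDiff_integral_unitInterval
      (G := fun z : (ι → ℝ) × ℝ => fderiv ℝ g (a + z.2 • (z.1 - a)) (Pi.single i 1)) ?_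
    refine ContDiff.clm_apply ?_ contDiff_const
    exact (hg.fderiv_right (m := ∞) (by simp)).comp (by fun_prop)
  · have hd : ∀ s ∈ Set.uIcc (0 : ℝ) 1, HasDerivAt (fun s : ℝ => g (a + s • (q - a)))
        (fderiv ℝ g (a + s • (q - a)) (q - a)) s := fun s _ => by
      have h1 : HasFDerivAt g (fderiv ℝ g (a + s • (q - a))) (a + s • (q - a)) :=
        (hg.differentiable (by simp)).differentiableAt.hasFDerivAt
      have h2 : HasDerivAt (fun s : ℝ => a + s • (q - a)) (q - a) s := by
        simpa using ((hasDerivAt_id s).smul_const (q - a)).const_add a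
      exact h1.comp_hasDerivAt s h2
    have hcd : ∀ w : ι → ℝ, Continuous fun s : ℝ => fderiv ℝ g (a + s • (q - a)) w := fun w =>
      ((hg.continuous_fderiv (by simp)).comp (by fun_prop)).clm_apply continuous_const
    have := integral_eq_sub_of_hasDerivAt hd ((hcd _).intervalIntegrable _ _)
    simp only [one_smul, zero_smul, add_zero, add_sub_cancel] at this
    rw [← sub_eq_iff_eq_add', ← this]
    have e : ∀ s : ℝ, fderiv ℝ g (a + s • (q - a)) (q - a) =
        ∑ i, (q i - a i) * fderiv ℝ g (a + s • (q - a)) (Pi.single i 1) := fun s => by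
      have : q - a = ∑ i, (q i - a i) • Pi.single i (1 : ℝ) := by
        conv_lhs => rw [pi_eq_sum_univ' (q - a)]
        simp
      conv_lhs => rw [this, map_sum]
      simp only [map_smul, smul_eq_mul, ← this]
    simp only [e]
    rw [integral_finsetSum fun i _ => ((hcd _).const_mul _).intervalIntegrable _ _]
    simp only [intervalIntegral.integral_const_mul]

end Hadamard

/-! ## Vector fields are determined by their components -/

theorem FE.ext {f g : FE} (h : ∀ p, f.1 p = g.1 p) : f = g := Subtype.ext (funext h)

def evalAt (p : Point) : FE →ₐ[ℝ] ℝ := (Pi.evalAlgHom ℝ _ p).comp smoothSubalgebra.val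

theorem evalAt_apply (p : Point) (f : FE) : evalAt p f = f.1 p := rfl

theorem evalAt_co (p : Point) (c : Coord) : evalAt p (co c) = p c := rfl

theorem FE.ext_evalAt {f g : FE} (h : ∀ p, evalAt p f = evalAt p g) : f = g := FE.ext h

/-- Expands f at p in the finitely many coordinates that it depends on, which makes f accessible to
derivations that are given only algebraically. -/
theorem hadamard (f : FE) (p : Point) : ∃ (s : Finset Coord) (h : Coord → FE),
    f = algebraMap ℝ FE (evalAt p f) + ∑ c ∈ s, (co c - algebraMap ℝ FE (p c)) * h c := by
  classical
  obtain ⟨s, g, hg, hf⟩ := f.2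
  obtain ⟨h, hh, -, e⟩ := exists_hadamard hg (fun i : s => p i)
  refine ⟨s, fun c => if hc : c ∈ s then
    ⟨fun q => h ⟨c, hc⟩ (fun i => q i), s, h ⟨c, hc⟩, hh _, fun _ => rfl⟩ else 0, ?_⟩
  refine FE.ext_evalAt fun q => ?_
  rw [map_add, map_sum, AlgHom.commutes]
  simp only [map_mul, map_sub, evalAt_co, AlgHom.commutes]
  rw [evalAt_apply, evalAt_apply, hf, hf, e, ← Finset.sum_coe_sort s]
  simp
  rfl

/-- Apply a derivation to the Hadamard expansion at p and evaluate at p: the terms that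
differentiate a cofactor carry a factor vanishing at p, and only the values on coordinates remain.
No continuity of the derivation is involved. -/
theorem VF.ext {Z W : VF} (h : ∀ c, Z (co c) = W (co c)) : Z = W := by
  ext f
  refine FE.ext_evalAt fun p => ?_
  obtain ⟨s, k, e⟩ := hadamard f p
  have key : ∀ V : VF, evalAt p (V f) = ∑ c ∈ s, evalAt p (k c) * evalAt p (V (co c)) := fun V => by
    conv_lhs => rw [e]
    simp only [map_add, Derivation.map_algebraMap, map_sum, Derivation.leibniz, smul_eq_mul,
      map_mul, map_sub, evalAt_co, AlgHom.commutes]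
    simp
  rw [key, key]
  simp [h]

open Classical in
theorem pd_co (c c' : Coord) : pd c (co c') = if c = c' then 1 else 0 := by
  refine FE.ext fun p => ?_
  change deriv (fun r => Function.update p c r c') (p c) = _
  split_ifs with h
  · subst h
    simp
    rfl
  · simp [Function.update_of_ne (Ne.symm h)]
    rfl

@[simp]
theorem pd_co_self (c : Coord) : pd c (co c) = 1 := by simp [pd_co]

theorem pd_co_of_ne {c c' : Coord} (h : c ≠ c') : pd c (co c') = 0 := by simp [pd_co, h]

theorem vf_apply (a : Coord → FE) (f : FE) : vf a f = ∑ᶠ c, a c * pd c f := rfl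

@[simp]
theorem vf_co (a : Coord → FE) (c : Coord) : vf a (co c) = a c := by
  rw [vf_apply, finsum_eq_single _ c]
  · simp
  · intro c' hc
    simp [pd_co_of_ne hc]

theorem VF.eq_vf (Z : VF) : Z = vf fun c => Z (co c) := VF.ext fun c => by simp

theorem VF.apply_eq_sum (Z : VF) (f : FE) : Z f = ∑ᶠ c, Z (co c) * pd c f := by
  conv_lhs => rw [Z.eq_vf]
  rw [vf_apply]

theorem VF.apply_eq_finset_sum (Z : VF) (f : FE) (s : Finset Coord)
    (hs : ∀ c ∉ s, pd c f = 0) : Z f = ∑ c ∈ s, Z (co c) * pd c f := by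
  rw [Z.apply_eq_sum, finsum_eq_sum_of_support_subset]
  intro c hc
  by_contra h
  exact hc (by simp [hs c h])

theorem exists_pd_eq_zero (f : FE) : ∃ s : Finset Coord, ∀ c ∉ s, pd c f = 0 := by
  obtain ⟨s, hs⟩ := f.2
  exact ⟨s, fun c hc => Subtype.ext (show pdFun c f.1 = 0 from hs.pd_notMem hc)⟩

/-- Two vector fields whose commutator vanishes on the coordinates commute. -/
theorem VF.comm_of_co {Z W : VF} (h : ∀ c, Z (W (co c)) = W (Z (co c))) (f : FE) :
    Z (W f) = W (Z f) := by
  have : ⁅Z, W⁆ = 0 := VF.ext fun c => by simp [Derivation.commutator_apply, h c]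
  have h2 := congrArg (fun V : VF => V f) this
  simpa [Derivation.commutator_apply, sub_eq_zero] using h2

theorem pd_comm (c c' : Coord) (f : FE) : pd c (pd c' f) = pd c' (pd c f) :=
  VF.comm_of_co (fun b => by
    rw [pd_co, pd_co]
    split_ifs <;> simp) f

/-! ## Total derivatives of the coordinates -/

section

@[simp] theorem Dx_x : Dx (co .x) = 1 := vf_co _ _
@[simp] theorem Dx_y : Dx (co .y) = 0 := vf_co _ _
@[simp] theorem Dx_t : Dx (co .t) = 0 := vf_co _ _
@[simp] theorem Dx_u0 (k l : ℕ) : Dx (co (.u0 k l)) = co (.u0 (k + 1) l) := vf_co _ _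
@[simp] theorem Dx_u1 (k l : ℕ) : Dx (co (.u1 k l)) = co (.u1 (k + 1) l) := vf_co _ _
@[simp] theorem Dx_v0 (k l : ℕ) : Dx (co (.v0 k l)) = co (.v0 (k + 1) l) := vf_co _ _
@[simp] theorem Dx_v1 (k l : ℕ) : Dx (co (.v1 k l)) = co (.v1 (k + 1) l) := vf_co _ _
@[simp] theorem Dt_x : Dt (co .x) = 0 := vf_co _ _
@[simp] theorem Dt_y : Dt (co .y) = 0 := vf_co _ _
@[simp] theorem Dt_t : Dt (co .t) = 1 := vf_co _ _
@[simp] theorem Dt_u0 (k l : ℕ) : Dt (co (.u0 k l)) = co (.u0 k (l + 1)) := vf_co _ _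
@[simp] theorem Dt_u1 (k l : ℕ) : Dt (co (.u1 k l)) = co (.u1 k (l + 1)) := vf_co _ _
@[simp] theorem Dt_v0 (k l : ℕ) : Dt (co (.v0 k l)) = co (.v0 k (l + 1)) := vf_co _ _
@[simp] theorem Dt_v1 (k l : ℕ) : Dt (co (.v1 k l)) = co (.v1 k (l + 1)) := vf_co _ _
@[simp] theorem Dy_x : Dy (co .x) = 0 := vf_co _ _
@[simp] theorem Dy_y : Dy (co .y) = 1 := vf_co _ _
@[simp] theorem Dy_t : Dy (co .t) = 0 := vf_co _ _
@[simp] theorem Dy_u0 (k l : ℕ) : Dy (co (.u0 k l)) = co (.u1 k l) := vf_co _ _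
@[simp] theorem Dy_v0 (k l : ℕ) : Dy (co (.v0 k l)) = co (.v1 k l) := vf_co _ _
theorem Dy_u1 (k l : ℕ) : Dy (co (.u1 k l)) = Dx^[k] (Dt^[l] rhsU) := vf_co _ _
theorem Dy_v1 (k l : ℕ) : Dy (co (.v1 k l)) = Dx^[k] (Dt^[l] rhsV) := vf_co _ _

end

theorem Dx_Dt (f : FE) : Dx (Dt f) = Dt (Dx f) :=
  VF.comm_of_co (fun c => by cases c <;> simp) f

theorem iterate_comm {Z W : VF} (h : ∀ f, Z (W f) = W (Z f)) (n : ℕ) (f : FE) :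
    Z (W^[n] f) = W^[n] (Z f) :=
  (Function.Commute.iterate_right (f := Z) (g := W) h n) f

theorem Dx_Dy (f : FE) : Dx (Dy f) = Dy (Dx f) :=
  VF.comm_of_co (fun c => by
    cases c <;> simp [Dy_u1, Dy_v1, Function.iterate_succ_apply']) f

theorem Dt_Dy (f : FE) : Dt (Dy f) = Dy (Dt f) :=
  VF.comm_of_co (fun c => by
    cases c <;> simp [Dy_u1, Dy_v1, Function.iterate_succ_apply',
      iterate_comm (Z := Dt) (W := Dx) fun f => (Dx_Dt f).symm]) f

/-! ## Evolutionary fields -/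

@[simp] theorem Ev_x (φ : Section) : Ev φ (co .x) = 0 := vf_co _ _
@[simp] theorem Ev_y (φ : Section) : Ev φ (co .y) = 0 := vf_co _ _
@[simp] theorem Ev_t (φ : Section) : Ev φ (co .t) = 0 := vf_co _ _
theorem Ev_u0 (φ : Section) (k l : ℕ) : Ev φ (co (.u0 k l)) = Dx^[k] (Dt^[l] φ.1) := vf_co _ _
theorem Ev_u1 (φ : Section) (k l : ℕ) : Ev φ (co (.u1 k l)) = Dx^[k] (Dt^[l] (Dy φ.1)) := vf_co _ _
theorem Ev_v0 (φ : Section) (k l : ℕ) : Ev φ (co (.v0 k l)) = Dx^[k] (Dt^[l] φ.2) := vf_co _ _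
theorem Ev_v1 (φ : Section) (k l : ℕ) : Ev φ (co (.v1 k l)) = Dx^[k] (Dt^[l] (Dy φ.2)) := vf_co _ _

theorem Ev_u (φ : Section) : Ev φ u = φ.1 := Ev_u0 φ 0 0
theorem Ev_v (φ : Section) : Ev φ v = φ.2 := Ev_v0 φ 0 0

theorem Dt_iterate_Dx (k : ℕ) (f : FE) : Dt (Dx^[k] f) = Dx^[k] (Dt f) :=
  iterate_comm (fun f => (Dx_Dt f).symm) k f

theorem Dy_iterate_Dx (k : ℕ) (f : FE) : Dy (Dx^[k] f) = Dx^[k] (Dy f) :=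
  iterate_comm (fun f => (Dx_Dy f).symm) k f

theorem Dy_iterate_Dt (k : ℕ) (f : FE) : Dy (Dt^[k] f) = Dt^[k] (Dy f) :=
  iterate_comm (fun f => (Dt_Dy f).symm) k f

theorem Ev_Dx (φ : Section) (f : FE) : Ev φ (Dx f) = Dx (Ev φ f) :=
  VF.comm_of_co (fun c => by
    cases c <;> simp [Ev_u0, Ev_u1, Ev_v0, Ev_v1, Function.iterate_succ_apply']) f

theorem Ev_Dt (φ : Section) (f : FE) : Ev φ (Dt f) = Dt (Ev φ f) :=
  VF.comm_of_co (fun c => by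
    cases c <;> simp [Ev_u0, Ev_u1, Ev_v0, Ev_v1, Function.iterate_succ_apply', Dt_iterate_Dx]) f

/-- The linearized equation, as a condition on generating sections. -/
def IsGenerating (φ : Section) : Prop :=
  Dy (Dy φ.1) = Ev φ rhsU ∧ Dy (Dy φ.2) = Ev φ rhsV

/-- On the coordinates u₁ and v₁, which `Dy` sends to differentiated right-hand sides of the system,
commutation is the linearized equation; on all others it is automatic. -/
theorem Ev_Dy {φ : Section} (h : IsGenerating φ) (f : FE) : Ev φ (Dy f) = Dy (Ev φ f) := by
  have h1 : ∀ n f, Ev φ (Dx^[n] f) = Dx^[n] (Ev φ f) := iterate_comm (Ev_Dx φ)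
  have h2 : ∀ n f, Ev φ (Dt^[n] f) = Dt^[n] (Ev φ f) := iterate_comm (Ev_Dt φ)
  refine VF.comm_of_co (fun c => ?_) f
  cases c <;> simp [Ev_u0, Ev_u1, Ev_v0, Ev_v1, Dy_u1, Dy_v1, Dy_iterate_Dx, Dy_iterate_Dt, h1, h2,
    h.1, h.2]

/-! ### Symmetries as evolutionary fields -/

theorem mem_Cartan_iff {Z : VF} : Z ∈ Cartan ↔ ∃ a b c : FE, a • Dx + b • Dy + c • Dt = Z := by
  rw [Cartan, Submodule.mem_span_triple]

/-- The values on x, y, t of a combination of `Dx`, `Dy`, `Dt` are its coefficients. -/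
theorem eq_zero_of_mem_Cartan {Z : VF} (h : Z ∈ Cartan) (hx : Z (co .x) = 0) (hy : Z (co .y) = 0)
    (ht : Z (co .t) = 0) : Z = 0 := by
  obtain ⟨a, b, c, rfl⟩ := mem_Cartan_iff.1 h
  simp at hx hy ht
  simp [hx, hy, ht]

theorem Dx_mem : Dx ∈ Cartan := Submodule.subset_span (by simp)
theorem Dy_mem : Dy ∈ Cartan := Submodule.subset_span (by simp)
theorem Dt_mem : Dt ∈ Cartan := Submodule.subset_span (by simp)

theorem apply_comm_of_lie_eq_zero {Z W : VF} (h : ⁅Z, W⁆ = 0) (f : FE) : Z (W f) = W (Z f) := by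
  have h2 := congrArg (fun V : VF => V f) h
  simpa [Derivation.commutator_apply, sub_eq_zero] using h2

theorem Ev_mem_symE {φ : Section} (h : IsGenerating φ) : Ev φ ∈ symE := by
  refine ⟨⟨by simp, by simp, by simp⟩, fun C hC => ?_⟩
  obtain ⟨a, b, c, rfl⟩ := mem_Cartan_iff.1 hC
  refine mem_Cartan_iff.2 ⟨Ev φ a, Ev φ b, Ev φ c, VF.ext fun k => ?_⟩
  simp only [Derivation.commutator_apply, Derivation.add_apply, Derivation.smul_apply, map_add,
    smul_eq_mul, Derivation.leibniz, Ev_Dx, Ev_Dt, Ev_Dy h]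
  ring

/-- The total derivatives of x, y, t are constants, so the brackets of Z with `Dx`, `Dy`, `Dt` kill
x, y, t; being in the Cartan module, they are zero. Every jet coordinate is a total derivative of u
or v, hence Z is evolutionary, and applying Z to the two equations of the system yields the
linearized equations. -/
theorem mem_symE_iff {Z : VF} : Z ∈ symE ↔ ∃ φ, IsGenerating φ ∧ Z = Ev φ := by
  constructor
  · rintro ⟨⟨hx, hy, ht⟩, h⟩
    have h1 : ∀ f, Z (Dx f) = Dx (Z f) := apply_comm_of_lie_eq_zero
      (eq_zero_of_mem_Cartan (h _ Dx_mem) (by simp [Derivation.commutator_apply, hx])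
        (by simp [Derivation.commutator_apply, hy]) (by simp [Derivation.commutator_apply, ht]))
    have h2 : ∀ f, Z (Dy f) = Dy (Z f) := apply_comm_of_lie_eq_zero
      (eq_zero_of_mem_Cartan (h _ Dy_mem) (by simp [Derivation.commutator_apply, hx])
        (by simp [Derivation.commutator_apply, hy]) (by simp [Derivation.commutator_apply, ht]))
    have h3 : ∀ f, Z (Dt f) = Dt (Z f) := apply_comm_of_lie_eq_zero
      (eq_zero_of_mem_Cartan (h _ Dt_mem) (by simp [Derivation.commutator_apply, hx])
        (by simp [Derivation.commutator_apply, hy]) (by simp [Derivation.commutator_apply, ht]))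
    have cu : ∀ k l, co (.u0 k l) = Dx^[k] (Dt^[l] u) := fun k l => by
      induction k with
      | zero => induction l with
        | zero => rfl
        | succ l ih => simpa [Function.iterate_succ_apply'] using congrArg Dt ih
      | succ k ih => simpa [Function.iterate_succ_apply'] using congrArg Dx ih
    have cv : ∀ k l, co (.v0 k l) = Dx^[k] (Dt^[l] v) := fun k l => by
      induction k with
      | zero => induction l with
        | zero => rfl
        | succ l ih => simpa [Function.iterate_succ_apply'] using congrArg Dt ih
      | succ k ih => simpa [Function.iterate_succ_apply'] using congrArg Dx ih
    have e : Z = Ev (Z u, Z v) := VF.ext fun c => by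
      cases c with
      | x => simp [hx]
      | y => simp [hy]
      | t => simp [ht]
      | u0 k l => rw [Ev_u0, cu, iterate_comm h1, iterate_comm h3]
      | u1 k l => rw [Ev_u1, ← Dy_u0, h2, cu, iterate_comm h1, iterate_comm h3, Dy_iterate_Dx,
          Dy_iterate_Dt]
      | v0 k l => rw [Ev_v0, cv, iterate_comm h1, iterate_comm h3]
      | v1 k l => rw [Ev_v1, ← Dy_v0, h2, cv, iterate_comm h1, iterate_comm h3, Dy_iterate_Dx,
          Dy_iterate_Dt]
    refine ⟨(Z u, Z v), ⟨?_, ?_⟩, e⟩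
    · rw [← e, ← h2, ← h2]
      congr 1
      exact (congrArg Dy (Dy_u0 0 0)).trans (Dy_u1 0 0)
    · rw [← e, ← h2, ← h2]
      congr 1
      exact (congrArg Dy (Dy_v0 0 0)).trans (Dy_v1 0 0)
  · rintro ⟨φ, h, rfl⟩
    exact Ev_mem_symE h

theorem Ev_injective : Function.Injective Ev := fun φ ψ h =>
  Prod.ext (by rw [← Ev_u φ, h, Ev_u]) (by rw [← Ev_v φ, h, Ev_v])

theorem Ev_mem_symE_iff {φ : Section} : Ev φ ∈ symE ↔ IsGenerating φ := by
  rw [mem_symE_iff]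
  exact ⟨fun ⟨ψ, h, e⟩ => Ev_injective e ▸ h, fun h => ⟨φ, h, rfl⟩⟩

theorem Ev_add (φ ψ : Section) : Ev (φ + ψ) = Ev φ + Ev ψ :=
  VF.ext fun c => by
    cases c <;> simp [Ev_u0, Ev_u1, Ev_v0, Ev_v1, iterate_map_add]

theorem Ev_smul (r : ℝ) (φ : Section) : Ev (r • φ) = r • Ev φ :=
  VF.ext fun c => by
    have h1 : ∀ n f, Dx^[n] (r • f) = r • Dx^[n] f := fun n f => by
      induction n generalizing f with
      | zero => rfl
      | succ n ih => simp [ih]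
    have h2 : ∀ n f, Dt^[n] (r • f) = r • Dt^[n] f := fun n f => by
      induction n generalizing f with
      | zero => rfl
      | succ n ih => simp [ih]
    cases c <;> simp [Ev_u0, Ev_u1, Ev_v0, Ev_v1, h1, h2]

/-- The map from sections to evolutionary fields. -/
noncomputable def EvHom : Section →ₗ[ℝ] VF where
  toFun := Ev
  map_add' := Ev_add
  map_smul' := Ev_smul

/-- The commutator is again a symmetry, hence evolutionary, and its generating section is read off
on u and v. -/
theorem lie_Ev {φ ψ : Section} (hφ : IsGenerating φ) (hψ : IsGenerating ψ) :
    ⁅Ev φ, Ev ψ⁆ = Ev (jacobi φ ψ) := by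
  obtain ⟨χ, -, e⟩ := mem_symE_iff.1 (symE.lie_mem (Ev_mem_symE hφ) (Ev_mem_symE hψ))
  rw [e]
  congr 1
  refine Prod.ext ?_ ?_
  · rw [← Ev_u χ, ← e, Derivation.commutator_apply, Ev_u, Ev_u]; rfl
  · rw [← Ev_v χ, ← e, Derivation.commutator_apply, Ev_v, Ev_v]; rfl

/-! ## Functions of `t` -/

open Classical in
theorem pd_t_lift (ϑ : TFun) : pd .t (lift ϑ) = lift (d ϑ) := by
  refine FE.ext fun p => ?_
  change deriv (fun r => ϑ.1 (Function.update p Coord.t r Coord.t)) (p .t) = deriv ϑ.1 (p .t)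
  simp

open Classical in
theorem pd_lift_of_ne {c : Coord} (hc : c ≠ .t) (ϑ : TFun) : pd c (lift ϑ) = 0 := by
  refine FE.ext fun p => ?_
  change deriv (fun r => ϑ.1 (Function.update p c r Coord.t)) (p c) = 0
  simp [Function.update_of_ne hc.symm]

theorem VF.apply_lift (Z : VF) (ϑ : TFun) : Z (lift ϑ) = Z (co .t) * lift (d ϑ) := by
  rw [Z.apply_eq_finset_sum _ {.t}, Finset.sum_singleton, pd_t_lift]
  intro c hc
  exact pd_lift_of_ne (by simpa using hc) ϑ

@[simp] theorem Dx_lift (ϑ : TFun) : Dx (lift ϑ) = 0 := by simp [VF.apply_lift]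
@[simp] theorem Dy_lift (ϑ : TFun) : Dy (lift ϑ) = 0 := by simp [VF.apply_lift]
@[simp] theorem Dt_lift (ϑ : TFun) : Dt (lift ϑ) = lift (d ϑ) := by simp [VF.apply_lift]
@[simp] theorem Ev_lift (φ : Section) (ϑ : TFun) : Ev φ (lift ϑ) = 0 := by simp [VF.apply_lift]

@[simp] theorem lift_add (ϑ η : TFun) : lift (ϑ + η) = lift ϑ + lift η := rfl
@[simp] theorem lift_sub (ϑ η : TFun) : lift (ϑ - η) = lift ϑ - lift η := rfl
@[simp] theorem lift_neg (ϑ : TFun) : lift (-ϑ) = -lift ϑ := rfl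
@[simp] theorem lift_zero : lift 0 = 0 := rfl
@[simp] theorem lift_mul (ϑ η : TFun) : lift (ϑ * η) = lift ϑ * lift η := rfl
@[simp] theorem lift_smul (r : ℝ) (ϑ : TFun) : lift (r • ϑ) = r • lift ϑ := rfl
@[simp] theorem lift_ofNat (n : ℕ) [n.AtLeastTwo] :
    lift ofNat(n) = ofNat(n) := rfl

theorem lift_injective : Function.Injective lift := fun ϑ η h => by
  refine Subtype.ext (funext fun s => ?_)
  exact congrArg (fun f : FE => f.1 fun _ => s) h

/-- Transfers the rules of differentiation from the derivation `Dt` to `d`. -/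
theorem d_eq_iff {ϑ η : TFun} : d ϑ = η ↔ Dt (lift ϑ) = lift η := by
  rw [Dt_lift]
  exact lift_injective.eq_iff.symm

@[simp] theorem d_add (ϑ η : TFun) : d (ϑ + η) = d ϑ + d η := d_eq_iff.2 (by simp)
@[simp] theorem d_sub (ϑ η : TFun) : d (ϑ - η) = d ϑ - d η := d_eq_iff.2 (by simp)
@[simp] theorem d_zero : d 0 = 0 := d_eq_iff.2 (by simp)
@[simp] theorem d_smul (r : ℝ) (ϑ : TFun) : d (r • ϑ) = r • d ϑ := d_eq_iff.2 (by simp)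
@[simp] theorem d_mul (ϑ η : TFun) : d (ϑ * η) = ϑ * d η + η * d ϑ := d_eq_iff.2 (by simp)
@[simp] theorem d_ofNat (n : ℕ) [n.AtLeastTwo] : d ofNat(n) = 0 := d_eq_iff.2 (by
  rw [lift_ofNat, lift_zero]
  exact Derivation.map_natCast Dt n)

theorem Dy_u1_zero : Dy (co (.u1 0 0)) = rhsU := Dy_u1 0 0

/-! ## Rewriting rules for computations in jet coordinates -/

/-- This and the following conjunctions serve as rule sets for `simp only`; together they turn a
bracket of sections into a polynomial expression in the coordinates. -/
theorem coordinate_names : X = co .x ∧ Y = co .y ∧ u = co (.u0 0 0) ∧ v = co (.v0 0 0) ∧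
    u_x = co (.u0 1 0) ∧ u_y = co (.u1 0 0) ∧ u_t = co (.u0 0 1) ∧
    v_x = co (.v0 1 0) ∧ v_y = co (.v1 0 0) ∧ v_t = co (.v0 0 1) ∧
    u_xx = co (.u0 2 0) ∧ u_xy = co (.u1 1 0) ∧ u_xt = co (.u0 1 1) ∧ u_yt = co (.u1 0 1) ∧
    v_xx = co (.v0 2 0) ∧ v_xy = co (.v1 1 0) ∧ v_xt = co (.v0 1 1) ∧
    u_xxx = co (.u0 3 0) ∧ u_xxy = co (.u1 2 0) ∧ u_xxt = co (.u0 2 1) ∧ u_xyt = co (.u1 1 1) ∧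
    u_xtt = co (.u0 1 2) ∧ u_ytt = co (.u1 0 2) ∧ u_ttt = co (.u0 0 3) := by
  refine ⟨rfl, rfl, rfl, rfl, rfl, rfl, rfl, rfl, rfl, rfl, rfl, rfl, rfl, rfl, rfl, rfl, rfl, rfl,
    rfl, rfl, rfl, rfl, rfl, rfl⟩

theorem derivation_rules :
    (∀ (Z : VF) (f g : FE), Z (f + g) = Z f + Z g) ∧
    (∀ (Z : VF) (f g : FE), Z (f - g) = Z f - Z g) ∧
    (∀ (Z : VF) (f : FE), Z (-f) = -Z f) ∧
    (∀ (Z : VF) (f g : FE), Z (f * g) = f * Z g + g * Z f) ∧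
    (∀ (Z : VF) (r : ℝ) (f : FE), Z (r • f) = r • Z f) ∧
    (∀ (Z : VF) (n : ℕ) [n.AtLeastTwo], Z ofNat(n) = 0) ∧
    (∀ (Z : VF) (f : FE), Z (f ^ 2) = 2 * f * Z f) ∧
    (∀ (Z : VF) (f : FE) (n : ℕ) [n.AtLeastTwo], Z (f ^ ofNat(n)) = ofNat(n) * f ^ (ofNat(n) - 1) * Z f) ∧
    (∀ Z : VF, Z 0 = 0) ∧ (∀ Z : VF, Z 1 = 0) := by
  refine ⟨fun Z f g => map_add Z f g, fun Z f g => map_sub Z f g, fun Z f => map_neg Z f,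
    fun Z f g => Z.leibniz f g, fun Z r f => Z.map_smul r f, fun Z n _ => Z.map_natCast n,
    fun Z f => ?_, fun Z f n _ => ?_, fun Z => map_zero Z, fun Z => Z.map_one_eq_zero⟩
  · simp [mul_assoc]
  · rw [Derivation.leibniz_pow]
    simp [mul_assoc]

theorem total_derivatives :
    Dx (co .x) = 1 ∧ Dx (co .y) = 0 ∧ Dx (co .t) = 0 ∧
    (∀ k l, Dx (co (.u0 k l)) = co (.u0 (k + 1) l)) ∧
    (∀ k l, Dx (co (.u1 k l)) = co (.u1 (k + 1) l)) ∧
    (∀ k l, Dx (co (.v0 k l)) = co (.v0 (k + 1) l)) ∧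
    (∀ k l, Dx (co (.v1 k l)) = co (.v1 (k + 1) l)) ∧
    Dt (co .x) = 0 ∧ Dt (co .y) = 0 ∧ Dt (co .t) = 1 ∧
    (∀ k l, Dt (co (.u0 k l)) = co (.u0 k (l + 1))) ∧
    (∀ k l, Dt (co (.u1 k l)) = co (.u1 k (l + 1))) ∧
    (∀ k l, Dt (co (.v0 k l)) = co (.v0 k (l + 1))) ∧
    (∀ k l, Dt (co (.v1 k l)) = co (.v1 k (l + 1))) ∧
    Dy (co .x) = 0 ∧ Dy (co .y) = 1 ∧ Dy (co .t) = 0 ∧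
    (∀ k l, Dy (co (.u0 k l)) = co (.u1 k l)) ∧
    (∀ k l, Dy (co (.u1 k l)) = Dx^[k] (Dt^[l] rhsU)) ∧
    (∀ k l, Dy (co (.v0 k l)) = co (.v1 k l)) ∧
    (∀ k l, Dy (co (.v1 k l)) = Dx^[k] (Dt^[l] rhsV)) ∧
    (∀ ϑ, Dx (lift ϑ) = 0) ∧ (∀ ϑ, Dy (lift ϑ) = 0) ∧ (∀ ϑ, Dt (lift ϑ) = lift (d ϑ)) ∧
    rhsU = co (.u0 1 1) - co (.u0 1 0) * co (.u1 1 0) + co (.u1 0 0) * co (.u0 2 0) ∧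
    rhsV = co (.v0 1 1) - co (.u0 1 0) * co (.v1 1 0) - 2 * co (.v1 0 0) * co (.u0 2 0)
      + 2 * co (.v0 1 0) * co (.u1 1 0) + co (.u1 0 0) * co (.v0 2 0) ∧
    (∀ (Z : VF) (f : FE), Z^[0] f = f) ∧ (∀ (Z : VF) (n : ℕ) (f : FE), Z^[n + 1] f = Z^[n] (Z f)) := by
  refine ⟨?_, ?_, ?_, ?_, ?_, ?_, ?_, ?_, ?_, ?_, ?_, ?_, ?_, ?_, ?_, ?_, ?_, ?_, Dy_u1, ?_, Dy_v1,
    ?_, ?_, ?_, rfl, rfl, fun _ _ => rfl, fun _ _ _ => rfl⟩ <;> simp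

theorem evolutionary_components :
    (∀ φ, Ev φ (co .x) = 0) ∧ (∀ φ, Ev φ (co .y) = 0) ∧ (∀ φ, Ev φ (co .t) = 0) ∧
    (∀ φ ϑ, Ev φ (lift ϑ) = 0) ∧
    (∀ φ k l, Ev φ (co (.u0 k l)) = Dx^[k] (Dt^[l] φ.1)) ∧
    (∀ φ k l, Ev φ (co (.u1 k l)) = Dx^[k] (Dt^[l] (Dy φ.1))) ∧
    (∀ φ k l, Ev φ (co (.v0 k l)) = Dx^[k] (Dt^[l] φ.2)) ∧
    (∀ φ k l, Ev φ (co (.v1 k l)) = Dx^[k] (Dt^[l] (Dy φ.2))) :=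
  ⟨Ev_x, Ev_y, Ev_t, Ev_lift, Ev_u0, Ev_u1, Ev_v0, Ev_v1⟩

/-- Evaluation at a point replaces real scalar multiplication by multiplication in ℝ, so that
rational coefficients become accessible to `ring`. -/
theorem evaluation_rules :
    (∀ p f g, evalAt p (f + g) = evalAt p f + evalAt p g) ∧
    (∀ p f g, evalAt p (f - g) = evalAt p f - evalAt p g) ∧
    (∀ p f, evalAt p (-f) = -evalAt p f) ∧
    (∀ p f g, evalAt p (f * g) = evalAt p f * evalAt p g) ∧
    (∀ p (r : ℝ) f, evalAt p (r • f) = r * evalAt p f) ∧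
    (∀ p f (n : ℕ), evalAt p (f ^ n) = evalAt p f ^ n) ∧
    (∀ p (n : ℕ) [n.AtLeastTwo], evalAt p ofNat(n) = ofNat(n)) ∧
    (∀ p, evalAt p 0 = 0) ∧ (∀ p, evalAt p 1 = 1) :=
  ⟨fun _ _ _ => rfl, fun _ _ _ => rfl, fun _ _ => rfl, fun _ _ _ => rfl, fun _ _ _ => rfl,
    fun _ _ _ => map_pow _ _ _, fun _ _ _ => rfl, fun _ => rfl, fun _ => rfl⟩

theorem trivial_rules : (∀ f : FE, 0 * f = 0) ∧ (∀ f : FE, f * 0 = 0) ∧ (∀ f : FE, 0 + f = f) ∧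
    (∀ f : FE, f + 0 = f) ∧ (∀ f : FE, f - 0 = f) ∧ (∀ r : ℝ, r • (0 : FE) = 0) ∧
    (∀ f : FE, f * 1 = f) ∧ (∀ f : FE, f ^ 1 = f) := by simp

/-! ## The table of brackets -/

theorem jacobi_gt4 (ϑ η : TFun) :
      jacobi (phi3 ϑ) (phi6 η) = phi3 (d ϑ * η - ϑ * d η) ∧
      jacobi (phi4 ϑ) (phi5 η) = phi3 (ϑ * d η - d ϑ * η) ∧
      jacobi (phi4 ϑ) (phi6 η) = phi4 (d ϑ * η - ϑ * d η) ∧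
      jacobi (phi5 ϑ) (phi5 η) = phi4 (d ϑ * η - ϑ * d η) ∧
      jacobi (phi5 ϑ) (phi6 η) = phi5 (d ϑ * η - ϑ * d η) ∧
      jacobi (phi6 ϑ) (phi6 η) = phi6 (d ϑ * η - ϑ * d η) := by
  refine ⟨?_, ?_, ?_, ?_, ?_, ?_⟩ <;>
    refine Prod.ext (FE.ext_evalAt fun p => ?_) (FE.ext_evalAt fun p => ?_) <;>
    simp only [jacobi, phi3, phi4, phi5, phi6, coordinate_names, derivation_rules,
      total_derivatives, evolutionary_components, trivial_rules, Nat.reduceAdd, Nat.reduceSub,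
      Prod.smul_fst, Prod.smul_snd, Prod.fst_neg, Prod.snd_neg, d_mul, d_add, d_sub, d_smul, d_zero,
      d_ofNat, lift_add, lift_sub, lift_neg, lift_mul, lift_smul, lift_ofNat, lift_zero, evaluation_rules] <;>
    try ring1

theorem jacobi_phi1 (ϑ : TFun) :
      jacobi phi1 (phi4 ϑ) = (-2 : ℝ) • phi3 ϑ ∧
      jacobi phi1 (phi5 ϑ) = phi4 ϑ ∧
      jacobi phi1 phi9 = -phi8 ∧
      jacobi phi1 phi10 = (-2 : ℝ) • phi9 ∧
      jacobi phi1 phi11 = (-3 : ℝ) • phi10 ∧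
      jacobi phi1 phi12 = (-4 : ℝ) • phi11 ∧
      jacobi phi1 phi13 = (-5 : ℝ) • phi12 ∧
      jacobi phi1 phi14 = (-6 : ℝ) • phi13 ∧
      jacobi phi1 (phi16 ϑ) = (-2 : ℝ) • phi15 ϑ ∧
      jacobi phi1 (phi17 ϑ) = (-5 : ℝ) • phi16 ϑ ∧
      jacobi phi1 (phi18 ϑ) = (-6 : ℝ) • phi17 ϑ := by
  refine ⟨?_, ?_, ?_, ?_, ?_, ?_, ?_, ?_, ?_, ?_, ?_⟩ <;>
    refine Prod.ext (FE.ext_evalAt fun p => ?_) (FE.ext_evalAt fun p => ?_) <;>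
    simp only [jacobi, phi1, phi3, phi4, phi5, phi8, phi9, phi10, phi11, phi12, phi13, phi14, phi15,
      phi16, phi17, phi18, coordinate_names, derivation_rules, total_derivatives,
      evolutionary_components, trivial_rules, Nat.reduceAdd, Nat.reduceSub, Prod.smul_fst,
      Prod.smul_snd, Prod.fst_neg, Prod.snd_neg, d_mul, d_add, d_sub, d_smul, d_zero, d_ofNat,
      lift_add,
      lift_sub, lift_neg, lift_mul, lift_smul, lift_ofNat, lift_zero, evaluation_rules] <;>
    try ring1

theorem jacobi_phi2 (ϑ : TFun) :
      jacobi phi2 (phi3 ϑ) = (3 : ℝ) • phi3 ϑ ∧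
      jacobi phi2 (phi4 ϑ) = (2 : ℝ) • phi4 ϑ ∧
      jacobi phi2 (phi5 ϑ) = phi5 ϑ ∧
      jacobi phi2 phi8 = (3 : ℝ) • phi8 ∧
      jacobi phi2 phi9 = (2 : ℝ) • phi9 ∧
      jacobi phi2 phi10 = phi10 ∧
      jacobi phi2 phi12 = -phi12 ∧
      jacobi phi2 phi13 = (-2 : ℝ) • phi13 ∧
      jacobi phi2 phi14 = (-3 : ℝ) • phi14 ∧
      jacobi phi2 (phi16 ϑ) = -phi16 ϑ ∧
      jacobi phi2 (phi17 ϑ) = (-2 : ℝ) • phi17 ϑ ∧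
      jacobi phi2 (phi18 ϑ) = (-3 : ℝ) • phi18 ϑ := by
  refine ⟨?_, ?_, ?_, ?_, ?_, ?_, ?_, ?_, ?_, ?_, ?_, ?_⟩ <;>
    refine Prod.ext (FE.ext_evalAt fun p => ?_) (FE.ext_evalAt fun p => ?_) <;>
    simp only [jacobi, phi2, phi3, phi4, phi5, phi8, phi9, phi10, phi11, phi12, phi13, phi14, phi15,
      phi16, phi17, phi18, coordinate_names, derivation_rules, total_derivatives,
      evolutionary_components, trivial_rules, Nat.reduceAdd, Nat.reduceSub, Prod.smul_fst,
      Prod.smul_snd, Prod.fst_neg, Prod.snd_neg, d_mul, d_add, d_sub, d_smul, d_zero, d_ofNat,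
      lift_add,
      lift_sub, lift_neg, lift_mul, lift_smul, lift_ofNat, lift_zero, evaluation_rules] <;>
    try ring1

set_option maxHeartbeats 2000000 in
theorem jacobi_gt4_ideal (ϑ η : TFun) :
      jacobi (phi3 ϑ) phi14 = phi15 (d (d (d ϑ))) ∧
      jacobi (phi3 ϑ) (phi18 η) = phi15 ((1 / 2 : ℝ) • (ϑ * d η) + d ϑ * η) ∧
      jacobi (phi4 ϑ) phi13 = -phi15 (d (d (d ϑ))) ∧
      jacobi (phi4 ϑ) phi14 = (-2 : ℝ) • phi16 (d (d (d ϑ))) ∧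
      jacobi (phi4 ϑ) (phi17 η) = -phi15 (d ϑ * η + (1 / 2 : ℝ) • (ϑ * d η)) ∧
      jacobi (phi4 ϑ) (phi18 η) = -phi16 (2 * d ϑ * η + ϑ * d η) ∧
      jacobi (phi5 ϑ) phi12 = -phi15 (d (d (d ϑ))) ∧
      jacobi (phi5 ϑ) phi13 = (-2 : ℝ) • phi16 (d (d (d ϑ))) ∧
      jacobi (phi5 ϑ) phi14 = (-2 : ℝ) • phi17 (d (d (d ϑ))) ∧
      jacobi (phi5 ϑ) (phi16 η) = -phi15 (d ϑ * η + (1 / 2 : ℝ) • (ϑ * d η)) ∧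
      jacobi (phi5 ϑ) (phi17 η) = -phi16 (2 * d ϑ * η + ϑ * d η) ∧
      jacobi (phi5 ϑ) (phi18 η) = -phi17 (2 * d ϑ * η + ϑ * d η) ∧
      jacobi (phi6 ϑ) phi11 = -phi15 (d (d (d ϑ))) ∧
      jacobi (phi6 ϑ) phi12 = (-2 : ℝ) • phi16 (d (d (d ϑ))) ∧
      jacobi (phi6 ϑ) phi13 = (-2 : ℝ) • phi17 (d (d (d ϑ))) ∧
      jacobi (phi6 ϑ) phi14 = (-2 : ℝ) • phi18 (d (d (d ϑ))) ∧
      jacobi (phi6 ϑ) (phi15 η) = -phi15 (2 * d ϑ * η + ϑ * d η) ∧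
      jacobi (phi6 ϑ) (phi16 η) = -phi16 (2 * d ϑ * η + ϑ * d η) ∧
      jacobi (phi6 ϑ) (phi17 η) = -phi17 (2 * d ϑ * η + ϑ * d η) ∧
      jacobi (phi6 ϑ) (phi18 η) = -phi18 (2 * d ϑ * η + ϑ * d η) := by
  refine ⟨?_, ?_, ?_, ?_, ?_, ?_, ?_, ?_, ?_, ?_, ?_, ?_, ?_, ?_, ?_, ?_, ?_, ?_, ?_, ?_⟩ <;>
    refine Prod.ext (FE.ext_evalAt fun p => ?_) (FE.ext_evalAt fun p => ?_) <;>
    simp only [jacobi, phi3, phi4, phi5, phi6, phi11, phi12, phi13, phi14, phi15, phi16, phi17,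
      phi18, coordinate_names, derivation_rules, total_derivatives, evolutionary_components,
      trivial_rules, Nat.reduceAdd, Nat.reduceSub, Prod.smul_fst, Prod.smul_snd, Prod.fst_neg,
      Prod.snd_neg, d_mul, d_add, d_sub, d_smul, d_zero, d_ofNat, lift_add, lift_sub, lift_neg, lift_mul,
      lift_smul, lift_ofNat, lift_zero, evaluation_rules] <;>
    try ring1

theorem jacobi_s2_eq_zero (η : TFun) :
      jacobi phi1 (phi3 η) = 0 ∧
      jacobi phi1 (phi6 η) = 0 ∧
      jacobi phi1 phi7 = 0 ∧
      jacobi phi1 phi8 = 0 ∧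
      jacobi phi1 (phi15 η) = 0 ∧
      jacobi phi2 (phi6 η) = 0 ∧
      jacobi phi2 phi7 = 0 ∧
      jacobi phi2 phi11 = 0 ∧
      jacobi phi2 (phi15 η) = 0 := by
  refine ⟨?_, ?_, ?_, ?_, ?_, ?_, ?_, ?_, ?_⟩ <;>
    refine Prod.ext (FE.ext_evalAt fun p => ?_) (FE.ext_evalAt fun p => ?_) <;>
    simp only [jacobi, phi1, phi2, phi3, phi6, phi7, phi8, phi11, phi15, coordinate_names,
      derivation_rules, total_derivatives, evolutionary_components, trivial_rules, Nat.reduceAdd,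
      Nat.reduceSub, Prod.fst_zero, Prod.snd_zero, d_mul, d_add, d_sub, d_smul, d_zero,
      d_ofNat, lift_add, lift_sub, lift_neg, lift_mul, lift_smul, lift_ofNat, lift_zero, evaluation_rules] <;>
    try ring1

theorem jacobi_gt4_eq_zero (ϑ η : TFun) :
      jacobi (phi3 ϑ) (phi3 η) = 0 ∧
      jacobi (phi3 ϑ) (phi4 η) = 0 ∧
      jacobi (phi3 ϑ) (phi5 η) = 0 ∧
      jacobi (phi3 ϑ) phi7 = 0 ∧
      jacobi (phi3 ϑ) phi8 = 0 ∧
      jacobi (phi3 ϑ) phi9 = 0 ∧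
      jacobi (phi3 ϑ) phi10 = 0 ∧
      jacobi (phi3 ϑ) phi11 = 0 ∧
      jacobi (phi3 ϑ) phi12 = 0 ∧
      jacobi (phi3 ϑ) phi13 = 0 ∧
      jacobi (phi3 ϑ) (phi15 η) = 0 ∧
      jacobi (phi3 ϑ) (phi16 η) = 0 ∧
      jacobi (phi3 ϑ) (phi17 η) = 0 ∧
      jacobi (phi4 ϑ) (phi4 η) = 0 ∧
      jacobi (phi4 ϑ) phi7 = 0 ∧
      jacobi (phi4 ϑ) phi8 = 0 ∧
      jacobi (phi4 ϑ) phi9 = 0 ∧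
      jacobi (phi4 ϑ) phi10 = 0 ∧
      jacobi (phi4 ϑ) phi11 = 0 ∧
      jacobi (phi4 ϑ) phi12 = 0 ∧
      jacobi (phi4 ϑ) (phi15 η) = 0 ∧
      jacobi (phi4 ϑ) (phi16 η) = 0 ∧
      jacobi (phi5 ϑ) phi7 = 0 ∧
      jacobi (phi5 ϑ) phi8 = 0 ∧
      jacobi (phi5 ϑ) phi9 = 0 ∧
      jacobi (phi5 ϑ) phi10 = 0 ∧
      jacobi (phi5 ϑ) phi11 = 0 ∧
      jacobi (phi5 ϑ) (phi15 η) = 0 ∧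
      jacobi (phi6 ϑ) phi7 = 0 ∧
      jacobi (phi6 ϑ) phi8 = 0 ∧
      jacobi (phi6 ϑ) phi9 = 0 ∧
      jacobi (phi6 ϑ) phi10 = 0 := by
  refine ⟨?_, ?_, ?_, ?_, ?_, ?_, ?_, ?_, ?_, ?_, ?_, ?_, ?_, ?_, ?_, ?_, ?_, ?_, ?_, ?_, ?_, ?_,
    ?_, ?_, ?_, ?_, ?_, ?_, ?_, ?_, ?_, ?_⟩ <;>
    refine Prod.ext (FE.ext_evalAt fun p => ?_) (FE.ext_evalAt fun p => ?_) <;>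
    simp only [jacobi, phi3, phi4, phi5, phi6, phi7, phi8, phi9, phi10, phi11, phi12, phi13, phi15,
      phi16, phi17, coordinate_names, derivation_rules, total_derivatives, evolutionary_components,
      trivial_rules, Nat.reduceAdd, Nat.reduceSub, Prod.fst_zero, Prod.snd_zero, d_mul, d_add, d_sub,
      d_smul, d_zero, d_ofNat, lift_add, lift_sub, lift_neg, lift_mul, lift_smul, lift_ofNat,
      lift_zero, evaluation_rules] <;>
    try ring1

/-! ## The generators are symmetries -/

theorem isGenerating_zero : IsGenerating 0 := by
  constructor <;> simp [show Ev 0 = 0 from map_zero EvHom]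

theorem IsGenerating.add {φ ψ : Section} (hφ : IsGenerating φ) (hψ : IsGenerating ψ) :
    IsGenerating (φ + ψ) :=
  Ev_mem_symE_iff.1 (by
    rw [Ev_add]
    exact add_mem (Ev_mem_symE hφ) (Ev_mem_symE hψ))

theorem IsGenerating.smul {φ : Section} (hφ : IsGenerating φ) (r : ℝ) : IsGenerating (r • φ) :=
  Ev_mem_symE_iff.1 (by
    rw [Ev_smul]
    exact symE.smul_mem r (Ev_mem_symE hφ))

theorem IsGenerating.jacobi {φ ψ : Section} (hφ : IsGenerating φ) (hψ : IsGenerating ψ) :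
    IsGenerating (jacobi φ ψ) :=
  Ev_mem_symE_iff.1 (by
    rw [← lie_Ev hφ hψ]
    exact symE.lie_mem (Ev_mem_symE hφ) (Ev_mem_symE hψ))

theorem IsGenerating.of_smul {φ : Section} {r : ℝ} (h : IsGenerating (r • φ)) (hr : r ≠ 0) :
    IsGenerating φ := by
  simpa [smul_smul, inv_mul_cancel₀ hr] using h.smul r⁻¹

theorem isGenerating_phi1_phi2_phi7 :
    IsGenerating phi1 ∧ IsGenerating phi2 ∧ IsGenerating phi7 := by
  refine ⟨⟨?_, ?_⟩, ⟨?_, ?_⟩, ⟨?_, ?_⟩⟩ <;>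
    refine FE.ext_evalAt fun p => ?_ <;>
    simp only [phi1, phi2, phi7, coordinate_names, derivation_rules, total_derivatives,
      evolutionary_components, trivial_rules, Nat.reduceAdd, Nat.reduceSub, evaluation_rules] <;>
    try ring1

theorem isGenerating_gt4_at4 (ϑ : TFun) :
    IsGenerating (phi3 ϑ) ∧ IsGenerating (phi4 ϑ) ∧ IsGenerating (phi5 ϑ) ∧ IsGenerating (phi6 ϑ) ∧
    IsGenerating (phi15 ϑ) ∧ IsGenerating (phi16 ϑ) ∧ IsGenerating (phi17 ϑ) ∧
    IsGenerating (phi18 ϑ) := by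
  refine ⟨⟨?_, ?_⟩, ⟨?_, ?_⟩, ⟨?_, ?_⟩, ⟨?_, ?_⟩, ⟨?_, ?_⟩, ⟨?_, ?_⟩, ⟨?_, ?_⟩, ⟨?_, ?_⟩⟩ <;>
    refine FE.ext_evalAt fun p => ?_ <;>
    simp only [phi3, phi4, phi5, phi6, phi15, phi16, phi17, phi18, coordinate_names,
      derivation_rules, total_derivatives, evolutionary_components, trivial_rules, Nat.reduceAdd,
      Nat.reduceSub, evaluation_rules] <;>
    try ring1

set_option maxHeartbeats 1000000 in
theorem isGenerating_phi14 : IsGenerating phi14 := by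
  constructor <;>
    refine FE.ext_evalAt fun p => ?_ <;>
    simp only [phi14, coordinate_names, derivation_rules, total_derivatives,
      evolutionary_components, trivial_rules, Nat.reduceAdd, Nat.reduceSub, evaluation_rules] <;>
    ring

/-- Only φ₁₄ requires an expansion of the linearized equation. Bracketing with φ₁ lowers the index
by one up to a nonzero factor, and brackets of symmetries are symmetries. -/
theorem isGenerating_a7 : IsGenerating phi8 ∧ IsGenerating phi9 ∧ IsGenerating phi10 ∧
    IsGenerating phi11 ∧ IsGenerating phi12 ∧ IsGenerating phi13 ∧ IsGenerating phi14 := by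
  obtain ⟨-, -, h8, h9, h10, h11, h12, h13, -⟩ := jacobi_phi1 0
  have h1 := isGenerating_phi1_phi2_phi7.1
  have g14 := isGenerating_phi14
  have g13 := (h13 ▸ h1.jacobi g14).of_smul (by norm_num)
  have g12 := (h12 ▸ h1.jacobi g13).of_smul (by norm_num)
  have g11 := (h11 ▸ h1.jacobi g12).of_smul (by norm_num)
  have g10 := (h10 ▸ h1.jacobi g11).of_smul (by norm_num)
  have g9 := (h9 ▸ h1.jacobi g10).of_smul (by norm_num)
  have g8 : IsGenerating phi8 := by
    have := (h8 ▸ h1.jacobi g9).smul (-1)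
    rwa [neg_one_smul, neg_neg] at this
  exact ⟨g8, g9, g10, g11, g12, g13, g14⟩

theorem isGenerating_gen (i : ℕ) (ϑ : TFun) : IsGenerating (gen i ϑ) := by
  obtain ⟨h1, h2, h7⟩ := isGenerating_phi1_phi2_phi7
  obtain ⟨h3, h4, h5, h6, h15, h16, h17, h18⟩ := isGenerating_gt4_at4 ϑ
  obtain ⟨h8, h9, h10, h11, h12, h13, h14⟩ := isGenerating_a7
  unfold gen
  split <;> first | assumption | exact isGenerating_zero

/-- A symmetry with trivial `u`-component whose `v`-component does not involve `v`. -/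
theorem jacobi_v_section {f g : FE} (hg : ∀ Z : VF, (∀ k l, Z (co (.u0 k l)) = 0) →
    (∀ k l, Z (co (.u1 k l)) = 0) → Z (co .x) = 0 → Z (co .y) = 0 → Z (co .t) = 0 → Z g = 0) :
    Ev (0, f) g = 0 := by
  have h0 : ∀ (Z : VF) n, Z^[n] (0 : FE) = 0 := fun Z n => iterate_map_zero Z n
  refine hg _ (fun k l => ?_) (fun k l => ?_) ?_ ?_ ?_ <;> simp [Ev_u0, Ev_u1, h0]

/-- The field of (0, f) moves only the jets of v, which the v-components of φ₈, …, φ₁₈ do not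
contain. This yields all brackets among these sections and their brackets with φ₇. -/
theorem exists_gen_eq {i : ℕ} (hi : i ∈ Set.Icc 8 18) (ϑ : TFun) : ∃ g : FE, gen i ϑ = (0, g) ∧
    ∀ f, Ev (0, f) g = 0 := by
  obtain ⟨h8, h18⟩ := hi
  refine ⟨(gen i ϑ).2, ?_, fun f => ?_⟩
  · interval_cases i <;> rfl
  · refine jacobi_v_section fun Z h0 h1 hx hy ht => ?_
    interval_cases i <;>
      simp only [gen, phi8, phi9, phi10, phi11, phi12, phi13, phi14, phi15, phi16, phi17, phi18,
        coordinate_names, derivation_rules, trivial_rules, VF.apply_lift, h0, h1, hx, hy, ht]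

theorem jacobi_ideal {i j : ℕ} (hi : i ∈ Set.Icc 8 18) (hj : j ∈ Set.Icc 8 18) (ϑ η : TFun) :
    jacobi (gen i ϑ) (gen j η) = 0 := by
  obtain ⟨f, hf, hf0⟩ := exists_gen_eq hi ϑ
  obtain ⟨g, hg, hg0⟩ := exists_gen_eq hj η
  rw [hf, hg]
  simp [jacobi, hf0, hg0]

theorem jacobi_phi7 {i : ℕ} (hi : i ∈ Set.Icc 8 18) (ϑ : TFun) :
    jacobi phi7 (gen i ϑ) = -gen i ϑ := by
  obtain ⟨f, hf, hf0⟩ := exists_gen_eq hi ϑ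
  rw [hf, jacobi]
  refine Prod.ext ?_ ?_
  · simp [phi7]
  · have := Ev_v (0, f)
    simp [phi7, hf0, this]

theorem jacobi_phi2_phi1 : jacobi phi2 phi1 = phi1 := by
  refine Prod.ext (FE.ext_evalAt fun p => ?_) (FE.ext_evalAt fun p => ?_) <;>
    simp only [jacobi, phi1, phi2, coordinate_names, derivation_rules, total_derivatives,
      evolutionary_components, trivial_rules, Nat.reduceAdd, Nat.reduceSub, evaluation_rules] <;>
    ring

theorem jacobi_self (φ : Section) : jacobi φ φ = 0 := by simp [jacobi]

theorem jacobi_swap (φ ψ : Section) : jacobi ψ φ = -jacobi φ ψ := by simp [jacobi]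

/-- The pairs `(i, j)` with `i ≤ 7` and `i ≤ j` that are not listed. -/
def unlistedPairs : List (ℕ × ℕ) :=
  [(1, 1), (1, 3), (1, 6), (1, 7), (1, 8), (1, 15), (2, 2), (2, 6), (2, 7), (2, 11), (2, 15),
    (3, 3), (3, 4), (3, 5), (3, 7), (3, 8), (3, 9), (3, 10), (3, 11), (3, 12), (3, 13), (3, 15),
    (3, 16), (3, 17), (4, 4), (4, 7), (4, 8), (4, 9), (4, 10), (4, 11), (4, 12), (4, 15), (4, 16),
    (5, 7), (5, 8), (5, 9), (5, 10), (5, 11), (5, 15), (6, 7), (6, 8), (6, 9), (6, 10), (7, 7)]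

set_option synthInstance.maxSize 4000 in
set_option synthInstance.maxHeartbeats 400000 in
set_option maxRecDepth 20000 in
theorem mem_unlistedPairs : ∀ i < 8, ∀ j < 19, 1 ≤ i → i ≤ j →
    (i, j) ∉ unlistedPairs → (i, j) ∈ listedPairs := by
  intro i hi j hj h1 hij
  -- Over explicit lists of indices the claim is a finite check.
  have h : ∀ q ∈ ((List.range' 1 7).product (List.range' 1 18)), q.1 ≤ q.2 →
      q ∉ unlistedPairs → q ∈ listedPairs := by
    simp only [listedPairs, Set.mem_insert_iff, Set.mem_singleton_iff]
    decide
  exact h (i, j) (by simp [List.mem_range'_1]; omega) hij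

/-- The values of `gen`. Rewriting with them avoids the overlapping equations of its definition. -/
theorem gen_eq (ϑ : TFun) : gen 1 ϑ = phi1 ∧ gen 2 ϑ = phi2 ∧ gen 3 ϑ = phi3 ϑ ∧ gen 4 ϑ = phi4 ϑ ∧
    gen 5 ϑ = phi5 ϑ ∧ gen 6 ϑ = phi6 ϑ ∧ gen 7 ϑ = phi7 ∧ gen 8 ϑ = phi8 ∧ gen 9 ϑ = phi9 ∧
    gen 10 ϑ = phi10 ∧ gen 11 ϑ = phi11 ∧ gen 12 ϑ = phi12 ∧ gen 13 ϑ = phi13 ∧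
    gen 14 ϑ = phi14 ∧ gen 15 ϑ = phi15 ϑ ∧ gen 16 ϑ = phi16 ϑ ∧ gen 17 ϑ = phi17 ϑ ∧
    gen 18 ϑ = phi18 ϑ :=
  ⟨rfl, rfl, rfl, rfl, rfl, rfl, rfl, rfl, rfl, rfl, rfl, rfl, rfl, rfl, rfl, rfl, rfl, rfl⟩

theorem jacobi_eq_zero {i j : ℕ} (hi : 1 ≤ i) (hij : i ≤ j) (hj : j ≤ 18)
    (h : (i, j) ∉ listedPairs) (ϑ η : TFun) : jacobi (gen i ϑ) (gen j η) = 0 := by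
  rcases Nat.lt_or_ge i 8 with hi8 | hi8
  · have hs2 := jacobi_s2_eq_zero η
    have hgt := jacobi_gt4_eq_zero ϑ η
    have key : ∀ q ∈ unlistedPairs, jacobi (gen q.1 ϑ) (gen q.2 η) = 0 := by
      simp only [unlistedPairs, List.forall_mem_cons, gen_eq, jacobi_self, hs2, hgt, true_and]
      exact fun _ hq => absurd hq List.not_mem_nil
    exact key (i, j) (by_contra fun hq => h (mem_unlistedPairs i hi8 j (by omega) hi hij hq))
  · exact jacobi_ideal ⟨hi8, by omega⟩ ⟨by omega, hj⟩ ϑ η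

/-! ## Derivatives along jet coordinates, indexed by integers -/

/-- The jet coordinates: `s` selects `u` or `v`, `i` selects the order in `y`. -/
def jet : Bool → Bool → ℕ → ℕ → Coord
  | false, false => .u0
  | false, true => .u1
  | true, false => .v0
  | true, true => .v1

/-- The right-hand sides of the system. -/
noncomputable def rhs : Bool → FE
  | false => rhsU
  | true => rhsV

theorem jet_inj {s i s' i' : Bool} {k l k' l' : ℕ} :
    jet s i k l = jet s' i' k' l' ↔ s = s' ∧ i = i' ∧ k = k' ∧ l = l' := by
  cases s <;> cases i <;> cases s' <;> cases i' <;> simp [jet]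

theorem Coord.exists_jet (c : Coord) :
    c = .x ∨ c = .y ∨ c = .t ∨ ∃ s i k l, c = jet s i k l := by
  cases c with
  | x => simp
  | y => simp
  | t => simp
  | u0 k l => exact .inr (.inr (.inr ⟨false, false, k, l, rfl⟩))
  | u1 k l => exact .inr (.inr (.inr ⟨false, true, k, l, rfl⟩))
  | v0 k l => exact .inr (.inr (.inr ⟨true, false, k, l, rfl⟩))
  | v1 k l => exact .inr (.inr (.inr ⟨true, true, k, l, rfl⟩))

theorem jet_ne (s i : Bool) (k l : ℕ) :
    jet s i k l ≠ .x ∧ jet s i k l ≠ .y ∧ jet s i k l ≠ .t := by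
  cases s <;> cases i <;> simp [jet]

theorem Dx_jet (s i : Bool) (k l : ℕ) : Dx (co (jet s i k l)) = co (jet s i (k + 1) l) := by
  cases s <;> cases i <;> simp [jet]

theorem Dt_jet (s i : Bool) (k l : ℕ) : Dt (co (jet s i k l)) = co (jet s i k (l + 1)) := by
  cases s <;> cases i <;> simp [jet]

theorem Dy_jet_false (s : Bool) (k l : ℕ) :
    Dy (co (jet s false k l)) = co (jet s true k l) := by
  cases s <;> simp [jet]

theorem Dy_jet_true (s : Bool) (k l : ℕ) :
    Dy (co (jet s true k l)) = Dx^[k] (Dt^[l] (rhs s)) := by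
  cases s
  · exact Dy_u1 k l
  · exact Dy_v1 k l

/-- The derivative along `jet s i a b`, zero if an index is negative. -/
noncomputable def pj (s i : Bool) (a b : ℤ) : VF :=
  if 0 ≤ a ∧ 0 ≤ b then pd (jet s i a.toNat b.toNat) else 0

theorem pj_natCast (s i : Bool) (k l : ℕ) : pj s i k l = pd (jet s i k l) := by simp [pj]

theorem pj_of_neg {a b : ℤ} (s i : Bool) (h : a < 0 ∨ b < 0) (f : FE) : pj s i a b f = 0 := by
  rw [pj, if_neg (by omega)]
  rfl

theorem pj_jet (s i s' i' : Bool) (a b : ℤ) (k l : ℕ) :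
    pj s i a b (co (jet s' i' k l)) = if s = s' ∧ i = i' ∧ a = k ∧ b = l then 1 else 0 := by
  by_cases h : 0 ≤ a ∧ 0 ≤ b
  · have e : jet s i a.toNat b.toNat = jet s' i' k l ↔ s = s' ∧ i = i' ∧ a = k ∧ b = l := by
      rw [jet_inj]
      constructor <;> rintro ⟨h1, h2, h3, h4⟩ <;> exact ⟨h1, h2, by omega, by omega⟩
    rw [pj, if_pos h, pd_co]
    by_cases hc : s = s' ∧ i = i' ∧ a = k ∧ b = l
    · rw [if_pos (e.2 hc), if_pos hc]
    · rw [if_neg (e.not.2 hc), if_neg hc]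
  · rw [pj, if_neg h, if_neg (fun h' => h (by omega))]
    rfl

theorem pj_xyt (s i : Bool) (a b : ℤ) :
    pj s i a b (co .x) = 0 ∧ pj s i a b (co .y) = 0 ∧ pj s i a b (co .t) = 0 := by
  have h := jet_ne s i a.toNat b.toNat
  rw [pj]
  split_ifs
  · exact ⟨pd_co_of_ne h.1, pd_co_of_ne h.2.1, pd_co_of_ne h.2.2⟩
  · exact ⟨rfl, rfl, rfl⟩

theorem VF.eq_of_jets {Z W : VF} (hx : Z (co .x) = W (co .x)) (hy : Z (co .y) = W (co .y))
    (ht : Z (co .t) = W (co .t)) (h : ∀ s i k l, Z (co (jet s i k l)) = W (co (jet s i k l))) :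
    Z = W := by
  refine VF.ext fun c => ?_
  obtain rfl | rfl | rfl | ⟨s, i, k, l, rfl⟩ := c.exists_jet
  exacts [hx, hy, ht, h s i k l]

/-- `Dx` raises the x-index of every jet coordinate by one, so commuting with it lowers the x-index
of the derivative by one. Because derivatives with negative index are zero, no boundary case arises.
-/
theorem pj_Dx (s i : Bool) (a b : ℤ) (f : FE) :
    pj s i a b (Dx f) = Dx (pj s i a b f) + pj s i (a - 1) b f := by
  have h : ⁅pj s i a b, Dx⁆ = pj s i (a - 1) b := by
    refine VF.eq_of_jets ?_ ?_ ?_ fun s' i' k l => ?_ <;>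
      simp only [Derivation.commutator_apply, pj_xyt, Dx_x, Dx_y, Dx_t, map_zero, sub_zero,
        Derivation.map_one_eq_zero, Dx_jet, pj_jet]
    rw [apply_ite Dx, Dx.map_one_eq_zero, map_zero, ite_self, sub_zero]
    refine if_congr ?_ rfl rfl
    push_cast
    constructor <;> rintro ⟨h1, h2, h3, h4⟩ <;> exact ⟨h1, h2, by omega, by omega⟩
  rw [← h, Derivation.commutator_apply]
  ring

theorem pj_Dt (s i : Bool) (a b : ℤ) (f : FE) :
    pj s i a b (Dt f) = Dt (pj s i a b f) + pj s i a (b - 1) f := by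
  have h : ⁅pj s i a b, Dt⁆ = pj s i a (b - 1) := by
    refine VF.eq_of_jets ?_ ?_ ?_ fun s' i' k l => ?_ <;>
      simp only [Derivation.commutator_apply, pj_xyt, Dt_x, Dt_y, Dt_t, map_zero, sub_zero,
        Derivation.map_one_eq_zero, Dt_jet, pj_jet]
    rw [apply_ite Dt, Dt.map_one_eq_zero, map_zero, ite_self, sub_zero]
    refine if_congr ?_ rfl rfl
    push_cast
    constructor <;> rintro ⟨h1, h2, h3, h4⟩ <;> exact ⟨h1, h2, by omega, by omega⟩
  rw [← h, Derivation.commutator_apply]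
  ring

/-! ## Functions annihilated by the total `x`-derivative -/

theorem exists_pj_eq_zero (f : FE) : ∃ N : ℕ, ∀ s i (a b : ℤ), N < a + b → pj s i a b f = 0 := by
  obtain ⟨S, hS⟩ := exists_pd_eq_zero f
  let w : Coord → ℕ := fun
    | .u0 k l => k + l
    | .u1 k l => k + l
    | .v0 k l => k + l
    | .v1 k l => k + l
    | _ => 0
  refine ⟨S.sup w, fun s i a b h => ?_⟩
  rw [pj]
  split_ifs with hab
  · refine hS _ fun hm => ?_
    have h1 := Finset.le_sup (f := w) hm
    have h2 : w (jet s i a.toNat b.toNat) = a.toNat + b.toNat := by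
      cases s <;> cases i <;> rfl
    omega
  · rfl

/-- Descending induction on the order: when `Dx f = 0`, the commutation rule expresses a derivative
of f as minus `Dx` of the derivative one order higher, and derivatives of high order vanish. In
effect the kernel of `Dx` consists of functions of y and t. -/
theorem pj_eq_zero_of_Dx {f : FE} (h : Dx f = 0) (s i : Bool) (a b : ℤ) : pj s i a b f = 0 := by
  obtain ⟨N, hN⟩ := exists_pj_eq_zero f
  have key : ∀ n : ℕ, ∀ a b : ℤ, N - a - b < n → pj s i a b f = 0 := by
    intro n
    induction n with
    | zero => exact fun a b hab => hN s i a b (by push_cast at hab; omega)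
    | succ n ih =>
      intro a b hab
      have h1 := pj_Dx s i (a + 1) b f
      rw [h, map_zero, ih (a + 1) b (by push_cast at hab ⊢; omega), map_zero, zero_add,
        add_sub_cancel_right] at h1
      exact h1.symm
  exact key (N - a - b + 1).toNat a b (by omega)

theorem pd_jet_eq_zero_of_Dx {f : FE} (h : Dx f = 0) (s i : Bool) (k l : ℕ) :
    pd (jet s i k l) f = 0 := by
  rw [← pj_natCast]
  exact pj_eq_zero_of_Dx h s i k l

theorem VF.apply_of_pd_jet {f : FE} (h : ∀ s i k l, pd (jet s i k l) f = 0) (Z : VF) :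
    Z f = Z (co .x) * pd .x f + Z (co .y) * pd .y f + Z (co .t) * pd .t f := by
  classical
  rw [Z.apply_eq_finset_sum f {Coord.x, Coord.y, Coord.t}]
  · simp [add_assoc]
  · intro c hc
    obtain rfl | rfl | rfl | ⟨s, i, k, l, rfl⟩ := c.exists_jet
    · simp at hc
    · simp at hc
    · simp at hc
    · exact h s i k l

theorem pd_x_eq_zero_of_Dx {f : FE} (h : Dx f = 0) : pd .x f = 0 := by
  have := VF.apply_of_pd_jet (pd_jet_eq_zero_of_Dx h) Dx
  simpa [h] using this.symm

theorem Dx_Dy_eq_zero {f : FE} (h : Dx f = 0) : Dx (Dy f) = 0 := by rw [Dx_Dy, h, map_zero]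

theorem Dx_Dt_eq_zero {f : FE} (h : Dx f = 0) : Dx (Dt f) = 0 := by rw [Dx_Dt, h, map_zero]

theorem Dy_Dt_eq_zero {f : FE} (h : Dy f = 0) : Dy (Dt f) = 0 := by rw [← Dt_Dy, h, map_zero]

theorem pd_eq_zero_of_Dx_of_Dy {f : FE} (hx : Dx f = 0) (hy : Dy f = 0) {c : Coord} (hc : c ≠ .t) :
    pd c f = 0 := by
  obtain rfl | rfl | rfl | ⟨s, i, k, l, rfl⟩ := c.exists_jet
  · exact pd_x_eq_zero_of_Dx hx
  · have := VF.apply_of_pd_jet (pd_jet_eq_zero_of_Dx hx) Dy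
    simpa [hy, pd_x_eq_zero_of_Dx hx] using this.symm
  · exact absurd rfl hc
  · exact pd_jet_eq_zero_of_Dx hx s i k l

open Classical in
theorem evalAt_update_of_pd {f : FE} {c : Coord} (h : pd c f = 0) (p : Point) (r : ℝ) :
    evalAt (Function.update p c r) f = evalAt p f := by
  have key : ∀ r, HasDerivAt (fun r => evalAt (Function.update p c r) f) 0 r := fun r => by
    have h1 := differentiableAt_slice f.2 c (Function.update p c r)
    have h2 : pdFun c f.1 (Function.update p c r) = 0 :=
      congrArg (fun g : FE => g.1 (Function.update p c r)) h
    have h3 := h1.hasDerivAt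
    rw [pdFun] at h2
    rw [h2] at h3
    simp only [Function.update_self, Function.update_idem] at h3
    exact h3
  have := is_const_of_deriv_eq_zero (fun r => (key r).differentiableAt) (fun r => (key r).deriv)
    r (p c)
  simpa using this

/-- A function whose derivatives along all coordinates but `t` vanish is a function of `t`. -/
theorem exists_eq_lift {f : FE} (h : ∀ c ≠ .t, pd c f = 0) : ∃ ϑ : TFun, f = lift ϑ := by
  classical
  obtain ⟨s, g, hg, hfg⟩ := f.2
  have hconst : ∀ p q : Point, p .t = q .t → evalAt p f = evalAt q f := by
    intro p q hpq
    -- The coordinates are changed one at a time; finitely many changes suffice because f depends on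
    -- finitely many coordinates.
    have key : ∀ S : Finset Coord, evalAt (fun c => if c ∈ S then q c else p c) f = evalAt p f := by
      intro S
      induction S using Finset.induction_on with
      | empty => simp
      | insert c S hc ih =>
        by_cases hct : c = .t
        · rw [← ih]
          congr 2
          funext c'
          by_cases h1 : c' = c
          · subst h1
            simp [hct, hpq]
          · simp [h1]
        · rw [← ih, ← evalAt_update_of_pd (h c hct) (fun c' => if c' ∈ S then q c' else p c') (q c)]
          congr 2
          funext c'
          by_cases h1 : c' = c
          · subst h1
            simp
          · simp [h1]
    rw [← key s, evalAt_apply, evalAt_apply, hfg, hfg]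
    congr 1
    funext i
    simp
  -- All coordinates other than t are set to zero.
  refine ⟨⟨fun r => g fun i => if i.1 = .t then r else 0, ?_⟩, ?_⟩
  · refine hg.comp (contDiff_pi.2 fun i => ?_)
    by_cases hi : i.1 = .t
    · simp only [hi, if_true]
      exact contDiff_id
    · simp only [hi, if_false]
      exact contDiff_const
  · refine FE.ext_evalAt fun p => ?_
    rw [hconst p (fun c => if c = .t then p .t else 0) (by simp), evalAt_apply, hfg]
    rfl

theorem exists_eq_lift_of_Dx_of_Dy {f : FE} (hx : Dx f = 0) (hy : Dy f = 0) :
    ∃ ϑ : TFun, f = lift ϑ :=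
  exists_eq_lift fun _ hc => pd_eq_zero_of_Dx_of_Dy hx hy hc

theorem exists_eq_const {f : FE} (hx : Dx f = 0) (hy : Dy f = 0) (ht : Dt f = 0) :
    ∃ r : ℝ, f = algebraMap ℝ FE r := by
  obtain ⟨ϑ, rfl⟩ := exists_eq_lift_of_Dx_of_Dy hx hy
  have h1 : d ϑ = 0 := lift_injective (by rw [← Dt_lift, ht, lift_zero])
  have h2 : ∀ r, deriv ϑ.1 r = 0 := fun r => congrFun (congrArg Subtype.val h1) r
  refine ⟨ϑ.1 0, FE.ext_evalAt fun p => ?_⟩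
  have h3 : ContDiff ℝ ∞ ϑ.1 := ϑ.2
  exact is_const_of_deriv_eq_zero (h3.differentiable (by simp)) h2 _ _

/-! ## Commutators of jet derivatives with the total `y`-derivative -/

/-- R stands for a family of jet derivatives that commuting with Z shifts by one index. If g has
order n, then Z^k raises the order to n + k without changing the leading derivative, and to the next
one each of the k factors contributes one Z of the leading derivative. -/
theorem shift_iterate {R : ℤ → VF} {Z : VF}
    (hR : ∀ a f, R a (Z f) = Z (R a f) + R (a - 1) f) {g : FE} {n : ℤ}
    (hg : ∀ a, n < a → R a g = 0) (k : ℕ) :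
    (∀ a, n + k < a → R a (Z^[k] g) = 0) ∧ R (n + k) (Z^[k] g) = R n g ∧
      R (n + k - 1) (Z^[k] g) = k * Z (R n g) + R (n - 1) g := by
  induction k with
  | zero => simpa using hg
  | succ k ih =>
    obtain ⟨h1, h2, h3⟩ := ih
    simp only [Function.iterate_succ_apply', hR]
    refine ⟨fun a ha => ?_, ?_, ?_⟩
    · rw [h1 a (by push_cast at ha; omega), h1 (a - 1) (by push_cast at ha; omega)]
      simp
    · rw [h1 _ (by push_cast; omega), show n + (k + 1 : ℕ) - 1 = n + k by push_cast; ring, h2]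
      simp
    · rw [show n + (k + 1 : ℕ) - 1 = n + k by push_cast; ring, h2, h3]
      push_cast
      ring

/-- `shift_iterate` first in t at fixed x-index, then in x at fixed t-index: the two leading orders
of a differentiated right-hand side. -/
theorem pj_iterate (s i : Bool) {g : FE} {n : ℤ} (hg : ∀ a b, n < a + b → pj s i a b g = 0)
    (k l : ℕ) (a b : ℤ) :
    (n + k + l < a + b → pj s i a b (Dx^[k] (Dt^[l] g)) = 0) ∧
    (a + b = n + k + l → pj s i a b (Dx^[k] (Dt^[l] g)) = pj s i (a - k) (b - l) g) ∧
    (a + b = n + k + l - 1 → pj s i a b (Dx^[k] (Dt^[l] g)) =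
      k * Dx (pj s i (a - k + 1) (b - l) g) + l * Dt (pj s i (a - k) (b - l + 1) g)
        + pj s i (a - k) (b - l) g) := by
  have ht : ∀ a, _ := fun a => shift_iterate (R := fun b => pj s i a b) (Z := Dt)
    (fun b f => pj_Dt s i a b f) (g := g) (n := n - a) (fun b hb => hg a b (by omega)) l
  have h0 : ∀ a b, n + l < a + b → pj s i a b (Dt^[l] g) = 0 :=
    fun a b hb => (ht a).1 b (by omega)
  have h1 : ∀ a b, a + b = n + l → pj s i a b (Dt^[l] g) = pj s i a (b - l) g := by
    intro a b hb
    have := (ht a).2.1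
    rwa [show n - a + l = b by omega, show n - a = b - l by omega] at this
  have h2 : ∀ a b, a + b = n + l - 1 → pj s i a b (Dt^[l] g) =
      l * Dt (pj s i a (b - l + 1) g) + pj s i a (b - l) g := by
    intro a b hb
    have := (ht a).2.2
    rwa [show n - a + l - 1 = b by omega, show n - a - 1 = b - l by omega,
      show n - a = b - l + 1 by omega] at this
  have hx := shift_iterate (R := fun a => pj s i a b) (Z := Dx)
    (fun a f => pj_Dx s i a b f) (g := Dt^[l] g) (n := n + l - b) (fun a ha => h0 a b (by omega)) k
  refine ⟨fun hab => hx.1 a (by omega), fun hab => ?_, fun hab => ?_⟩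
  · have := hx.2.1
    rw [show n + l - b + k = a by omega, show n + l - b = a - k by omega] at this
    rw [this, h1 _ _ (by omega)]
  · have := hx.2.2
    rw [show n + l - b + k - 1 = a by omega, show n + l - b - 1 = a - k by omega,
      show n + l - b = a - k + 1 by omega] at this
    rw [this, h1 _ _ (by omega), h2 _ _ (by omega)]
    ring

/-- The coefficient of `u_xy` in the derivative of the right-hand side along the `x`-derivative of
the corresponding unknown function. -/
def weight : Bool → ℤ
  | false => -1
  | true => 2

open Classical in
-- Along its own unknown, each equation has the same second-order part; the first-order terms are
-- proportional, with the factor `weight s`. This lets both unknowns be treated at once.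
theorem pj_false_rhs (s : Bool) (a b : ℤ) : pj s false a b (rhs s) =
    (if a = 1 ∧ b = 1 then 1 else 0) + u_y * (if a = 2 ∧ b = 0 then 1 else 0)
      + weight s * u_xy * (if a = 1 ∧ b = 0 then 1 else 0) := by
  have e := pj_jet s false
  cases s
  · have h : rhs false = co (jet false false 1 1) - co (jet false false 1 0) *
      co (jet false true 1 0) + co (jet false true 0 0) * co (jet false false 2 0) := rfl
    simp only [h, derivation_rules, e, true_and, reduceCtorEq, false_and, if_false, Nat.cast_one,
      Nat.cast_zero, Nat.cast_ofNat, weight]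
    simp only [u_y, u_xy, jet]
    push_cast
    ring
  · have h : rhs true = co (jet true false 1 1) - co (jet false false 1 0) *
      co (jet true true 1 0) - 2 * co (jet true true 0 0) * co (jet false false 2 0)
      + 2 * co (jet true false 1 0) * co (jet false true 1 0) +
        co (jet false true 0 0) * co (jet true false 2 0) := rfl
    simp only [h, derivation_rules, e, true_and, reduceCtorEq, false_and, if_false, Nat.cast_one,
      Nat.cast_zero, Nat.cast_ofNat, weight]
    simp only [u_y, u_xy, jet]
    push_cast
    ring

open Classical in
theorem pj_true_rhs (s : Bool) (a b : ℤ) : pj s true a b (rhs s) =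
    -u_x * (if a = 1 ∧ b = 0 then 1 else 0)
      - weight s * u_xx * (if a = 0 ∧ b = 0 then 1 else 0) := by
  have e := pj_jet s true
  cases s
  · have h : rhs false = co (jet false false 1 1) - co (jet false false 1 0) *
      co (jet false true 1 0) + co (jet false true 0 0) * co (jet false false 2 0) := rfl
    simp only [h, derivation_rules, e, true_and, reduceCtorEq, false_and, if_false, Nat.cast_one,
      Nat.cast_zero, Nat.cast_ofNat, weight]
    simp only [u_x, u_xx, jet]
    push_cast
    ring
  · have h : rhs true = co (jet true false 1 1) - co (jet false false 1 0) *
      co (jet true true 1 0) - 2 * co (jet true true 0 0) * co (jet false false 2 0)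
      + 2 * co (jet true false 1 0) * co (jet false true 1 0) +
        co (jet false true 0 0) * co (jet true false 2 0) := rfl
    simp only [h, derivation_rules, e, true_and, reduceCtorEq, false_and, if_false, Nat.cast_one,
      Nat.cast_zero, Nat.cast_ofNat, weight]
    simp only [u_x, u_xx, jet]
    push_cast
    ring

theorem pj_v_iterate_rhsU (i : Bool) (a b : ℤ) (k l : ℕ) :
    pj true i a b (Dx^[k] (Dt^[l] (rhs false))) = 0 := by
  have h0 : ∀ a b, pj true i a b (rhs false) = 0 := by
    intro a b
    have h : rhs false = co (jet false false 1 1) - co (jet false false 1 0) *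
      co (jet false true 1 0) + co (jet false true 0 0) * co (jet false false 2 0) := rfl
    simp [h, pj_jet]
  exact (pj_iterate true i (n := a + b - k - l - 1) (fun a b _ => h0 a b) k l a b).1 (by omega)

/-- `f` has order at most `N` in the unknown function selected by `s`; if it is `u`, then `f` does
not depend on `v` through `y`-derivatives. -/
structure HasOrder (s : Bool) (N : ℤ) (f : FE) : Prop where
  pj_false : ∀ a b, N < a + b → pj s false a b f = 0
  pj_true : ∀ a b, N - 1 < a + b → pj s true a b f = 0
  pj_v : s = false → ∀ i a b, pj true i a b f = 0

theorem HasOrder.mono {s : Bool} {N M : ℤ} {f : FE} (h : HasOrder s N f) (hNM : N ≤ M) :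
    HasOrder s M f :=
  ⟨fun a b hab => h.1 a b (by omega), fun a b hab => h.2 a b (by omega), h.3⟩

theorem VF.apply_eq_zero {W : VF} {f : FE} (h : ∀ c, W (co c) = 0 ∨ pd c f = 0) : W f = 0 := by
  rw [W.apply_eq_sum, finsum_eq_zero_of_forall_eq_zero]
  intro c
  obtain h | h := h c <;> simp [h]

/-- The exact commutator with `Dy` involves differentiated right-hand sides of every order. On a
function of order at most N and at total index at least N, only their two leading orders are felt,
and `pj_iterate` supplies them. -/
theorem pj_false_Dy {s : Bool} {N : ℤ} {f : FE} (h : HasOrder s N f) {a b : ℤ} (hab : N ≤ a + b) :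
    pj s false a b (Dy f) = Dy (pj s false a b f) + pj s true (a - 1) (b - 1) f
      + u_y * pj s true (a - 2) b f + (a - 1 + weight s : ℤ) * u_xy * pj s true (a - 1) b f
      + (b + 1 : ℤ) * u_yt * pj s true (a - 2) (b + 1) f := by
  classical
  -- A derivation kills f if for every coordinate it kills that coordinate or f does not depend on
  -- it, so the identity is tested only on coordinates that f may contain.
  have key : (⁅pj s false a b, Dy⁆ - pj s true (a - 1) (b - 1) - u_y • pj s true (a - 2) b
      - (((a - 1 + weight s : ℤ) : FE) * u_xy) • pj s true (a - 1) b
      - (((b + 1 : ℤ) : FE) * u_yt) • pj s true (a - 2) (b + 1)) f = 0 := by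
    refine VF.apply_eq_zero fun c => ?_
    simp only [Derivation.sub_apply, Derivation.smul_apply, Derivation.commutator_apply,
      smul_eq_mul]
    obtain rfl | rfl | rfl | ⟨s', i, k, l, rfl⟩ := c.exists_jet
    · simp [pj_xyt]
    · simp [pj_xyt]
    · simp [pj_xyt]
    · cases i
      · simp [Dy_jet_false, pj_jet, apply_ite Dy]
      by_cases hs : s = s'
      · subst hs
        rcases lt_or_ge (N - 1) (k + l) with hkl | hkl
        · right
          rw [← pj_natCast]
          exact h.2 _ _ hkl
        left
        have hg : ∀ a b, 2 < a + b → pj s false a b (rhs s) = 0 := by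
          intro a b hab
          rw [pj_false_rhs, if_neg (by omega), if_neg (by omega), if_neg (by omega)]
          ring
        obtain ⟨h0, h1, h2⟩ := pj_iterate s false hg k l a b
        simp only [Dy_jet_true, pj_jet, reduceCtorEq, true_and, false_and, and_false, if_false,
          map_zero, sub_zero]
        -- The bounds on a + b and k + l leave just one order below the top. There `k * Dx u_y` and
        -- the first-order term of the equation add up to the factor a - 1 + `weight s` of u_xy, and
        -- `l * Dt u_y` gives the factor b + 1 of u_yt.
        rcases lt_trichotomy (a + b) (2 + k + l) with hlt | heq | hgt
        · rw [h2 (by omega)]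
          simp only [pj_false_rhs]
          obtain hb | hb | hb | hb : b = l ∨ b = l - 1 ∨ b = l + 1 ∨
            (b ≠ l ∧ b ≠ l - 1 ∧ b ≠ l + 1) := by omega
          · obtain ⟨rfl⟩ : a = k + 1 := by omega
            subst hb
            simp (disch := omega) only [add_sub_cancel_right, and_self, if_pos, if_neg]
            simp only [u_y, u_xy, derivation_rules, Dx_u1]
            push_cast
            ring
          · obtain ⟨rfl⟩ : a = k + 2 := by omega
            subst hb
            simp (disch := omega) only [if_pos, if_neg]
            simp only [u_y, u_yt, derivation_rules, Dt_u1]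
            push_cast
            ring
          · obtain ⟨rfl⟩ : a = k := by omega
            subst hb
            simp (disch := omega) only [if_pos, if_neg]
            simp only [derivation_rules]
            ring
          · simp (disch := omega) only [if_neg]
            simp only [derivation_rules, mul_zero]
            ring
        · rw [h1 heq, pj_false_rhs]
          obtain hb | hb | hb : b = l ∨ b = l + 1 ∨ (b ≠ l ∧ b ≠ l + 1) := by omega
          · simp (disch := omega) only [if_pos, if_neg]
            ring
          · simp (disch := omega) only [if_pos, if_neg]
            ring
          · simp (disch := omega) only [if_neg]
            ring
        · rw [h0 (by omega)]
          simp (disch := omega) only [if_neg]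
          ring
      · cases s
        · obtain ⟨rfl⟩ : s' = true := by simpa using Ne.symm hs
          right
          rw [← pj_natCast]
          exact h.3 rfl _ _ _
        · obtain ⟨rfl⟩ : s' = false := by simpa using Ne.symm hs
          left
          rw [Dy_jet_true, pj_v_iterate_rhsU]
          simp [pj_jet]
  simp only [Derivation.sub_apply, Derivation.smul_apply, Derivation.commutator_apply,
      smul_eq_mul] at key
  linear_combination key

theorem pj_true_Dy {s : Bool} {N : ℤ} {f : FE} (h : HasOrder s N f) {a b : ℤ}
    (hab : N - 1 ≤ a + b) :
    pj s true a b (Dy f) = Dy (pj s true a b f) + pj s false a b f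
      - u_x * pj s true (a - 1) b f - (a + weight s : ℤ) * u_xx * pj s true a b f
      - (b + 1 : ℤ) * u_xt * pj s true (a - 1) (b + 1) f := by
  classical
  have key : (⁅pj s true a b, Dy⁆ - pj s false a b + u_x • pj s true (a - 1) b
      + (((a + weight s : ℤ) : FE) * u_xx) • pj s true a b
      + (((b + 1 : ℤ) : FE) * u_xt) • pj s true (a - 1) (b + 1)) f = 0 := by
    refine VF.apply_eq_zero fun c => ?_
    simp only [Derivation.sub_apply, Derivation.add_apply, Derivation.smul_apply,
      Derivation.commutator_apply, smul_eq_mul]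
    obtain rfl | rfl | rfl | ⟨s', i, k, l, rfl⟩ := c.exists_jet
    · simp [pj_xyt]
    · simp [pj_xyt]
    · simp [pj_xyt]
    · cases i
      · simp [Dy_jet_false, pj_jet]
      by_cases hs : s = s'
      · subst hs
        rcases lt_or_ge (N - 1) (k + l) with hkl | hkl
        · right
          rw [← pj_natCast]
          exact h.2 _ _ hkl
        left
        have hg : ∀ a b, 1 < a + b → pj s true a b (rhs s) = 0 := by
          intro a b hab
          rw [pj_true_rhs, if_neg (by omega), if_neg (by omega)]
          ring
        obtain ⟨h0, h1, h2⟩ := pj_iterate s true hg k l a b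
        simp only [Dy_jet_true, pj_jet, reduceCtorEq, true_and, false_and, and_false, if_false,
          apply_ite Dy, map_zero, sub_zero, Derivation.map_one_eq_zero, ite_self]
        rcases lt_trichotomy (a + b) (1 + k + l) with hlt | heq | hgt
        · rw [h2 (by omega)]
          simp only [pj_true_rhs]
          obtain hb | hb | hb : b = l ∨ b = l - 1 ∨ (b ≠ l ∧ b ≠ l - 1) := by omega
          · obtain ⟨rfl⟩ : a = k := by omega
            subst hb
            simp (disch := omega) only [if_pos, if_neg]
            simp only [u_x, u_xx, derivation_rules, Dx_u0, and_self, if_true]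
            push_cast
            ring
          · obtain ⟨rfl⟩ : a = k + 1 := by omega
            subst hb
            simp (disch := omega) only [if_pos, if_neg]
            simp only [u_x, u_xt, derivation_rules, Dt_u0]
            push_cast
            ring
          · simp (disch := omega) only [if_neg]
            simp only [derivation_rules, mul_zero]
            ring
        · rw [h1 heq, pj_true_rhs]
          obtain hb | hb : b = l ∨ b ≠ l := by omega
          · simp (disch := omega) only [if_pos, if_neg]
            ring
          · simp (disch := omega) only [if_neg]
            ring
        · rw [h0 (by omega)]
          simp (disch := omega) only [if_neg]
          ring
      · cases s
        · obtain ⟨rfl⟩ : s' = true := by simpa using Ne.symm hs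
          right
          rw [← pj_natCast]
          exact h.3 rfl _ _ _
        · obtain ⟨rfl⟩ : s' = false := by simpa using Ne.symm hs
          left
          rw [Dy_jet_true, pj_v_iterate_rhsU]
          simp [pj_jet]
  simp only [Derivation.sub_apply, Derivation.add_apply, Derivation.smul_apply,
      Derivation.commutator_apply, smul_eq_mul] at key
  linear_combination key

/-! ## The linearized equation and its principal symbols -/

/-- The linearizations of the two equations of the system along the respective unknown function,
for `c = -1` and `c = 2`. -/
noncomputable def linOp (c : ℤ) (f : FE) : FE :=
  Dy (Dy f) - Dx (Dt f) + u_x * Dx (Dy f) - u_y * Dx (Dx f) + c * (u_xx * Dy f - u_xy * Dx f)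

theorem HasOrder.Dy {s : Bool} {N : ℤ} {f : FE} (h : HasOrder s N f) :
    HasOrder s (N + 1) (Dy f) := by
  refine ⟨fun a b hab => ?_, fun a b hab => ?_, fun hs i a b => ?_⟩
  · rw [pj_false_Dy h (by omega), h.1 _ _ (by omega), h.2 _ _ (by omega), h.2 _ _ (by omega),
      h.2 _ _ (by omega), h.2 _ _ (by omega)]
    simp
  · rw [pj_true_Dy h (by omega), h.1 _ _ (by omega), h.2 _ _ (by omega), h.2 _ _ (by omega),
      h.2 _ _ (by omega)]
    simp
  · have h0 := h.3 hs
    -- A function free of v has every order in v, so the commutator formulas for v apply at any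
    -- index.
    have hv : HasOrder true (a + b) f :=
      ⟨fun a b _ => h0 _ a b, fun a b _ => h0 _ a b, fun h => by simp at h⟩
    cases i
    · rw [pj_false_Dy hv le_rfl]
      simp [h0]
    · rw [pj_true_Dy hv (by omega)]
      simp [h0]

/-- The coefficients of `linOp` must not contribute to the two leading orders of the equation. Along
v this is automatic; along u it requires N ≥ 2, because u_xx and u_xy have order two themselves. -/
theorem pj_low_coordinates {s : Bool} {N : ℤ} (hN : s = true ∨ 2 ≤ N) (b : ℤ) (g : FE)
    (hg : g ∈ ({u_x, u_y, u_xx, u_xy} : Set FE)) :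
    pj s false (N + 1 - b) b g = 0 ∧ pj s true (N - b) b g = 0 := by
  have e1 : u_x = co (jet false false 1 0) := rfl
  have e2 : u_y = co (jet false true 0 0) := rfl
  have e3 : u_xx = co (jet false false 2 0) := rfl
  have e4 : u_xy = co (jet false true 1 0) := rfl
  rw [e1, e2, e3, e4] at hg
  simp only [Set.mem_insert_iff, Set.mem_singleton_iff] at hg
  obtain rfl | hN := hN
  · rcases hg with rfl | rfl | rfl | rfl <;> simp [pj_jet]
  · rcases hg with rfl | rfl | rfl | rfl <;>
      simp only [pj_jet, reduceCtorEq, true_and, false_and, and_false, if_false] <;>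
      simp (disch := omega) only [if_neg, and_self]

/-- The two leading orders of the linearized equation. -/
theorem linOp_symbol {s : Bool} {N : ℤ} {f : FE} (h : HasOrder s N f) {c : ℤ}
    (hf : linOp c f = 0) (p q : ℤ → FE) (hp : ∀ b, p b = pj s false (N - b) b f)
    (hq : ∀ b, q b = pj s true (N - 1 - b) b f) (b : ℤ)
    (hlow : ∀ g ∈ ({u_x, u_y, u_xx, u_xy} : Set FE), pj s false (N + 1 - b) b g = 0 ∧
      pj s true (N - b) b g = 0) :
    (Dy (q (b - 1)) + rhsU * q b + u_y * Dy (q b)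
      + (Dy (q (b - 1)) - (N - b + weight s : ℤ) * u_xx * q (b - 1) - b * u_xt * q b)
      + u_y * (Dy (q b) - (N - 1 - b + weight s : ℤ) * u_xx * q b
        - (b + 1 : ℤ) * u_xt * q (b + 1))
      + (N - b + weight s : ℤ) * u_xy * (p b - u_x * q b)
      + (b + 1 : ℤ) * u_yt * (p (b + 1) - u_x * q (b + 1)) - Dx (p (b - 1)) - Dt (p b)
      + u_x * (Dx (q (b - 1)) + u_xy * q b + u_y * Dx (q b) + Dy (p b)
        + (N - b - 1 + weight s : ℤ) * u_xy * q b + (b + 1 : ℤ) * u_yt * q (b + 1))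
      - 2 * u_y * Dx (p b) + c * (u_xx * (q (b - 1) + u_y * q b) - u_xy * p b) = 0) ∧
    (Dy (p b) - u_xy * q b - u_x * Dy (q b)
      + (Dy (p b) + (N - b - 1 + weight s : ℤ) * u_xy * q b + (b + 1 : ℤ) * u_yt * q (b + 1))
      - u_x * (Dy (q b) - (N - 1 - b + weight s : ℤ) * u_xx * q b
        - (b + 1 : ℤ) * u_xt * q (b + 1))
      - (N - b + weight s : ℤ) * u_xx * (p b - u_x * q b)
      - (b + 1 : ℤ) * u_xt * (p (b + 1) - u_x * q (b + 1)) - Dx (q (b - 1)) - Dt (q b)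
      + u_x * (Dx (p b) - u_xx * q b - u_x * Dx (q b) + Dy (q b)
        - (N - 1 - b + weight s : ℤ) * u_xx * q b - (b + 1 : ℤ) * u_xt * q (b + 1))
      - 2 * u_y * Dx (q b) + c * (u_xx * (p b - u_x * q b) - u_xy * q b) = 0) := by
  simp only [Set.mem_insert_iff, Set.mem_singleton_iff, forall_eq_or_imp, forall_eq] at hlow
  obtain ⟨⟨l1, m1⟩, ⟨l2, m2⟩, ⟨l3, m3⟩, l4, m4⟩ := hlow
  have hDx_ux : Dx u_x = u_xx := Dx_u0 1 0
  have hDx_uy : Dx u_y = u_xy := Dx_u1 0 0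
  have hDy_ux : Dy u_x = u_xy := Dy_u0 1 0
  have hDy_uy : Dy u_y = rhsU := Dy_u1_zero
  have zP : ∀ b, pj s false (N + 1 - b) b f = 0 := fun b => h.1 _ _ (by omega)
  have zQ : ∀ b, pj s true (N - b) b f = 0 := fun b => h.2 _ _ (by omega)
  -- A1, A2 are the leading and the next order of `Dy f` along coordinates without a y-derivative,
  -- B1, B2 those along coordinates with one.
  have A1 : ∀ b, pj s false (N + 1 - b) b (Dy f) = q (b - 1) + u_y * q b := by
    intro b
    rw [pj_false_Dy h (by omega), zP, hq, hq, show N + 1 - b - 1 = N - b by ring,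
      show N + 1 - b - 2 = N - 1 - b by ring, show N - 1 - (b - 1) = N - b by ring, zQ,
      h.2 (N - 1 - b) (b + 1) (by omega), map_zero]
    ring
  have A2 : ∀ b, pj s false (N - b) b (Dy f) = Dy (p b) + pj s true (N - b - 1) (b - 1) f
      + u_y * pj s true (N - b - 2) b f + (N - b - 1 + weight s : ℤ) * u_xy * q b
      + (b + 1 : ℤ) * u_yt * q (b + 1) := by
    intro b
    rw [pj_false_Dy h (by omega), hp, hq, hq, show N - 1 - (b + 1) = N - b - 2 by ring,
      show N - 1 - b = N - b - 1 by ring]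
  have B1 : ∀ b, pj s true (N - b) b (Dy f) = p b - u_x * q b := by
    intro b
    rw [pj_true_Dy h (by omega), hp, hq, zQ, h.2 (N - b - 1) (b + 1) (by omega), map_zero,
      show N - 1 - b = N - b - 1 by ring]
    ring
  have B2 : ∀ b, pj s true (N - 1 - b) b (Dy f) = Dy (q b) + pj s false (N - b - 1) b f
      - u_x * pj s true (N - b - 2) b f - (N - 1 - b + weight s : ℤ) * u_xx * q b
      - (b + 1 : ℤ) * u_xt * q (b + 1) := by
    intro b
    rw [pj_true_Dy h (by omega), hq, hq, show N - 1 - (b + 1) = N - 1 - b - 1 by ring,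
      show N - b - 2 = N - 1 - b - 1 by ring, show N - b - 1 = N - 1 - b by ring]
  constructor
  · have e : pj s false (N + 1 - b) b (linOp c f) = 0 := by rw [hf, map_zero]
    have e1 := pj_false_Dy h.Dy (a := N + 1 - b) (b := b) (by omega)
    rw [A1, show N + 1 - b - 1 = N - b by ring, show N + 1 - b - 2 = N - 1 - b by ring,
      show N - b = N - 1 - (b - 1) by ring, B2, show N - 1 - (b - 1) = N - b by ring, B2, B1,
      show N - 1 - b = N - (b + 1) by ring, B1, show N - (b + 1) = N - 1 - b by ring] at e1
    have x1 : pj s false (N + 1 - b) b (Dx (Dt f)) =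
        Dx (p (b - 1)) + Dt (p b) + pj s false (N - b) (b - 1) f := by
      rw [pj_Dx, pj_Dt, pj_Dt, zP, hp, hp, show N + 1 - b - 1 = N - b by ring,
        show N - (b - 1) = N + 1 - b by ring]
      simp [add_assoc]
    have x2 : pj s false (N + 1 - b) b (Dx (Dx f)) = 2 * Dx (p b) + pj s false (N - b - 1) b f := by
      rw [pj_Dx, pj_Dx, pj_Dx, zP, hp, show N + 1 - b - 1 = N - b by ring, map_zero]
      ring_nf
    have x3 : pj s false (N + 1 - b) b (Dx f) = p b := by
      rw [pj_Dx, zP, hp, show N + 1 - b - 1 = N - b by ring, map_zero, zero_add]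
    rw [linOp] at e
    simp only [derivation_rules, Derivation.map_intCast, l1, l2, l3, l4, x1, x2, x3, e1,
      pj_Dx _ _ _ _ (Dy f), A1, show N + 1 - b - 1 = N - b by ring, A2,
      hDx_uy, hDy_uy] at e
    rw [show b - 1 + 1 = b by ring, show N - (b - 1) - 1 = N - b by ring,
      show N - (b - 1) - 2 = N - b - 1 by ring] at e
    push_cast at e ⊢
    linear_combination e
  · have e : pj s true (N - b) b (linOp c f) = 0 := by rw [hf, map_zero]
    have e1 := pj_true_Dy h.Dy (a := N - b) (b := b) (by omega)
    rw [A2, B1, show N - b - 1 = N - 1 - b by ring, B2, show N - 1 - b = N - (b + 1) by ring, B1,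
      show N - (b + 1) = N - b - 1 by ring] at e1
    have x1 : pj s true (N - b) b (Dx (Dt f)) =
        Dx (q (b - 1)) + Dt (q b) + pj s true (N - b - 1) (b - 1) f := by
      rw [pj_Dx, pj_Dt, pj_Dt, zQ, hq, hq, show N - 1 - (b - 1) = N - b by ring,
        show N - b - 1 = N - 1 - b by ring]
      simp [add_assoc]
    have x2 : pj s true (N - b) b (Dx (Dx f)) = 2 * Dx (q b) + pj s true (N - b - 2) b f := by
      rw [pj_Dx, pj_Dx, pj_Dx, zQ, hq, show N - b - 1 - 1 = N - b - 2 by ring, map_zero,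
        show N - b - 1 = N - 1 - b by ring]
      ring_nf
    have x3 : pj s true (N - b) b (Dx f) = q b := by
      rw [pj_Dx, zQ, hq, show N - 1 - b = N - b - 1 by ring, map_zero, zero_add]
    rw [linOp] at e
    simp only [derivation_rules, Derivation.map_intCast, m1, m2, m3, m4, x1, x2, x3, e1,
      pj_Dx _ _ _ _ (Dy f), B1, show N - b - 1 = N - 1 - b by ring, B2,
      hDx_ux, hDy_ux] at e
    rw [show N - b - 2 = N - 1 - b - 1 by ring] at e
    push_cast at e ⊢
    linear_combination e

/-! ### Symbols as polynomials on the characteristic conic -/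

open Polynomial in
/-- A derivation of the coefficients, extended to polynomials. -/
noncomputable def polyD (Z : VF) : Derivation ℝ FE[X] FE[X] :=
  PolynomialModule.equivPolynomialSelf.toLinearMap.compDer Z.mapCoeffs

open Polynomial in
theorem coeff_polyD (Z : VF) (P : FE[X]) (n : ℕ) : (polyD Z P).coeff n = Z (P.coeff n) := rfl

open Polynomial in
theorem polyD_C (Z : VF) (f : FE) : polyD Z (C f) = C (Z f) := by
  ext n
  rw [coeff_polyD, coeff_C, coeff_C]
  split_ifs <;> simp

open Polynomial in
theorem polyD_X (Z : VF) : polyD Z (Polynomial.X : FE[X]) = 0 := by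
  ext n
  rw [coeff_polyD, coeff_X]
  split_ifs <;> simp

open Polynomial in
theorem polyD_comp (Z : VF) (P M : FE[X]) :
    polyD Z (P.comp M) = (polyD Z P).comp M + (derivative P).comp M * polyD Z M := by
  induction P using Polynomial.induction_on' with
  | add P Q hP hQ =>
    simp only [add_comp, map_add, hP, hQ]
    ring
  | monomial n f =>
    have h : polyD Z (monomial n f) = monomial n (Z f) := by
      ext m
      rw [coeff_polyD, coeff_monomial, coeff_monomial]
      split_ifs <;> simp
    rw [h, monomial_comp, monomial_comp, derivative_monomial, monomial_comp, Derivation.leibniz,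
      Derivation.leibniz_pow, polyD_C]
    simp
    ring

open Polynomial in
/-- The polynomial with prescribed coefficients of degree at most `N`. -/
noncomputable def polyOf (N : ℕ) (p : ℤ → FE) : FE[X] := ∑ b ∈ Finset.range (N + 1), monomial b (p b)

theorem coeff_polyOf {N : ℕ} {p : ℤ → FE} (hp : ∀ b : ℤ, N < b → p b = 0) (b : ℕ) :
    (polyOf N p).coeff b = p b := by
  rw [polyOf, Polynomial.finsetSum_coeff]
  simp only [Polynomial.coeff_monomial]
  rw [Finset.sum_ite_eq' (Finset.range (N + 1)) b fun b => p b]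
  split_ifs with h
  · rfl
  · rw [hp b (by simp at h; omega)]

open Polynomial in
-- Expresses the factors b in the symbol identities through the operator X · d/dX.
theorem coeff_X_mul_derivative (P : FE[X]) (n : ℕ) :
    (Polynomial.X * derivative P).coeff n = n * P.coeff n := by
  rcases n with _ | n
  · simp
  · rw [coeff_X_mul, coeff_derivative]
    push_cast
    ring

open Polynomial in
/-- The linear factor of the symbols. -/
noncomputable def linSym : FE[X] := Polynomial.X - C u_x

open Polynomial in
/-- The quadratic factor of the symbols. -/
noncomputable def quadSym : FE[X] := Polynomial.X ^ 2 - C u_x * Polynomial.X - C u_y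

open Polynomial in
/-- The symbol of order `N`: the derivatives of leading order, collected into one polynomial. -/
noncomputable def symbol (s : Bool) (N : ℕ) (f : FE) : FE[X] :=
  (polyOf N fun b => pj s false (N - b) b f).comp quadSym
    + linSym * (polyOf N fun b => pj s true (N - 1 - b) b f).comp quadSym

open Polynomial in
-- The identities of `linOp_symbol` for all b are two polynomial identities in the variable τ dual
-- to t. Substituting the parametrization τ = `quadSym`, η = `linSym` of the characteristic conic
-- and adding `linSym` times the second to the first, the derivatives of P and Q with respect to τ
-- are absorbed by the chain rule for the variable coefficients of the conic.
theorem symbol_transport {s : Bool} {N : ℕ} {f : FE} (h : HasOrder s N f)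
    (hN : s = true ∨ 2 ≤ (N : ℤ)) {c : ℤ} (hf : linOp c f = 0) :
    (linSym ^ 2 + C u_y) * polyD Dx (symbol s N f) - (2 * linSym + C u_x) * polyD Dy (symbol s N f)
      + polyD Dt (symbol s N f) =
    ((c - weight s - N : ℤ) : FE[X]) * (C u_xx * linSym - C u_xy) * symbol s N f := by
  rw [symbol]
  set p : ℤ → FE := fun b => pj s false (N - b) b f with hp
  set q : ℤ → FE := fun b => pj s true (N - 1 - b) b f with hq
  have hsym := fun b => linOp_symbol h hf p q (fun _ => rfl) (fun _ => rfl) b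
    (pj_low_coordinates hN b)
  have hpN : ∀ b, (N : ℤ) < b → p b = 0 := fun b hb => pj_of_neg _ _ (by omega) _
  have hqN : ∀ b, (N : ℤ) < b → q b = 0 := fun b hb => pj_of_neg _ _ (by omega) _
  have hp0 : p (-1) = 0 := pj_of_neg _ _ (by omega) _
  have hq0 : q (-1) = 0 := pj_of_neg _ _ (by omega) _
  set P := polyOf N p with hP
  set Q := polyOf N q with hQ
  have cP : ∀ n : ℕ, P.coeff n = p n := coeff_polyOf hpN
  have cQ : ∀ n : ℕ, Q.coeff n = q n := coeff_polyOf hqN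
  -- First family of identities as one polynomial identity in τ: an index shift b - 1 is
  -- multiplication by X, a factor b + 1 at index b + 1 is the derivative.
  have eP : Polynomial.X * polyD Dy Q + C rhsU * Q + C u_y * polyD Dy Q
      + (Polynomial.X * polyD Dy Q - C u_xx * (Polynomial.X * (C ((N - 1 + weight s : ℤ) : FE) * Q - Polynomial.X * derivative Q))
        - C u_xt * (Polynomial.X * derivative Q))
      + C u_y * (polyD Dy Q - C u_xx * (C ((N - 1 + weight s : ℤ) : FE) * Q - Polynomial.X * derivative Q)
        - C u_xt * derivative Q)
      + C u_xy * (C ((N + weight s : ℤ) : FE) * P - Polynomial.X * derivative P)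
      - C (u_xy * u_x) * (C ((N + weight s : ℤ) : FE) * Q - Polynomial.X * derivative Q)
      + C u_yt * (derivative P - C u_x * derivative Q) - Polynomial.X * polyD Dx P - polyD Dt P
      + C u_x * (Polynomial.X * polyD Dx Q + C u_xy * Q + C u_y * polyD Dx Q + polyD Dy P
        + C u_xy * (C ((N - 1 + weight s : ℤ) : FE) * Q - Polynomial.X * derivative Q) + C u_yt * derivative Q)
      - C (2 * u_y) * polyD Dx P
      + C (c : FE) * (C u_xx * (Polynomial.X * Q + C u_y * Q) - C u_xy * P) = 0 := by
    ext n
    have := (hsym n).1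
    -- At n = 0 the shifted index is -1, where p and q vanish.
    rcases n with _ | n
    · simp only [coeff_add, coeff_sub, mul_coeff_zero, coeff_C_zero, coeff_X_zero, coeff_derivative,
        coeff_polyD, cP, cQ, coeff_zero]
      push_cast at this ⊢
      simp only [zero_sub, zero_add, hp0, hq0, map_zero] at this ⊢
      linear_combination this
    · simp only [coeff_add, coeff_sub, coeff_X_mul, coeff_C_mul, coeff_X_mul_derivative,
        coeff_derivative, coeff_polyD, cP, cQ, coeff_zero]
      push_cast at this ⊢
      simp only [add_sub_cancel_right] at this
      linear_combination this
  have eQ : polyD Dy P - C u_xy * Q - C u_x * polyD Dy Q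
      + (polyD Dy P + C u_xy * (C ((N - 1 + weight s : ℤ) : FE) * Q - Polynomial.X * derivative Q)
        + C u_yt * derivative Q)
      - C u_x * (polyD Dy Q - C u_xx * (C ((N - 1 + weight s : ℤ) : FE) * Q - Polynomial.X * derivative Q)
        - C u_xt * derivative Q)
      - C u_xx * (C ((N + weight s : ℤ) : FE) * P - Polynomial.X * derivative P)
      + C (u_xx * u_x) * (C ((N + weight s : ℤ) : FE) * Q - Polynomial.X * derivative Q)
      - C u_xt * (derivative P - C u_x * derivative Q) - Polynomial.X * polyD Dx Q - polyD Dt Q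
      + C u_x * (polyD Dx P - C u_xx * Q - C u_x * polyD Dx Q + polyD Dy Q
        - C u_xx * (C ((N - 1 + weight s : ℤ) : FE) * Q - Polynomial.X * derivative Q)
        - C u_xt * derivative Q)
      - C (2 * u_y) * polyD Dx Q
      + C (c : FE) * (C u_xx * (P - C u_x * Q) - C u_xy * Q) = 0 := by
    ext n
    have := (hsym n).2
    rcases n with _ | n
    · simp only [coeff_add, coeff_sub, mul_coeff_zero, coeff_C_zero, coeff_X_zero, coeff_derivative,
        coeff_polyD, cP, cQ, coeff_zero]
      push_cast at this ⊢
      simp only [zero_sub, zero_add, hp0, hq0, map_zero] at this ⊢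
      linear_combination this
    · simp only [coeff_add, coeff_sub, coeff_X_mul, coeff_C_mul, coeff_X_mul_derivative,
        coeff_derivative, coeff_polyD, cP, cQ, coeff_zero]
      push_cast at this ⊢
      simp only [add_sub_cancel_right] at this
      linear_combination this
  have hL : ∀ Z : VF, polyD Z linSym = -C (Z u_x) := fun Z => by
    rw [linSym, map_sub, polyD_X, polyD_C, zero_sub]
  have hM : ∀ Z : VF, polyD Z quadSym = -C (Z u_x) * Polynomial.X - C (Z u_y) := fun Z => by
    rw [quadSym, map_sub, map_sub, Derivation.leibniz, Derivation.leibniz_pow, polyD_X, polyD_C,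
      polyD_C]
    simp
  have hDx_ux : Dx u_x = u_xx := Dx_u0 1 0
  have hDx_uy : Dx u_y = u_xy := Dx_u1 0 0
  have hDy_ux : Dy u_x = u_xy := Dy_u0 1 0
  have hDy_uy : Dy u_y = rhsU := Dy_u1_zero
  have hDt_ux : Dt u_x = u_xt := Dt_u0 1 0
  have hDt_uy : Dt u_y = u_yt := Dt_u1 0 0
  have fP := congrArg (fun R : FE[X] => R.comp quadSym) eP
  have fQ := congrArg (fun R : FE[X] => R.comp quadSym) eQ
  simp only [add_comp, sub_comp, mul_comp, X_comp, C_comp, intCast_comp, zero_comp] at fP fQ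
  simp only [map_add, Derivation.leibniz, smul_eq_mul, polyD_comp, hL, hM, hDx_ux, hDx_uy, hDy_ux,
    hDy_uy, hDt_ux, hDt_uy]
  -- All quantities are rewritten as polynomials in `linSym`, in which the final identity is linear
  -- in the two substituted ones.
  have hX : quadSym = linSym ^ 2 + C u_x * linSym - C u_y := by
    rw [quadSym, linSym]
    ring
  have hX' : Polynomial.X = linSym + C u_x := by
    rw [linSym]
    ring
  rw [hX'] at *
  rw [hX] at fP fQ ⊢
  simp only [map_mul, rhsU, map_add, map_sub, map_ofNat, map_intCast] at fP fQ ⊢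
  push_cast at fP fQ ⊢
  linear_combination -fP - linSym * fQ

/-! ## Vanishing symbols -/

open Polynomial in
-- The first summand has even degree and a nonzero second summand has odd degree, so they cannot
-- cancel. Monicity replaces the absence of zero divisors, which the function algebra does not have.
theorem comp_add_mul_comp_eq_zero {R : Type*} [CommRing R] [Nontrivial R] {P Q M L : R[X]}
    (hM : M.Monic) (hM2 : M.natDegree = 2) (hL : L.Monic) (hL1 : L.natDegree = 1)
    (h : P.comp M + L * Q.comp M = 0) : P = 0 ∧ Q = 0 := by
  have deg : ∀ P : R[X], (P.comp M).natDegree = P.natDegree * 2 := by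
    intro P
    rcases eq_or_ne P 0 with rfl | hP
    · simp
    · rw [natDegree_comp_eq_of_mul_ne_zero, hM2]
      simpa [hM.leadingCoeff] using hP
  have inj : ∀ P : R[X], P.comp M = 0 → P = 0 := by
    intro P hP
    have h1 := deg P
    rw [hP, natDegree_zero] at h1
    rw [eq_C_of_natDegree_eq_zero (show P.natDegree = 0 by omega), C_comp] at hP
    rw [eq_C_of_natDegree_eq_zero (show P.natDegree = 0 by omega), hP]
  by_cases hQ : Q.comp M = 0
  · rw [hQ, mul_zero, add_zero] at h
    exact ⟨inj P h, inj Q hQ⟩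
  · have h1 := hL.natDegree_mul' hQ
    rw [deg, hL1, ← neg_eq_of_add_eq_zero_right h, natDegree_neg, deg] at h1
    omega

open Polynomial in
theorem monic_linSym : linSym.Monic := monic_X_sub_C u_x

instance : Nontrivial FE := ⟨0, 1, fun h => by
  have := congrArg (evalAt fun _ => 0) h
  simp at this⟩

open Polynomial in
theorem natDegree_linSym : linSym.natDegree = 1 := natDegree_X_sub_C u_x

open Polynomial in
theorem quadSym_degree_lt : (-(C u_x * Polynomial.X + C u_y) : FE[X]).degree < (2 : ℕ) := by
  rw [degree_neg]
  exact (degree_linear_le).trans_lt (by norm_num)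

open Polynomial in
theorem quadSym_eq : quadSym = Polynomial.X ^ 2 + -(C u_x * Polynomial.X + C u_y) := by
  rw [quadSym]
  ring

theorem monic_quadSym : quadSym.Monic := by
  rw [quadSym_eq]
  exact Polynomial.monic_X_pow_add quadSym_degree_lt

theorem natDegree_quadSym : quadSym.natDegree = 2 := by
  rw [quadSym]
  compute_degree!

/-- A function of order at most `N` with vanishing symbol has order at most `N - 1`. -/
theorem HasOrder.pred {s : Bool} {N : ℕ} {f : FE} (h : HasOrder s N f) (h0 : symbol s N f = 0) :
    HasOrder s (N - 1) f := by
  obtain ⟨hP, hQ⟩ := comp_add_mul_comp_eq_zero monic_quadSym natDegree_quadSym monic_linSym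
    natDegree_linSym h0
  refine ⟨fun a b hab => ?_, fun a b hab => ?_, h.3⟩
  · rcases lt_or_ge (N : ℤ) (a + b) with hlt | hle
    · exact h.1 a b hlt
    obtain hb | ⟨n, rfl⟩ : b < 0 ∨ ∃ n : ℕ, b = n :=
      (lt_or_ge b 0).imp id Int.eq_ofNat_of_zero_le
    · exact pj_of_neg _ _ (.inr hb) f
    have := coeff_polyOf (N := N) (p := fun b => pj s false (N - b) b f)
      (fun b hb => pj_of_neg _ _ (by omega) _) n
    rw [hP, Polynomial.coeff_zero] at this
    rw [show a = N - n by omega]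
    exact this.symm
  · rcases lt_or_ge ((N : ℤ) - 1) (a + b) with hlt | hle
    · exact h.2 a b hlt
    obtain hb | ⟨n, rfl⟩ : b < 0 ∨ ∃ n : ℕ, b = n :=
      (lt_or_ge b 0).imp id Int.eq_ofNat_of_zero_le
    · exact pj_of_neg _ _ (.inr hb) f
    have := coeff_polyOf (N := N) (p := fun b => pj s true (N - 1 - b) b f)
      (fun b hb => pj_of_neg _ _ (by omega) _) n
    rw [hQ, Polynomial.coeff_zero] at this
    rw [show a = N - 1 - n by omega]
    exact this.symm

/-! ## The transport equation for the coefficients of symbols -/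

/-- The transport equation of weight `κ` for a sequence of coefficients. -/
def Transport (κ : ℤ) (F : ℤ → FE) : Prop :=
  ∀ j, Dx (F j) = 2 * Dy (F (j + 1)) - Dt (F (j + 2)) + 2 * u_x * Dx (F (j + 1))
    - u_x * Dy (F (j + 2)) - (u_x ^ 2 + u_y) * Dx (F (j + 2))
    + κ * (u_xx * F (j + 1) - (u_x * u_xx + u_xy) * F (j + 2))

open Polynomial in
/-- The coefficients of a polynomial, indexed by integers. -/
noncomputable def intCoeff (P : FE[X]) (j : ℤ) : FE := if 0 ≤ j then P.coeff j.toNat else 0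

open Polynomial in
theorem intCoeff_X_mul (P : FE[X]) (j : ℤ) :
    intCoeff (Polynomial.X * P) j = intCoeff P (j - 1) := by
  obtain hj | rfl | ⟨n, rfl⟩ : j < 0 ∨ j = 0 ∨ ∃ n : ℕ, j = n + 1 := by
    rcases lt_trichotomy j 0 with h | h | h
    · exact .inl h
    · exact .inr (.inl h)
    · exact .inr (.inr ⟨(j - 1).toNat, by omega⟩)
  · rw [intCoeff, intCoeff, if_neg (by omega), if_neg (by omega)]
  · simp [intCoeff]
  · rw [intCoeff, intCoeff, if_pos (by omega), if_pos (by omega),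
      show ((n : ℤ) + 1).toNat = n + 1 by omega, coeff_X_mul]
    simp

open Polynomial in
theorem intCoeff_rules :
    (∀ (P Q : FE[X]) j, intCoeff (P + Q) j = intCoeff P j + intCoeff Q j) ∧
    (∀ (P Q : FE[X]) j, intCoeff (P - Q) j = intCoeff P j - intCoeff Q j) ∧
    (∀ f (P : FE[X]) j, intCoeff (C f * P) j = f * intCoeff P j) ∧
    (∀ Z (P : FE[X]) j, intCoeff (polyD Z P) j = Z (intCoeff P j)) := by
  refine ⟨fun P Q j => ?_, fun P Q j => ?_, fun f P j => ?_, fun Z P j => ?_⟩ <;>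
    simp only [intCoeff] <;> split_ifs <;> simp [coeff_polyD]

open Polynomial in
theorem transport_of_symbol {κ : ℤ} {Φ : FE[X]}
    (h : (linSym ^ 2 + C u_y) * polyD Dx Φ - (2 * linSym + C u_x) * polyD Dy Φ + polyD Dt Φ =
      (κ : FE[X]) * (C u_xx * linSym - C u_xy) * Φ) : Transport κ (intCoeff Φ) := by
  intro j
  have e : Polynomial.X * (Polynomial.X * polyD Dx Φ) - C (2 * u_x) * (Polynomial.X * polyD Dx Φ)
      + C (u_x ^ 2 + u_y) * polyD Dx Φ - C 2 * (Polynomial.X * polyD Dy Φ) + C u_x * polyD Dy Φ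
      + polyD Dt Φ = C (κ * u_xx) * (Polynomial.X * Φ) - C (κ * (u_x * u_xx + u_xy)) * Φ := by
    simp only [map_add, map_mul, map_pow, map_ofNat, map_intCast]
    rw [linSym] at h
    linear_combination h
  -- The top power of X in front of `polyD Dx Φ` is X², so the coefficient of X^(j+2) contains `Dx`
  -- of the j-th coefficient.
  have e' := congrArg (fun P => intCoeff P (j + 2)) e
  simp only [intCoeff_rules, intCoeff_X_mul, show j + 2 - 1 = j + 1 by ring,
    show j + 1 - 1 = j by ring] at e'
  linear_combination e'

/-! ## Solutions of the transport equation -/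

theorem eq_zero_of_intCast_mul {n : ℤ} (hn : n ≠ 0) {f : FE} (h : (n : FE) * f = 0) : f = 0 := by
  have h1 : (n : ℝ) • f = 0 := by
    rw [← h, Algebra.smul_def, map_intCast]
  have h2 : ((n : ℝ)⁻¹ * n) • f = 0 := by rw [mul_smul, h1, smul_zero]
  rwa [inv_mul_cancel₀ (by exact_mod_cast hn), one_smul] at h2

/-- Total `x`-derivatives lie in the kernel of the Euler operators. -/
theorem euler_of_Dx {R f : FE} (h : Dx R = f) (s i : Bool) (l : ℕ)
    (h2 : ∀ k, pd (jet s i (k + 2) l) f = 0) :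
    pd (jet s i 0 l) f = Dx (pd (jet s i 1 l) f) := by
  obtain ⟨N, hN⟩ := exists_pj_eq_zero R
  have hstep : ∀ k : ℕ, pd (jet s i (k + 1) l) f =
      Dx (pd (jet s i (k + 1) l) R) + pd (jet s i k l) R := by
    intro k
    have := pj_Dx s i ((k + 1 : ℕ) : ℤ) l R
    rwa [h, pj_natCast, show ((k + 1 : ℕ) : ℤ) - 1 = (k : ℕ) by push_cast; ring, pj_natCast] at this
  -- Since f has no derivatives of x-order two or more, descending induction shows that R has none
  -- of x-order one or more. The Euler expression of f thus has two terms only.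
  have key : ∀ n k : ℕ, N < n + k → pd (jet s i (k + 1) l) R = 0 := by
    intro n
    induction n with
    | zero =>
      intro k hk
      rw [← pj_natCast]
      exact hN s i _ _ (by push_cast; omega)
    | succ n ih =>
      intro k hk
      have := hstep (k + 1)
      rw [h2, ih (k + 1) (by omega), map_zero, zero_add] at this
      exact this.symm
  have h1 : pd (jet s i 1 l) R = 0 := key (N + 1) 0 (by omega)
  have h3 : pd (jet s i 0 l) f = Dx (pd (jet s i 0 l) R) := by
    have := pj_Dx s i ((0 : ℕ) : ℤ) l R
    rwa [h, pj_natCast, pj_of_neg s i (a := ((0 : ℕ) : ℤ) - 1) (by simp), add_zero] at this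
  have h4 := hstep 0
  rw [zero_add, h1, map_zero, zero_add] at h4
  rw [h3, h4]

/-- A named inverse of 6 keeps the rational coefficients of the expansions inside the ring, where
`ring` and `linear_combination` work. -/
theorem exists_sixth : ∃ s : FE, 6 * s = 1 ∧ ∀ Z : VF, Z s = 0 := by
  refine ⟨algebraMap ℝ FE (1 / 6), ?_, fun Z => Z.map_algebraMap _⟩
  rw [show (6 : FE) = algebraMap ℝ FE 6 from (map_ofNat _ 6).symm, ← map_mul]
  norm_num

theorem pd_u_of_Dx {f : FE} (h : Dx f = 0) :
    (∀ k l, pd (.u0 k l) f = 0) ∧ (∀ k l, pd (.u1 k l) f = 0) :=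
  ⟨pd_jet_eq_zero_of_Dx h false false, pd_jet_eq_zero_of_Dx h false true⟩

theorem eq_zero_of_ofNat_mul (n : ℕ) [n.AtLeastTwo] {f : FE} (h : (ofNat(n) : FE) * f = 0) :
    f = 0 := by
  refine eq_zero_of_intCast_mul (n := n) (by exact_mod_cast NeZero.ne n) ?_
  rw [← h, Int.cast_natCast]
  rfl

/-- The leading coefficients of a solution of the transport equation. -/
theorem Transport.leading {κ : ℤ} {F : ℤ → FE} (hF : Transport κ F) {n : ℤ}
    (hn : ∀ j, n < j → F j = 0) :
    Dx (F n) = 0 ∧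
    Dx (F (n - 1) - (κ * u_x * F n + 2 * X * Dy (F n))) = 0 := by
  have h0 := hF n
  have h1 := hF (n - 1)
  rw [hn (n + 1) (by omega), hn (n + 2) (by omega)] at h0
  rw [show n - 1 + 1 = n by ring, hn (n - 1 + 2) (by omega)] at h1
  simp only [map_zero, mul_zero, sub_zero, add_zero] at h0 h1
  refine ⟨h0, ?_⟩
  have hy := Dx_Dy_eq_zero h0
  simp only [coordinate_names, derivation_rules, total_derivatives, Derivation.map_intCast, Dt_Dy,
    Nat.reduceAdd, Nat.reduceSub, trivial_rules, h0, h1, hy]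
  ring

/-- The coefficients of index n - 1 and n - 2 are integrated explicitly in x. The right-hand side
for index n - 3 must then be a total x-derivative, and the Euler operator in u_y reduces this to 4
`Dy (F n)` = 0. -/
theorem Transport.Dy_leading {κ : ℤ} {F : ℤ → FE} (hF : Transport κ F) {n : ℤ}
    (hn : ∀ j, n < j → F j = 0) : Dy (F n) = 0 := by
  obtain ⟨s, hs, hZ⟩ := exists_sixth
  obtain ⟨ha, hb⟩ := hF.leading hn
  have h2 := hF (n - 2)
  have h3 := hF (n - 3)
  rw [show n - 2 + 1 = n - 1 by ring, show n - 2 + 2 = n by ring] at h2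
  rw [show n - 3 + 1 = n - 2 by ring, show n - 3 + 2 = n - 1 by ring] at h3
  set a := F n with ha_def
  set b := F (n - 1) - (κ * u_x * a + 2 * X * Dy a) with hb_def
  have F1 : F (n - 1) = b + κ * u_x * a + 2 * X * Dy a := by rw [hb_def]; ring
  have ha_y := Dx_Dy_eq_zero ha
  have ha_yy := Dx_Dy_eq_zero ha_y
  have ha_yyy := Dx_Dy_eq_zero ha_yy
  have ha_t := Dx_Dt_eq_zero ha
  have ha_ty := Dx_Dy_eq_zero ha_t
  have hb_y := Dx_Dy_eq_zero hb
  have hb_yy := Dx_Dy_eq_zero hb_y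
  have hb_t := Dx_Dt_eq_zero hb
  -- The bracket is an explicit x-antiderivative of the right-hand side, so c is an integration
  -- constant, that is, `Dx c = 0`.
  set c := F (n - 2) - (3 * s * (κ + κ ^ 2) * u_x ^ 2 * a + 2 * κ * X * u_x * Dy a + κ * u_x * b
    + κ * u_y * a + 3 * u * Dy a + 2 * X ^ 2 * Dy (Dy a) + 2 * X * Dy b - X * Dt a) with hc_def
  have F2 : F (n - 2) = c + (3 * s * (κ + κ ^ 2) * u_x ^ 2 * a + 2 * κ * X * u_x * Dy a
    + κ * u_x * b + κ * u_y * a + 3 * u * Dy a + 2 * X ^ 2 * Dy (Dy a) + 2 * X * Dy b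
    - X * Dt a) := by rw [hc_def]; ring
  have hc : Dx c = 0 := by
    rw [hc_def, map_sub, h2, F1]
    simp only [coordinate_names, derivation_rules, total_derivatives, Derivation.map_intCast, Dt_Dy,
      Nat.reduceAdd, Nat.reduceSub, trivial_rules, ha, ha_y, ha_yy, ha_t, hb, hb_y, hZ]
    linear_combination (-(κ + κ ^ 2) * co (.u0 1 0) * co (.u0 2 0) * a) * hs
  have hc_y := Dx_Dy_eq_zero hc
  rw [F1, F2] at h3
  simp only [coordinate_names, derivation_rules, total_derivatives, Derivation.map_intCast, Dt_Dy,
    Nat.reduceAdd, Nat.reduceSub, trivial_rules, ha, ha_y, ha_yy, ha_t, hb, hb_y, hc, hZ] at h3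
  have e := euler_of_Dx h3 false true 0 fun k => by
    simp only [derivation_rules, Derivation.map_intCast, jet, pd_co, reduceCtorEq, if_false,
      trivial_rules, pd_u_of_Dx ha, pd_u_of_Dx ha_y, pd_u_of_Dx ha_yy, pd_u_of_Dx ha_yyy,
      pd_u_of_Dx ha_t, pd_u_of_Dx ha_ty, pd_u_of_Dx hb, pd_u_of_Dx hb_y, pd_u_of_Dx hb_yy,
      pd_u_of_Dx hb_t, pd_u_of_Dx hc, pd_u_of_Dx hc_y, hZ]
    simp
  simp only [derivation_rules, Derivation.map_intCast, jet, pd_co, reduceCtorEq, if_false, if_true,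
    trivial_rules, pd_u_of_Dx ha, pd_u_of_Dx ha_y, pd_u_of_Dx ha_yy, pd_u_of_Dx ha_yyy,
    pd_u_of_Dx ha_t, pd_u_of_Dx ha_ty, pd_u_of_Dx hb, pd_u_of_Dx hb_y, pd_u_of_Dx hb_yy,
    pd_u_of_Dx hb_t, pd_u_of_Dx hc, pd_u_of_Dx hc_y, hZ, Coord.u1.injEq, zero_ne_one, one_ne_zero,
    and_true, total_derivatives, ha, ha_y, ha_yy, hb, hb_y, Nat.reduceAdd, Nat.reduceSub] at e
  refine eq_zero_of_ofNat_mul 4 ?_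
  linear_combination e + 2 * a * co (.u0 2 0) * (κ + κ ^ 2) * hs

/-- The four leading coefficients of a solution of the transport equation. -/
theorem Transport.exists_expansion {κ : ℤ} {F : ℤ → FE} (hF : Transport κ F) {n : ℤ}
    (hn : ∀ j, n < j → F j = 0) {s : FE} (hs : 6 * s = 1) (hZ : ∀ Z : VF, Z s = 0) :
    ∃ b c e : FE, Dx b = 0 ∧ Dx c = 0 ∧ Dx e = 0 ∧ F (n - 1) = b + κ * u_x * F n ∧
    F (n - 2) = c + 3 * s * (κ + κ ^ 2) * u_x ^ 2 * F n + κ * u_x * b + κ * u_y * F n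
      + 2 * X * Dy b - X * Dt (F n) ∧
    F (n - 3) = e + (κ + κ ^ 2) * u_x * u_y * F n + s * (2 * κ + 3 * κ ^ 2 + κ ^ 3) * u_x ^ 3 * F n
      + 3 * s * (κ + κ ^ 2) * u_x ^ 2 * b + 2 * κ * X * u_x * Dy b - κ * X * u_x * Dt (F n)
      + κ * u_x * c + κ * u_t * F n + κ * u_y * b + 3 * u * Dy b - 2 * u * Dt (F n)
      + 2 * X ^ 2 * Dy (Dy b) + 2 * X * Dy c - X * Dt b := by
  obtain ⟨ha, hb⟩ := hF.leading hn
  have ha_y := hF.Dy_leading hn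
  have h2 := hF (n - 2)
  have h3 := hF (n - 3)
  rw [show n - 2 + 1 = n - 1 by ring, show n - 2 + 2 = n by ring] at h2
  rw [show n - 3 + 1 = n - 2 by ring, show n - 3 + 2 = n - 1 by ring] at h3
  generalize F n = a at *
  -- With `Dy (F n) = 0` the term 2x `Dy (F n)` disappears; b and c are the integration constants of
  -- the next two coefficients.
  generalize hB : F (n - 1) - (κ * u_x * a + 2 * X * Dy a) = b at hb
  have F1 : F (n - 1) = b + κ * u_x * a := by
    rw [← hB, ha_y]
    ring
  have ha_t := Dx_Dt_eq_zero ha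
  have ha_ty := Dy_Dt_eq_zero ha_y
  have hb_y := Dx_Dy_eq_zero hb
  have hb_yy := Dx_Dy_eq_zero hb_y
  have hb_t := Dx_Dt_eq_zero hb
  generalize hC : F (n - 2) - (3 * s * (κ + κ ^ 2) * u_x ^ 2 * a + κ * u_x * b + κ * u_y * a
    + 2 * X * Dy b - X * Dt a) = c
  have F2 : F (n - 2) = c + 3 * s * (κ + κ ^ 2) * u_x ^ 2 * a + κ * u_x * b + κ * u_y * a
      + 2 * X * Dy b - X * Dt a := by
    rw [← hC]
    ring
  have hc : Dx c = 0 := by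
    rw [← hC, map_sub, h2, F1]
    simp only [coordinate_names, derivation_rules, total_derivatives, Derivation.map_intCast,
      Nat.reduceAdd, Nat.reduceSub, trivial_rules, ha, ha_y, ha_t, hb, hb_y, hZ]
    linear_combination (-(κ + κ ^ 2) * co (.u0 1 0) * co (.u0 2 0) * a) * hs
  have hc_y := Dx_Dy_eq_zero hc
  refine ⟨b, c, F (n - 3) - ((κ + κ ^ 2) * u_x * u_y * a
    + s * (2 * κ + 3 * κ ^ 2 + κ ^ 3) * u_x ^ 3 * a
    + 3 * s * (κ + κ ^ 2) * u_x ^ 2 * b + 2 * κ * X * u_x * Dy b - κ * X * u_x * Dt a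
    + κ * u_x * c + κ * u_t * a + κ * u_y * b + 3 * u * Dy b - 2 * u * Dt a
    + 2 * X ^ 2 * Dy (Dy b) + 2 * X * Dy c - X * Dt b), hb, hc, ?_, F1, F2, by ring⟩
  rw [map_sub, h3, F1, F2]
  simp only [coordinate_names, derivation_rules, total_derivatives, Derivation.map_intCast, Dt_Dy,
    Nat.reduceAdd, Nat.reduceSub, trivial_rules, ha, ha_y, ha_t, ha_ty, hb, hb_y, hb_yy, hb_t, hc,
    hc_y, hZ]
  linear_combination (κ + κ ^ 2) * (2 * a * co (.u0 1 0) * co (.u1 1 0)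
    + a * co (.u0 1 0) ^ 2 * co (.u0 2 0) - b * co (.u0 1 0) * co (.u0 2 0)) * hs

/-- The next obstruction, for index n - 4, in the coordinate u_yt: `2 * Dy` of the term κ u_t F n
and `-Dt` of the term κ u_y F n leave κ F n as Euler expression. -/
theorem Transport.leading_eq_zero {κ : ℤ} (hκ : κ ≠ 0) {F : ℤ → FE} (hF : Transport κ F) {n : ℤ}
    (hn : ∀ j, n < j → F j = 0) : F n = 0 := by
  obtain ⟨s, hs, hZ⟩ := exists_sixth
  obtain ⟨b, c, f, hb, hc, hf, F1, F2, F3⟩ := hF.exists_expansion hn hs hZ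
  have ha := (hF.leading hn).1
  have ha_y := hF.Dy_leading hn
  have h4 := hF (n - 4)
  rw [show n - 4 + 1 = n - 3 by ring, show n - 4 + 2 = n - 2 by ring, F2, F3] at h4
  generalize F n = a at *
  have ha_t := Dx_Dt_eq_zero ha
  have ha_tt := Dx_Dt_eq_zero ha_t
  have ha_ty := Dy_Dt_eq_zero ha_y
  have hb_y := Dx_Dy_eq_zero hb
  have hb_yy := Dx_Dy_eq_zero hb_y
  have hb_yyy := Dx_Dy_eq_zero hb_yy
  have hb_t := Dx_Dt_eq_zero hb
  have hb_ty := Dx_Dy_eq_zero hb_t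
  have hc_y := Dx_Dy_eq_zero hc
  have hc_yy := Dx_Dy_eq_zero hc_y
  have hc_t := Dx_Dt_eq_zero hc
  have hf_y := Dx_Dy_eq_zero hf
  simp only [coordinate_names, derivation_rules, total_derivatives, Derivation.map_intCast, Dt_Dy,
    Nat.reduceAdd, Nat.reduceSub, trivial_rules, ha, ha_y, ha_t, ha_ty, hb, hb_y, hb_yy, hb_t, hc,
    hc_y, hf, hZ] at h4
  have e := euler_of_Dx h4 false true 1 fun k => by
    simp only [derivation_rules, Derivation.map_intCast, jet, pd_co, reduceCtorEq, if_false,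
      trivial_rules, pd_u_of_Dx ha, pd_u_of_Dx ha_t, pd_u_of_Dx ha_tt, pd_u_of_Dx hb,
      pd_u_of_Dx hb_y, pd_u_of_Dx hb_yy, pd_u_of_Dx hb_yyy,
      pd_u_of_Dx hb_t, pd_u_of_Dx hb_ty, pd_u_of_Dx hc, pd_u_of_Dx hc_y, pd_u_of_Dx hc_yy,
      pd_u_of_Dx hc_t, pd_u_of_Dx hf, pd_u_of_Dx hf_y, hZ]
    simp
  simp only [derivation_rules, Derivation.map_intCast, jet, pd_co, reduceCtorEq, if_false, if_true,
      trivial_rules, pd_u_of_Dx ha, pd_u_of_Dx ha_t, pd_u_of_Dx ha_tt, pd_u_of_Dx hb,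
      pd_u_of_Dx hb_y, pd_u_of_Dx hb_yy, pd_u_of_Dx hb_yyy,
      pd_u_of_Dx hb_t, pd_u_of_Dx hb_ty, pd_u_of_Dx hc, pd_u_of_Dx hc_y, pd_u_of_Dx hc_yy,
      pd_u_of_Dx hc_t, pd_u_of_Dx hf, pd_u_of_Dx hf_y, hZ, Coord.u1.injEq, zero_ne_one, one_ne_zero,
      and_true, and_false, total_derivatives, ha, Nat.reduceAdd, Nat.reduceSub] at e
  refine eq_zero_of_intCast_mul hκ ?_
  linear_combination e

/-- For κ = 0 constants are solutions, and the obstruction only sees derivatives. For index n - 4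
the Euler operator in u_y links `Dy b` to `Dt (F n)`; for index n - 5 the one in u_t makes `Dt (F
n)` vanish. -/
theorem Transport.Dt_leading {F : ℤ → FE} (hF : Transport 0 F) {n : ℤ}
    (hn : ∀ j, n < j → F j = 0) : Dt (F n) = 0 := by
  obtain ⟨s, hs, hZ⟩ := exists_sixth
  obtain ⟨b, c, f, hb, hc, hf, F1, F2, F3⟩ := hF.exists_expansion hn hs hZ
  have ha := (hF.leading hn).1
  have ha_y := hF.Dy_leading hn
  have h4 := hF (n - 4)
  have h5 := hF (n - 5)
  rw [show n - 4 + 1 = n - 3 by ring, show n - 4 + 2 = n - 2 by ring] at h4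
  rw [show n - 5 + 1 = n - 4 by ring, show n - 5 + 2 = n - 3 by ring] at h5
  generalize F n = a at *
  have hb_y := Dx_Dy_eq_zero hb
  have hb_yy := Dx_Dy_eq_zero hb_y
  have hb_yyy := Dx_Dy_eq_zero hb_yy
  have hb_t := Dx_Dt_eq_zero hb
  have hb_ty := Dx_Dy_eq_zero hb_t
  have hb_tt := Dx_Dt_eq_zero hb_t
  have hc_y := Dx_Dy_eq_zero hc
  have hc_yy := Dx_Dy_eq_zero hc_y
  have hc_yyy := Dx_Dy_eq_zero hc_yy
  have hc_t := Dx_Dt_eq_zero hc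
  have hc_ty := Dx_Dy_eq_zero hc_t
  have hf_y := Dx_Dy_eq_zero hf
  have hf_yy := Dx_Dy_eq_zero hf_y
  have hf_t := Dx_Dt_eq_zero hf
  -- The relation to come is 4 `Dy b` = 3 `Dt (F n)`; in terms of m it needs no fractions.
  obtain ⟨m, hm, hm_x, hm_y⟩ : ∃ m, Dt a = 4 * m ∧ Dx m = 0 ∧ Dy m = 0 := by
    refine ⟨(1 / 4 : ℝ) • Dt a, ?_, ?_, ?_⟩
    · rw [show (4 : FE) = algebraMap ℝ FE 4 from (map_ofNat _ 4).symm, ← Algebra.smul_def, smul_smul]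
      norm_num
    · rw [Derivation.map_smul, Dx_Dt_eq_zero ha, smul_zero]
    · rw [Derivation.map_smul, Dy_Dt_eq_zero ha_y, smul_zero]
  have hm_t := Dx_Dt_eq_zero hm_x
  have hm_ty := Dy_Dt_eq_zero hm_y
  rw [hm] at F2 F3
  simp only [Int.cast_zero, zero_mul, mul_zero, add_zero, sub_zero, ne_eq, OfNat.ofNat_ne_zero,
    not_false_eq_true, zero_pow] at F2 F3 h4 h5
  have hmb : Dy b = 3 * m := by
    rw [F2, F3] at h4
    simp only [coordinate_names, derivation_rules, total_derivatives, Dt_Dy, Nat.reduceAdd,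
      Nat.reduceSub, trivial_rules, hb, hb_y, hb_yy, hb_t, hc, hc_y, hf, hm_x, hm_y] at h4
    have e := euler_of_Dx h4 false true 0 fun k => by
      simp only [derivation_rules, jet, pd_co, reduceCtorEq, if_false, trivial_rules,
        pd_u_of_Dx hb_y, pd_u_of_Dx hb_yy, pd_u_of_Dx hb_yyy, pd_u_of_Dx hb_t, pd_u_of_Dx hb_ty,
        pd_u_of_Dx hc_y, pd_u_of_Dx hc_yy, pd_u_of_Dx hc_t, pd_u_of_Dx hf_y, pd_u_of_Dx hm_x,
        pd_u_of_Dx hm_t]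
      simp
    simp only [derivation_rules, jet, pd_co, reduceCtorEq, if_false, if_true, trivial_rules,
      pd_u_of_Dx hb_y, pd_u_of_Dx hb_yy, pd_u_of_Dx hb_yyy, pd_u_of_Dx hb_t, pd_u_of_Dx hb_ty,
      pd_u_of_Dx hc_y, pd_u_of_Dx hc_yy, pd_u_of_Dx hc_t, pd_u_of_Dx hf_y, pd_u_of_Dx hm_x,
      pd_u_of_Dx hm_t, Coord.u1.injEq, zero_ne_one, one_ne_zero, and_true] at e
    refine sub_eq_zero.1 (eq_zero_of_ofNat_mul 4 ?_)
    linear_combination e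
  have hb_ty' : Dy (Dt b) = 3 * Dt m := by
    rw [← Dt_Dy, hmb]
    simp [derivation_rules]
  have F2' : F (n - 2) = c + 2 * X * m := by
    rw [F2, hmb]
    ring
  have F3' : F (n - 3) = f + u * m + 2 * X * Dy c - X * Dt b := by
    rw [F3, hmb, derivation_rules.2.2.2.1, hm_y, derivation_rules.2.2.2.2.2.1]
    ring
  generalize hG : F (n - 4) - (2 * X * Dy f + 2 * X ^ 2 * Dy (Dy c) - 4 * X ^ 2 * Dt m - X * Dt c
    + 3 * u * Dy c - 2 * u * Dt b) = g
  have hg : Dx g = 0 := by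
    rw [← hG, map_sub, h4, F2', F3']
    simp only [coordinate_names, derivation_rules, total_derivatives, Dt_Dy,
      Nat.reduceAdd, Nat.reduceSub, trivial_rules, hb_t, hb_ty', hc, hc_y, hc_yy, hc_t, hf,
      hf_y, hm_x, hm_y, hm_t]
    ring
  have hg_y := Dx_Dy_eq_zero hg
  have F4 : F (n - 4) = g + 2 * X * Dy f + 2 * X ^ 2 * Dy (Dy c) - 4 * X ^ 2 * Dt m - X * Dt c
      + 3 * u * Dy c - 2 * u * Dt b := by
    rw [← hG]
    ring
  rw [F3', F4] at h5
  simp only [coordinate_names, derivation_rules, total_derivatives, Dt_Dy, Nat.reduceAdd,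
    Nat.reduceSub, trivial_rules, hb_t, hb_ty', hc, hc_y, hc_yy, hc_t, hf, hf_y, hg, hm_x, hm_y,
    hm_t, hm_ty] at h5
  -- The only occurrence of u_t is the term -m u_t, from `-Dt` of u m in F (n - 3).
  have e := euler_of_Dx h5 false false 1 fun k => by
    simp only [derivation_rules, jet, pd_co, reduceCtorEq, if_false, trivial_rules,
      pd_u_of_Dx hb_t, pd_u_of_Dx hb_tt, pd_u_of_Dx hc_y, pd_u_of_Dx hc_yy, pd_u_of_Dx hc_yyy,
      pd_u_of_Dx hc_t, pd_u_of_Dx hc_ty, pd_u_of_Dx hf_y, pd_u_of_Dx hf_yy, pd_u_of_Dx hf_t,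
      pd_u_of_Dx hg_y, pd_u_of_Dx hm_x, pd_u_of_Dx hm_t]
    simp
  simp only [derivation_rules, jet, pd_co, reduceCtorEq, if_false, trivial_rules,
    pd_u_of_Dx hb_t, pd_u_of_Dx hb_tt, pd_u_of_Dx hc_y, pd_u_of_Dx hc_yy, pd_u_of_Dx hc_yyy,
    pd_u_of_Dx hc_t, pd_u_of_Dx hc_ty, pd_u_of_Dx hf_y, pd_u_of_Dx hf_yy, pd_u_of_Dx hf_t,
    pd_u_of_Dx hg_y, pd_u_of_Dx hm_x, pd_u_of_Dx hm_t, Coord.u0.injEq, zero_ne_one, one_ne_zero,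
    and_true, and_false] at e
  simp at e
  rw [hm, e]
  ring

/-- Solutions of the transport equation of nonzero weight vanish. -/
theorem Transport.eq_zero {κ : ℤ} (hκ : κ ≠ 0) {F : ℤ → FE} (hF : Transport κ F) {n : ℕ}
    (hn : ∀ j : ℤ, n < j → F j = 0) (j : ℤ) : F j = 0 := by
  have key : ∀ m : ℕ, ∀ j : ℤ, n - j < m → F j = 0 := by
    intro m
    induction m with
    | zero => exact fun j hj => hn j (by push_cast at hj; omega)
    | succ m ih =>
      exact fun j hj => hF.leading_eq_zero hκ fun i hi => ih i (by push_cast at hj; omega)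
  exact key (n - j + 1).toNat j (by omega)

/-- In weight zero the equation involves F only through its derivatives, so constants may be
subtracted. This allows induction on the degree. -/
theorem Transport.sub_single {F : ℤ → FE} (hF : Transport 0 F) {a : FE} (hx : Dx a = 0)
    (hy : Dy a = 0) (ht : Dt a = 0) (n : ℤ) :
    Transport 0 fun j => F j - if j = n then a else 0 := by
  intro j
  have h : ∀ (Z : VF) (j : ℤ), Z a = 0 → Z (F j - if j = n then a else 0) = Z (F j) := by
    intro Z j hZ
    rw [map_sub]
    split_ifs <;> simp [hZ]
  simp only [h _ _ hx, h _ _ hy, h _ _ ht]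
  have := hF j
  rw [Int.cast_zero] at this ⊢
  linear_combination this

/-- Solutions of the transport equation of weight zero are constant. -/
theorem Transport.exists_const {F : ℤ → FE} (hF : Transport 0 F) {n : ℕ}
    (hn : ∀ j : ℤ, n < j → F j = 0) (j : ℤ) (hj : 0 ≤ j) : ∃ r : ℝ, F j = algebraMap ℝ FE r := by
  have key : ∀ (n : ℕ) (F : ℤ → FE), Transport 0 F → (∀ j : ℤ, n ≤ j → F j = 0) → ∀ j, 0 ≤ j →
      ∃ r : ℝ, F j = algebraMap ℝ FE r := by
    intro n
    induction n with
    | zero => exact fun F _ h j hj => ⟨0, by rw [h j (by simpa using hj), map_zero]⟩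
    | succ n ih =>
      intro F hF h j hj
      have hn : ∀ j, (n : ℤ) < j → F j = 0 := fun j hj => h j (by push_cast; omega)
      obtain ⟨r, hr⟩ := exists_eq_const (hF.leading hn).1 (hF.Dy_leading hn) (hF.Dt_leading hn)
      rcases eq_or_ne j n with rfl | hjn
      · exact ⟨r, hr⟩
      · obtain ⟨q, hq⟩ := ih _ (hF.sub_single (hF.leading hn).1 (hF.Dy_leading hn)
          (hF.Dt_leading hn) n) (fun j hj => by
            rcases eq_or_ne j n with rfl | hjn
            · simp
            · simp [hjn, hn j (by omega)]) j hj
        exact ⟨q, by simpa [hjn] using hq⟩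
  exact key (n + 1) F hF (fun j hj => hn j (by push_cast at hj; omega)) j hj

/-! ## Reduction of the order of solutions of the linearized equation -/

theorem HasOrder.add {s : Bool} {N : ℤ} {f g : FE} (hf : HasOrder s N f) (hg : HasOrder s N g) :
    HasOrder s N (f + g) :=
  ⟨fun a b h => by rw [map_add, hf.1 a b h, hg.1 a b h, add_zero],
    fun a b h => by rw [map_add, hf.2 a b h, hg.2 a b h, add_zero],
    fun h i a b => by rw [map_add, hf.3 h, hg.3 h, add_zero]⟩

theorem HasOrder.smul {s : Bool} {N : ℤ} {f : FE} (hf : HasOrder s N f) (r : ℝ) :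
    HasOrder s N (r • f) :=
  ⟨fun a b h => by rw [Derivation.map_smul, hf.1 a b h, smul_zero],
    fun a b h => by rw [Derivation.map_smul, hf.2 a b h, smul_zero],
    fun h i a b => by rw [Derivation.map_smul, hf.3 h, smul_zero]⟩

theorem HasOrder.sub {s : Bool} {N : ℤ} {f g : FE} (hf : HasOrder s N f) (hg : HasOrder s N g) :
    HasOrder s N (f - g) := by
  rw [sub_eq_add_neg, ← neg_one_smul ℝ g]
  exact hf.add (hg.smul _)

/-- The linearized operator as a linear map. -/
noncomputable def linOpHom (c : ℤ) : FE →ₗ[ℝ] FE where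
  toFun := linOp c
  map_add' f g := by
    simp only [linOp, map_add]
    ring
  map_smul' r f := by
    simp only [linOp, Derivation.map_smul, mul_smul_comm, smul_sub, smul_add, RingHom.id_apply]
    rw [← smul_sub r (u_xx * _), mul_smul_comm]

theorem linOp_add (c : ℤ) (f g : FE) : linOp c (f + g) = linOp c f + linOp c g :=
  map_add (linOpHom c) f g

theorem linOp_sub (c : ℤ) (f g : FE) : linOp c (f - g) = linOp c f - linOp c g :=
  map_sub (linOpHom c) f g

theorem linOp_smul (c : ℤ) (r : ℝ) (f : FE) : linOp c (r • f) = r • linOp c f :=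
  map_smul (linOpHom c) r f

theorem Transport.of_linOp {s : Bool} {N : ℕ} {f : FE} (h : HasOrder s N f)
    (hN : s = true ∨ 2 ≤ (N : ℤ)) {c : ℤ} (hf : linOp c f = 0) :
    Transport (c - weight s - N) (intCoeff (symbol s N f)) :=
  transport_of_symbol (symbol_transport h hN hf)

theorem intCoeff_of_natDegree_lt (P : Polynomial FE) (j : ℤ) (hj : P.natDegree < j) :
    intCoeff P j = 0 := by
  rw [intCoeff, if_pos (by omega), Polynomial.coeff_eq_zero_of_natDegree_lt (by omega)]

theorem intCoeff_natCast (P : Polynomial FE) (j : ℕ) : intCoeff P j = P.coeff j := by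
  simp [intCoeff]

theorem HasOrder.pred_of_linOp {s : Bool} {N : ℕ} {f : FE} (h : HasOrder s N f)
    (hN : s = true ∨ 2 ≤ (N : ℤ)) {c : ℤ} (hf : linOp c f = 0) (hκ : c - weight s - N ≠ 0) :
    HasOrder s (N - 1) f := by
  refine h.pred (Polynomial.ext fun j => ?_)
  rw [← intCoeff_natCast, Polynomial.coeff_zero]
  exact (Transport.of_linOp h hN hf).eq_zero hκ (intCoeff_of_natDegree_lt _) j

theorem exists_symbol_coeff {s : Bool} {N : ℕ} {f : FE} (h : HasOrder s N f)
    (hN : s = true ∨ 2 ≤ (N : ℤ)) {c : ℤ} (hf : linOp c f = 0) (hκ : c - weight s - N = 0)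
    (j : ℕ) : ∃ r : ℝ, (symbol s N f).coeff j = algebraMap ℝ FE r := by
  have hT := Transport.of_linOp h hN hf
  rw [hκ] at hT
  simpa [intCoeff_natCast] using hT.exists_const (intCoeff_of_natDegree_lt _) j (by omega)

/-- Lowers the order one step at a time as long as the weight is nonzero. M = -1 expresses
independence of all jets concerned, and M ≥ -1 keeps every order at which a symbol is taken a
natural number. -/
theorem HasOrder.descend {s : Bool} {M : ℤ} (hM : -1 ≤ M) {f : FE} {c : ℤ} (hf : linOp c f = 0)
    (hN : s = true ∨ 1 ≤ M) (hκ : ∀ N, M < N → c - weight s - N ≠ 0) (n : ℕ)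
    (h : HasOrder s (M + n) f) : HasOrder s M f := by
  induction n with
  | zero => simpa using h
  | succ n ih =>
    refine ih ?_
    have hc : M + (n + 1 : ℕ) = ((M + (n + 1 : ℕ)).toNat : ℤ) := by
      push_cast
      omega
    rw [hc] at h
    have := h.pred_of_linOp (hN.imp id fun _ => by omega) hf (hκ _ (by omega))
    rw [← hc] at this
    convert this using 1
    push_cast
    ring

theorem exists_hasOrder_true (f : FE) : ∃ N : ℕ, HasOrder true N f := by
  obtain ⟨N, hN⟩ := exists_pj_eq_zero f
  exact ⟨N + 1, fun a b h => hN _ _ a b (by push_cast at h; omega),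
    fun a b h => hN _ _ a b (by push_cast at h; omega), fun h => by simp at h⟩

theorem exists_hasOrder_false {f : FE} (hv : ∀ i a b, pj true i a b f = 0) :
    ∃ N : ℕ, HasOrder false N f := by
  obtain ⟨N, hN⟩ := exists_pj_eq_zero f
  exact ⟨N + 1, fun a b h => hN _ _ a b (by push_cast at h; omega),
    fun a b h => hN _ _ a b (by push_cast at h; omega), fun _ => hv⟩

theorem HasOrder.of_le {s : Bool} {M : ℤ} {f : FE} (hM : -1 ≤ M) {N : ℕ} (h : HasOrder s N f) :
    HasOrder s (M + (N + 1 : ℕ)) f := h.mono (by push_cast; omega)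

/-- The `u`-components of symmetries depend on the first derivatives of `u` only. -/
theorem hasOrder_one_of_linOp_neg_one {f : FE} (hf : linOp (-1) f = 0) : HasOrder false 1 f := by
  obtain ⟨N, hN⟩ := exists_hasOrder_true f
  -- Along v the weight is -3 - N, never zero.
  have h1 : HasOrder true (-1) f := HasOrder.descend le_rfl hf (.inl rfl)
    (fun N hN => by simp only [weight]; omega) _ (hN.of_le le_rfl)
  obtain ⟨N, hN⟩ := exists_hasOrder_false (f := f) fun i a b => by
    rcases lt_or_ge (a + b) 0 with h | h
    · exact pj_of_neg _ _ (by omega) f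
    · cases i
      · exact h1.1 a b (by omega)
      · exact h1.2 a b (by omega)
  -- Along u the weight is -N; the descent stops at one since the transport equation requires N ≥ 2.
  exact HasOrder.descend (by norm_num) hf (.inr le_rfl)
    (fun N hN => by simp only [weight]; omega) _ (hN.of_le (by norm_num))

theorem isGenerating_zero_left {f : FE} : IsGenerating (0, f) ↔ linOp 2 f = 0 := by
  have h0 : ∀ (Z : VF) n, Z^[n] (0 : FE) = 0 := fun Z n => iterate_map_zero Z n
  have h1 : Ev (0, f) rhsU = 0 := by
    simp [derivation_rules, total_derivatives, Ev_u0, Ev_u1, h0]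
  have h2 : Ev (0, f) rhsV = Dx (Dt f) - u_x * Dx (Dy f) - 2 * u_xx * Dy f + 2 * u_xy * Dx f
      + u_y * Dx (Dx f) := by
    simp only [total_derivatives, derivation_rules, evolutionary_components, trivial_rules]
    simp only [u_x, u_y, u_xx, u_xy]
    simp
    ring
  rw [IsGenerating, h1, h2, linOp]
  simp only [map_zero, true_and, ← sub_eq_zero (b := Dx (Dt f) - _ - _ + _ + _)]
  push_cast
  constructor <;> intro h <;> linear_combination h

/-- The first equation of the system does not involve v, so its linearization restricts the
u-component alone. -/
theorem linOp_neg_one_of_isGenerating {φ : Section} (h : IsGenerating φ) : linOp (-1) φ.1 = 0 := by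
  have h2 : Ev φ rhsU = Dx (Dt φ.1) - u_x * Dx (Dy φ.1) - u_xy * Dx φ.1 + u_xx * Dy φ.1
      + u_y * Dx (Dx φ.1) := by
    simp only [total_derivatives, derivation_rules, evolutionary_components]
    simp only [u_x, u_y, u_xx, u_xy]
    ring
  have := h.1
  rw [h2] at this
  rw [linOp]
  push_cast
  linear_combination this

theorem v_eq_jet : v = co (jet true false 0 0) := rfl

theorem linOp_v : linOp 2 v = 0 := isGenerating_zero_left.1 isGenerating_phi1_phi2_phi7.2.2

/-- The `v`-components of symmetries with trivial `u`-component depend linearly on `v`, and not on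
its derivatives. -/
theorem exists_sub_smul_v {f : FE} (hf : linOp 2 f = 0) :
    ∃ r : ℝ, ∀ i a b, pj true i a b (f - r • v) = 0 := by
  obtain ⟨N, hN⟩ := exists_hasOrder_true f
  -- Along v the weight is now -N. It vanishes at N = 0 alone, where the symbol is a constant: the
  -- derivative of f along v.
  have h0 : HasOrder true 0 f := HasOrder.descend (by norm_num) hf (.inl rfl)
    (fun N hN => by simp only [weight]; omega) _ (hN.of_le (by norm_num))
  obtain ⟨r, hr⟩ := exists_symbol_coeff (N := 0) h0 (.inl rfl) hf (by simp [weight]) 0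
  have hP : pj true false 0 0 f = algebraMap ℝ FE r := by
    rw [← hr, symbol, polyOf, polyOf]
    simp [pj_of_neg]
  refine ⟨r, fun i a b => ?_⟩
  have hv : pj true i a b v = if i = false ∧ a = 0 ∧ b = 0 then 1 else 0 := by
    rw [v_eq_jet, pj_jet]
    simp
  rw [map_sub, Derivation.map_smul, hv]
  rcases lt_or_ge (a + b) 0 with h | h
  · rw [pj_of_neg _ _ (by omega), if_neg (by omega)]
    simp
  cases i
  · rcases lt_or_ge 0 (a + b) with h' | h'
    · rw [h0.1 a b h', if_neg (by omega)]
      simp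
    · rcases lt_or_ge a 0 with ha | ha
      · rw [pj_of_neg _ _ (by omega), if_neg (by omega)]
        simp
      rcases lt_or_ge b 0 with hb | hb
      · rw [pj_of_neg _ _ (by omega), if_neg (by omega)]
        simp
      obtain rfl : a = 0 := by omega
      obtain rfl : b = 0 := by omega
      rw [hP, if_pos (by simp), Algebra.algebraMap_eq_smul_one, sub_self]
  · rw [h0.2 a b (by omega), if_neg (by simp)]
    simp

/-! ### Symbols of order three and the generators of `a7` -/

theorem pj_u_coordinates (s i : Bool) (a b : ℤ) (k l : ℕ) :
    pj s i a b (co (.u0 k l)) = (if false = s ∧ false = i ∧ a = k ∧ b = l then 1 else 0) ∧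
    pj s i a b (co (.u1 k l)) = (if false = s ∧ true = i ∧ a = k ∧ b = l then 1 else 0) := by
  have h0 := pj_jet s i false false a b k l
  have h1 := pj_jet s i false true a b k l
  simp only [jet] at h0 h1
  rw [h0, h1]
  simp only [eq_comm (a := s), eq_comm (a := i), and_self]

/-- The derivations annihilating the derivatives of `u` of order at most three annihilate the
generators of `a7`. -/
theorem apply_a7_eq_zero {Z : VF} (h0 : ∀ k l, k + l ≤ 3 → Z (co (.u0 k l)) = 0)
    (h1 : ∀ k l, k + l ≤ 2 → Z (co (.u1 k l)) = 0) :
    Z phi8.2 = 0 ∧ Z phi9.2 = 0 ∧ Z phi10.2 = 0 ∧ Z phi11.2 = 0 ∧ Z phi12.2 = 0 ∧ Z phi13.2 = 0 ∧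
      Z phi14.2 = 0 := by
  refine ⟨?_, ?_, ?_, ?_, ?_, ?_, ?_⟩ <;>
    simp only [phi8, phi9, phi10, phi11, phi12, phi13, phi14, coordinate_names, derivation_rules,
      trivial_rules, h0, h1, Nat.reduceAdd, Nat.reduceLeDiff, le_refl]

theorem hasOrder_a7 : HasOrder false 3 phi8.2 ∧ HasOrder false 3 phi9.2 ∧ HasOrder false 3 phi10.2 ∧
    HasOrder false 3 phi11.2 ∧ HasOrder false 3 phi12.2 ∧ HasOrder false 3 phi13.2 ∧
    HasOrder false 3 phi14.2 := by
  have hP := fun a b (hab : 3 < a + b) => apply_a7_eq_zero (Z := pj false false a b)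
    (fun k l hkl => by rw [(pj_u_coordinates _ _ a b k l).1, if_neg (by omega)])
    (fun k l hkl => by rw [(pj_u_coordinates _ _ a b k l).2, if_neg (by simp)])
  have hQ := fun a b (hab : 3 - 1 < a + b) => apply_a7_eq_zero (Z := pj false true a b)
    (fun k l hkl => by rw [(pj_u_coordinates _ _ a b k l).1, if_neg (by simp)])
    (fun k l hkl => by rw [(pj_u_coordinates _ _ a b k l).2, if_neg (by omega)])
  have hv := fun i a b => apply_a7_eq_zero (Z := pj true i a b)
    (fun k l hkl => by rw [(pj_u_coordinates _ _ a b k l).1, if_neg (by simp)])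
    (fun k l hkl => by rw [(pj_u_coordinates _ _ a b k l).2, if_neg (by simp)])
  exact ⟨⟨fun a b h => (hP a b h).1, fun a b h => (hQ a b h).1, fun _ i a b => (hv i a b).1⟩,
    ⟨fun a b h => (hP a b h).2.1, fun a b h => (hQ a b h).2.1, fun _ i a b => (hv i a b).2.1⟩,
    ⟨fun a b h => (hP a b h).2.2.1, fun a b h => (hQ a b h).2.2.1,
      fun _ i a b => (hv i a b).2.2.1⟩,
    ⟨fun a b h => (hP a b h).2.2.2.1, fun a b h => (hQ a b h).2.2.2.1,
      fun _ i a b => (hv i a b).2.2.2.1⟩,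
    ⟨fun a b h => (hP a b h).2.2.2.2.1, fun a b h => (hQ a b h).2.2.2.2.1,
      fun _ i a b => (hv i a b).2.2.2.2.1⟩,
    ⟨fun a b h => (hP a b h).2.2.2.2.2.1, fun a b h => (hQ a b h).2.2.2.2.2.1,
      fun _ i a b => (hv i a b).2.2.2.2.2.1⟩,
    ⟨fun a b h => (hP a b h).2.2.2.2.2.2, fun a b h => (hQ a b h).2.2.2.2.2.2,
      fun _ i a b => (hv i a b).2.2.2.2.2.2⟩⟩

open Polynomial in
theorem symbol_three (f : FE) : symbol false 3 f = C (pd (.u0 3 0) f) + C (pd (.u0 2 1) f) * quadSym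
    + C (pd (.u0 1 2) f) * quadSym ^ 2 + C (pd (.u0 0 3) f) * quadSym ^ 3
    + linSym * (C (pd (.u1 2 0) f) + C (pd (.u1 1 1) f) * quadSym
      + C (pd (.u1 0 2) f) * quadSym ^ 2) := by
  rw [symbol, polyOf, polyOf]
  simp [Finset.sum_range_succ, pj, jet]

theorem symbol_three_add (f g : FE) : symbol false 3 (f + g) = symbol false 3 f + symbol false 3 g := by
  simp only [symbol_three, map_add]
  ring

theorem symbol_three_sub (f g : FE) : symbol false 3 (f - g) = symbol false 3 f - symbol false 3 g := by
  simp only [symbol_three, map_sub]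
  ring

open Polynomial in
theorem symbol_three_smul (r : ℝ) (f : FE) :
    symbol false 3 (r • f) = C (algebraMap ℝ FE r) * symbol false 3 f := by
  simp only [symbol_three, Derivation.map_smul]
  simp only [Algebra.smul_def, map_mul]
  ring

open Polynomial in
-- The largest degrees are 6, from `quadSym ^ 3`, and 5, from `linSym * quadSym ^ 2`; hence at most
-- seven constants, matched by the seven generators of `a7`.
theorem natDegree_symbol_three_lt (f : FE) : (symbol false 3 f).natDegree < 7 := by
  rw [symbol_three, quadSym, linSym, Nat.lt_succ_iff]
  compute_degree

open Polynomial in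
-- The leading coefficients of these generators expand powers of X in terms of `quadSym` and
-- `linSym`, starting from X = `linSym` + u_x and X² = `quadSym` + u_x X + u_y.
theorem symbol_a7 : symbol false 3 phi8.2 = 1 ∧ symbol false 3 phi9.2 = Polynomial.X ∧
    symbol false 3 phi10.2 = Polynomial.X ^ 2 ∧ symbol false 3 phi11.2 = Polynomial.X ^ 3 ∧
    symbol false 3 phi12.2 = Polynomial.X ^ 4 ∧ symbol false 3 phi13.2 = Polynomial.X ^ 5 ∧
    symbol false 3 phi14.2 = Polynomial.X ^ 6 := by
  simp only [symbol_three]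
  refine ⟨?_, ?_, ?_, ?_, ?_, ?_, ?_⟩ <;>
    simp only [phi8, phi9, phi10, phi11, phi12, phi13, phi14, coordinate_names, derivation_rules,
      trivial_rules, pd_co, reduceCtorEq, Coord.u0.injEq, Coord.u1.injEq, OfNat.ofNat_ne_zero,
      OfNat.zero_ne_ofNat, OfNat.ofNat_ne_one, OfNat.one_ne_ofNat, zero_ne_one, one_ne_zero, and_true,
      true_and, and_false, false_and, if_false, if_true, and_self, Nat.succ_ne_self,
      show (3 : ℕ) ≠ 2 by decide, show (2 : ℕ) ≠ 3 by decide, quadSym, linSym, map_zero, map_one,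
      map_add, map_mul, map_pow, map_ofNat, zero_add, zero_mul, mul_zero, add_zero] <;>
    ring

theorem linOp_sub_a7 {f : FE} (hf : linOp 2 f = 0) (r : ℕ → ℝ) :
    linOp 2 (f - (r 0 • phi8.2 + r 1 • phi9.2 + r 2 • phi10.2
      + r 3 • phi11.2 + r 4 • phi12.2 + r 5 • phi13.2 + r 6 • phi14.2)) = 0 := by
  obtain ⟨g8, g9, g10, g11, g12, g13, g14⟩ := isGenerating_a7
  have l8 : linOp 2 phi8.2 = 0 := isGenerating_zero_left.1 g8
  have l9 : linOp 2 phi9.2 = 0 := isGenerating_zero_left.1 g9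
  have l10 : linOp 2 phi10.2 = 0 := isGenerating_zero_left.1 g10
  have l11 : linOp 2 phi11.2 = 0 := isGenerating_zero_left.1 g11
  have l12 : linOp 2 phi12.2 = 0 := isGenerating_zero_left.1 g12
  have l13 : linOp 2 phi13.2 = 0 := isGenerating_zero_left.1 g13
  have l14 : linOp 2 phi14.2 = 0 := isGenerating_zero_left.1 g14
  simp only [linOp_sub, linOp_add, linOp_smul, l8, l9, l10, l11, l12, l13, l14, hf, smul_zero,
    add_zero, sub_zero]

/-- Subtracting generators of `a7`, the order of solutions of the linearized equation is reduced to
one. -/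
theorem exists_sub_a7 {f : FE} (hf : linOp 2 f = 0) (hv : ∀ i a b, pj true i a b f = 0) :
    ∃ r : Fin 7 → ℝ, HasOrder false 1 (f - (r 0 • phi8.2 + r 1 • phi9.2 + r 2 • phi10.2
      + r 3 • phi11.2 + r 4 • phi12.2 + r 5 • phi13.2 + r 6 • phi14.2)) ∧
    linOp 2 (f - (r 0 • phi8.2 + r 1 • phi9.2 + r 2 • phi10.2
      + r 3 • phi11.2 + r 4 • phi12.2 + r 5 • phi13.2 + r 6 • phi14.2)) = 0 := by
  obtain ⟨N, hN⟩ := exists_hasOrder_false hv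
  -- Along u the weight is 3 - N, nonzero above order three; at order three the symbol has constant
  -- coefficients.
  have h3 : HasOrder false (3 : ℕ) f := HasOrder.descend (by norm_num) hf (.inr (by norm_num))
    (fun N hN => by simp only [weight]; push_cast at hN; omega) _ (hN.of_le (by norm_num))
  have hc := exists_symbol_coeff h3 (.inr (by norm_num)) hf (by simp [weight])
  choose r hr using hc
  obtain ⟨o8, o9, o10, o11, o12, o13, o14⟩ := hasOrder_a7
  obtain ⟨s8, s9, s10, s11, s12, s13, s14⟩ := symbol_a7
  refine ⟨fun j => r j, ?_, ?_⟩
  · have h2 : HasOrder false (3 : ℕ) (f - (r 0 • phi8.2 + r 1 • phi9.2 + r 2 • phi10.2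
        + r 3 • phi11.2 + r 4 • phi12.2 + r 5 • phi13.2 + r 6 • phi14.2)) :=
      h3.sub (((((((o8.smul _).add (o9.smul _)).add (o10.smul _)).add (o11.smul _)).add
        (o12.smul _)).add (o13.smul _)).add (o14.smul _))
    have hs := (symbol false 3 f).as_sum_range_C_mul_X_pow' (natDegree_symbol_three_lt f)
    simp only [Finset.sum_range_succ, Finset.sum_range_zero, hr] at hs
    -- Subtracting the generators removes the symbol of order three; at order two the weight is 1,
    -- so the order drops once more.
    refine HasOrder.pred_of_linOp (N := 2) (h2.pred ?_) (.inr le_rfl) (linOp_sub_a7 hf r)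
      (by simp [weight])
    simp only [symbol_three_sub, symbol_three_add, symbol_three_smul, s8, s9, s10, s11, s12, s13,
      s14, hs]
    ring
  · exact linOp_sub_a7 hf r

/-! ## Solutions of first order of the linearized equation -/

theorem apply_eq_zero_of_Dx {f : FE} (h : Dx f = 0) {Z : VF} (hx : Z (co .x) = 0)
    (hy : Z (co .y) = 0) (ht : Z (co .t) = 0) : Z f = 0 := by
  rw [VF.apply_of_pd_jet (pd_jet_eq_zero_of_Dx h) Z, hx, hy, ht]
  ring

theorem pd_u_of_Dx_eq_zero {f : FE} (h : Dx f = 0) :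
    (∀ k l, pd (.u0 k l) f = 0) ∧ ∀ k l, pd (.u1 k l) f = 0 :=
  ⟨fun k l => pd_jet_eq_zero_of_Dx h false false k l,
    fun k l => pd_jet_eq_zero_of_Dx h false true k l⟩

/-- The leading derivatives of a first order solution of the linearized equation. -/
theorem first_order_derivatives {c : ℤ} {f : FE} (h : HasOrder false 1 f) (hf : linOp c f = 0) :
    Dx (pd (.u0 0 1) f) = 0 ∧
    Dx (pd (.u1 0 0) f) = 2 * Dy (pd (.u0 0 1) f) + (c + 1) * u_xx * pd (.u0 0 1) f ∧
    Dx (pd (.u0 1 0) f) = 2 * Dy (pd (.u1 0 0) f) + (c + 1) * u_xx * pd (.u1 0 0) f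
      - (c + 1) * u_xy * pd (.u0 0 1) f - Dt (pd (.u0 0 1) f)
      + u_x * (Dx (pd (.u1 0 0) f) + Dy (pd (.u0 0 1) f)) := by
  have e1 : u_x = co (.u0 1 0) := rfl
  have e2 : u_y = co (.u1 0 0) := rfl
  have e3 : u_xx = co (.u0 2 0) := rfl
  have e4 : u_xy = co (.u1 1 0) := rfl
  -- For N = 1 the coefficients u_xx and u_xy interfere at b = 0, but not at b = 1 and b = 2, and
  -- these two indices suffice.
  have hsym := linOp_symbol h hf _ _ (fun _ => rfl) (fun _ => rfl)
  have h2 := (hsym 2 (by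
    simp only [Set.mem_insert_iff, Set.mem_singleton_iff, forall_eq_or_imp, forall_eq, e1, e2, e3,
      e4, pj_u_coordinates]
    norm_num)).1
  obtain ⟨h1P, h1Q⟩ := hsym 1 (by
    simp only [Set.mem_insert_iff, Set.mem_singleton_iff, forall_eq_or_imp, forall_eq, e1, e2, e3,
      e4, pj_u_coordinates]
    norm_num)
  have hT : pj false false (1 - 1) 1 f = pd (.u0 0 1) f := by simp [pj, jet]
  have hP : pj false false (1 - (1 - 1)) (1 - 1) f = pd (.u0 1 0) f := by simp [pj, jet]
  have hQ : pj false true (1 - 1 - (1 - 1)) (1 - 1) f = pd (.u1 0 0) f := by simp [pj, jet]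
  have z1 : pj false true (1 - 1 - 1) 1 f = 0 := pj_of_neg _ _ (by omega) f
  have z2 : pj false true (1 - 1 - (1 + 1)) (1 + 1) f = 0 := pj_of_neg _ _ (by omega) f
  have z3 : pj false false (1 - (1 + 1)) (1 + 1) f = 0 := pj_of_neg _ _ (by omega) f
  have y1 : pj false true (1 - 1 - (2 - 1)) (2 - 1) f = 0 := pj_of_neg _ _ (by omega) f
  have y2 : pj false true (1 - 1 - 2) 2 f = 0 := pj_of_neg _ _ (by omega) f
  have y3 : pj false true (1 - 1 - (2 + 1)) (2 + 1) f = 0 := pj_of_neg _ _ (by omega) f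
  have y4 : pj false false (1 - 2) 2 f = 0 := pj_of_neg _ _ (by omega) f
  have y5 : pj false false (1 - (2 + 1)) (2 + 1) f = 0 := pj_of_neg _ _ (by omega) f
  have y6 : pj false false (1 - (2 - 1)) (2 - 1) f = pd (.u0 0 1) f := by simp [pj, jet]
  simp only [y1, y2, y3, y4, y5, y6, map_zero, mul_zero] at h2
  simp only [hT, hP, hQ, z1, z2, z3, map_zero, mul_zero, weight] at h1P h1Q
  have k1 : Dx (pd (.u0 0 1) f) = 0 := by linear_combination -h2
  rw [k1] at h1P h1Q
  push_cast at h1P h1Q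
  refine ⟨k1, ?_, ?_⟩
  · linear_combination -h1Q
  · linear_combination -h1P

/-- Functions of `x, y, t, u`. -/
def IsLow (g : FE) : Prop :=
  ∀ s i k l, (s = true ∨ i = true ∨ k + l ≠ 0) → pd (jet s i k l) g = 0

theorem isLow_pd {g : FE} (h : IsLow g) (c : Coord) : IsLow (pd c g) := fun s i k l hs => by
  rw [pd_comm, h s i k l hs, map_zero]

theorem isLow_apply {g : FE} (h : IsLow g) (Z : VF) : Z g = Z (co .x) * pd .x g
    + Z (co .y) * pd .y g + Z (co .t) * pd .t g
    + Z (co (.u0 0 0)) * pd (.u0 0 0) g := by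
  classical
  rw [Z.apply_eq_finset_sum g {Coord.x, Coord.y, Coord.t, Coord.u0 0 0}]
  · simp [add_assoc]
  · intro c hc
    obtain rfl | rfl | rfl | ⟨s, i, k, l, rfl⟩ := c.exists_jet
    · simp at hc
    · simp at hc
    · simp at hc
    · refine h s i k l ?_
      by_contra hn
      obtain ⟨rfl, rfl, rfl, rfl⟩ : s = false ∧ i = false ∧ k = 0 ∧ l = 0 := by simpa using hn
      simp [jet] at hc

theorem isLow_total {g : FE} (h : IsLow g) :
    Dx g = pd .x g + co (.u0 1 0) * pd (.u0 0 0) g ∧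
    Dy g = pd .y g + co (.u1 0 0) * pd (.u0 0 0) g ∧
    Dt g = pd .t g + co (.u0 0 1) * pd (.u0 0 0) g := by
  refine ⟨?_, ?_, ?_⟩ <;> rw [isLow_apply h] <;> simp

theorem isLow_pd_u {g : FE} (h : IsLow g) :
    (∀ k l, pd (.u1 k l) g = 0) ∧
    (∀ k l, pd (.u0 (k + 1) l) g = 0) ∧
    (∀ k l, pd (.u0 k (l + 1)) g = 0) :=
  ⟨fun k l => h false true k l (by simp), fun k l => h false false (k + 1) l (by simp),
    fun k l => h false false k (l + 1) (by simp)⟩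

theorem linOp_of_isLow {g : FE} (h : IsLow g) (c : ℤ) : linOp c g =
    pd .y (pd .y g) + 2 * u_y * pd .y (pd (.u0 0 0) g) + u_y ^ 2 * pd (.u0 0 0) (pd (.u0 0 0) g)
    - pd .x (pd .t g) - u_x * pd .t (pd (.u0 0 0) g) - u_t * pd .x (pd (.u0 0 0) g)
    - u_x * u_t * pd (.u0 0 0) (pd (.u0 0 0) g) + u_x * pd .x (pd .y g)
    + u_x ^ 2 * pd .y (pd (.u0 0 0) g) - u_x * u_y * pd .x (pd (.u0 0 0) g)
    - u_y * pd .x (pd .x g)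
    + c * (u_xx * (pd .y g + u_y * pd (.u0 0 0) g) - u_xy * (pd .x g + u_x * pd (.u0 0 0) g)) := by
  have h1 := pd_comm (.u0 0 0) .x g
  have h2 := pd_comm (.u0 0 0) .y g
  have h3 := pd_comm (.u0 0 0) .t g
  simp only [linOp, isLow_total h, isLow_total (isLow_pd h _), derivation_rules, total_derivatives,
    coordinate_names, h1, h2, h3, Nat.reduceAdd]
  ring

/-- If e depends on the first derivatives of u in the same way as f, the difference depends on x, y,
t, u only. -/
theorem isLow_sub {f e : FE} (h : HasOrder false 1 f)
    (he : ∀ Z : VF, Z (co .x) = 0 → Z (co .y) = 0 → Z (co .t) = 0 → Z (co (.u0 0 0)) = 0 →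
      Z e = Z (co (.u0 1 0)) * pd (.u0 1 0) f + Z (co (.u1 0 0)) * pd (.u1 0 0) f
        + Z (co (.u0 0 1)) * pd (.u0 0 1) f) : IsLow (f - e) := by
  intro s i k l hs
  have hj := jet_ne s i k l
  have hu : pd (jet s i k l) (co (.u0 0 0)) = 0 := by
    refine pd_co_of_ne fun h => ?_
    rw [show Coord.u0 0 0 = jet false false 0 0 from rfl, jet_inj] at h
    simp [h] at hs
  rw [map_sub, he _ (pd_co_of_ne hj.1) (pd_co_of_ne hj.2.1) (pd_co_of_ne hj.2.2) hu]
  simp only [← pj_natCast, pj_u_coordinates]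
  cases s
  · cases i
    · rcases Nat.lt_or_ge 1 (k + l) with hkl | hkl
      · rw [h.1 _ _ (by omega), if_neg (by omega), if_neg (by simp), if_neg (by omega)]
        ring
      · obtain ⟨rfl, rfl⟩ | ⟨rfl, rfl⟩ : (k = 1 ∧ l = 0) ∨ (k = 0 ∧ l = 1) := by
          simp at hs
          omega
        · simp [pj, jet]
        · simp [pj, jet]
    · rcases Nat.lt_or_ge 0 (k + l) with hkl | hkl
      · rw [h.2 _ _ (by omega), if_neg (by simp), if_neg (by omega), if_neg (by simp)]
        ring
      · obtain ⟨rfl, rfl⟩ : k = 0 ∧ l = 0 := by omega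
        simp [pj, jet]
  · rw [h.3 rfl]
    simp

/-- The equations of `first_order_derivatives` are integrated in x one after another, with
integration constants a, b, e, and f is rebuilt from its derivatives along u_t, u_y, u_x up to a
function of x, y, t, u. -/
theorem exists_first_order_form {c : ℤ} {f s : FE} (h : HasOrder false 1 f) (hf : linOp c f = 0)
    (hs : 6 * s = 1) (hZ : ∀ Z : VF, Z s = 0) :
    ∃ a b e g, Dx a = 0 ∧ Dx b = 0 ∧ Dx e = 0 ∧ IsLow g ∧ pd (.u0 0 1) f = a ∧
      pd (.u1 0 0) f = b + (c + 1) * u_x * a + 2 * X * Dy a ∧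
      pd (.u0 1 0) f = (c + 1) * u_y * a + 3 * s * (c + 1) * (c + 2) * u_x ^ 2 * a
        + (c + 1) * u_x * (2 * X * Dy a + b) + 3 * u * Dy a + X * (2 * Dy b - Dt a)
        + 2 * X ^ 2 * Dy (Dy a) + e ∧
      f = a * u_t + (c + 1) * u_x * u_y * a + u_y * (2 * X * Dy a + b)
        + s * (c + 1) * (c + 2) * u_x ^ 3 * a + 3 * s * (c + 1) * u_x ^ 2 * (2 * X * Dy a + b)
        + u_x * (3 * u * Dy a + X * (2 * Dy b - Dt a) + 2 * X ^ 2 * Dy (Dy a) + e) + g := by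
  obtain ⟨ha, hQ, hP⟩ := first_order_derivatives h hf
  obtain ⟨a, hT⟩ : ∃ a, pd (.u0 0 1) f = a := ⟨_, rfl⟩
  rw [hT] at ha hQ hP
  have ha_y := Dx_Dy_eq_zero ha
  have ha_yy := Dx_Dy_eq_zero ha_y
  have ha_t := Dx_Dt_eq_zero ha
  obtain ⟨b, hb⟩ : ∃ b, b = pd (.u1 0 0) f - ((c + 1) * u_x * a + 2 * X * Dy a) := ⟨_, rfl⟩
  have hb_x : Dx b = 0 := by
    rw [hb, map_sub, hQ]
    simp only [coordinate_names, derivation_rules, total_derivatives, Derivation.map_intCast,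
      Nat.reduceAdd, trivial_rules, ha, ha_y]
    ring
  have hb_y := Dx_Dy_eq_zero hb_x
  have Q : pd (.u1 0 0) f = b + (c + 1) * u_x * a + 2 * X * Dy a := by
    rw [hb]
    ring
  rw [Q] at hP
  obtain ⟨e, he⟩ : ∃ e, e = pd (.u0 1 0) f - ((c + 1) * u_y * a
    + 3 * s * (c + 1) * (c + 2) * u_x ^ 2 * a + (c + 1) * u_x * (2 * X * Dy a + b) + 3 * u * Dy a
    + X * (2 * Dy b - Dt a) + 2 * X ^ 2 * Dy (Dy a)) := ⟨_, rfl⟩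
  have he_x : Dx e = 0 := by
    rw [he, map_sub, hP]
    simp only [coordinate_names, derivation_rules, total_derivatives, Derivation.map_intCast,
      Nat.reduceAdd, trivial_rules, ha, ha_y, ha_yy, ha_t, hb_x, hb_y, hZ]
    linear_combination -((c : FE) + 1) * (c + 2) * co (.u0 1 0) * co (.u0 2 0) * a * hs
  have P : pd (.u0 1 0) f = (c + 1) * u_y * a + 3 * s * (c + 1) * (c + 2) * u_x ^ 2 * a
      + (c + 1) * u_x * (2 * X * Dy a + b) + 3 * u * Dy a + X * (2 * Dy b - Dt a)
      + 2 * X ^ 2 * Dy (Dy a) + e := by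
    rw [he]
    ring
  refine ⟨a, b, e, f - (a * u_t + (c + 1) * u_x * u_y * a + u_y * (2 * X * Dy a + b)
        + s * (c + 1) * (c + 2) * u_x ^ 3 * a + 3 * s * (c + 1) * u_x ^ 2 * (2 * X * Dy a + b)
        + u_x * (3 * u * Dy a + X * (2 * Dy b - Dt a) + 2 * X ^ 2 * Dy (Dy a) + e)), ha, hb_x, he_x,
        ?_, hT, Q, P, (add_sub_cancel _ _).symm⟩
  refine isLow_sub h fun Z hx hy ht hu => ?_
  have k {k : FE} (hk : Dx k = 0) : Z k = 0 := apply_eq_zero_of_Dx hk hx hy ht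
  rw [hT, Q, P]
  simp only [coordinate_names, derivation_rules, Derivation.map_intCast, trivial_rules, hx, hu,
    k ha, k hb_x, k he_x, k ha_y, k ha_yy, k hb_y, k ha_t, hZ]
  linear_combination ((c : FE) + 1) * co (.u0 1 0) * (2 * co .x * Dy a + b) * Z (co (.u0 1 0)) * hs

/-- In the linearized equation the mixed derivative along u_xy and u_y isolates 4 `Dy a`, where a is
the derivative of f along u_t. -/
theorem Dy_pd_u_t_eq_zero {c : ℤ} {f : FE} (h : HasOrder false 1 f) (hf : linOp c f = 0) :
    Dy (pd (.u0 0 1) f) = 0 := by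
  obtain ⟨s, hs, hZ⟩ := exists_sixth
  obtain ⟨a, b, e, g, ha, hb, he, hg, hT, -, -, rfl⟩ := exists_first_order_form h hf hs hZ
  rw [hT]
  have ha_y := Dx_Dy_eq_zero ha
  have ha_yy := Dx_Dy_eq_zero ha_y
  have ha_yyy := Dx_Dy_eq_zero ha_yy
  have ha_yyyy := Dx_Dy_eq_zero ha_yyy
  have ha_t := Dx_Dt_eq_zero ha
  have ha_ty := Dx_Dy_eq_zero ha_t
  have ha_tyy := Dx_Dy_eq_zero ha_ty
  have ha_tt := Dx_Dt_eq_zero ha_t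
  have ha_yt := Dx_Dt_eq_zero ha_y
  have ha_yyt := Dx_Dt_eq_zero ha_yy
  have hb_y := Dx_Dy_eq_zero hb
  have hb_yy := Dx_Dy_eq_zero hb_y
  have hb_yyy := Dx_Dy_eq_zero hb_yy
  have hb_t := Dx_Dt_eq_zero hb
  have hb_yt := Dx_Dt_eq_zero hb_y
  have he_y := Dx_Dy_eq_zero he
  have he_yy := Dx_Dy_eq_zero he_y
  have he_t := Dx_Dt_eq_zero he
  rw [linOp_add, linOp_of_isLow hg] at hf
  simp only [linOp, coordinate_names, derivation_rules, total_derivatives, Derivation.map_intCast,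
      Nat.reduceAdd, Nat.reduceSub, trivial_rules, ha, ha_y, ha_yy, ha_yyy, ha_yyyy, ha_t, ha_ty, ha_tyy, ha_tt, ha_yt,
      ha_yyt, hb, hb_y, hb_yy, hb_yyy, hb_t, hb_yt, he, he_y, he_yy, he_t, hZ] at hf
  have h1 := congrArg (pd (.u1 0 0)) (congrArg (pd (.u1 1 0)) hf)
  simp only [derivation_rules, Derivation.map_intCast, pd_co, Coord.u1.injEq, reduceCtorEq,
    if_false, and_true, and_false, OfNat.one_ne_ofNat, one_ne_zero, zero_ne_one, if_true, Nat.reduceAdd, Nat.reduceSub, trivial_rules, pd_u_of_Dx_eq_zero ha, pd_u_of_Dx_eq_zero ha_y, pd_u_of_Dx_eq_zero ha_yy, pd_u_of_Dx_eq_zero ha_yyy, pd_u_of_Dx_eq_zero ha_yyyy, pd_u_of_Dx_eq_zero ha_t, pd_u_of_Dx_eq_zero ha_ty, pd_u_of_Dx_eq_zero ha_tyy, pd_u_of_Dx_eq_zero ha_tt, pd_u_of_Dx_eq_zero ha_yt,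
      pd_u_of_Dx_eq_zero ha_yyt, pd_u_of_Dx_eq_zero hb, pd_u_of_Dx_eq_zero hb_y, pd_u_of_Dx_eq_zero hb_yy, pd_u_of_Dx_eq_zero hb_yyy, pd_u_of_Dx_eq_zero hb_t, pd_u_of_Dx_eq_zero hb_yt, pd_u_of_Dx_eq_zero he, pd_u_of_Dx_eq_zero he_y, pd_u_of_Dx_eq_zero he_yy, pd_u_of_Dx_eq_zero he_t, hZ, isLow_pd_u hg, isLow_pd_u (isLow_pd hg _), isLow_pd_u (isLow_pd (isLow_pd hg _) _)] at h1
  refine eq_zero_of_ofNat_mul 4 ?_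
  linear_combination h1

theorem exists_form_of_pd_u_t {c : ℤ} {f s : FE} (h : HasOrder false 1 f) (hf : linOp c f = 0)
    (hs : 6 * s = 1) (hZ : ∀ Z : VF, Z s = 0) (hT : pd (.u0 0 1) f = 0) :
    ∃ b e g, Dx b = 0 ∧ Dx e = 0 ∧ IsLow g ∧ pd (.u1 0 0) f = b ∧
      pd (.u0 1 0) f = (c + 1) * u_x * b + 2 * X * Dy b + e ∧
      f = u_y * b + 3 * s * (c + 1) * u_x ^ 2 * b + u_x * (2 * X * Dy b + e) + g := by
  obtain ⟨a, b, e, g, -, hb, he, hg, hT', hQ, hP, hform⟩ := exists_first_order_form h hf hs hZ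
  obtain rfl : a = 0 := by rw [← hT', hT]
  simp only [map_zero, mul_zero, add_zero, zero_add, zero_mul, sub_zero] at hQ hP hform
  refine ⟨b, e, g, hb, he, hg, hQ, hP.trans (by ring), hform.trans (by ring)⟩

theorem pd_eq_total_of_Dx {f : FE} (h : Dx f = 0) :
    pd .x f = 0 ∧ pd .y f = Dy f ∧ pd .t f = Dt f := by
  refine ⟨pd_x_eq_zero_of_Dx h, ?_, ?_⟩
  · rw [VF.apply_of_pd_jet (pd_jet_eq_zero_of_Dx h) Dy]
    simp
  · rw [VF.apply_of_pd_jet (pd_jet_eq_zero_of_Dx h) Dt]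
    simp

/-- The coefficients of u_xy and u_xx in the linearized equation give the first derivatives of g;
the equality of the mixed derivatives of g and the powers of u_x in the remaining part then restrict
b and e. -/
theorem coefficients_of_linOp_neg_one {b e g : FE} (hb : Dx b = 0) (he : Dx e = 0) (hg : IsLow g)
    (hf : linOp (-1) (u_y * b + u_x * (2 * X * Dy b + e) + g) = 0) :
    Dy (Dy b) = 0 ∧ Dt (Dy b) = 0 ∧ Dy (Dy e) = 0 ∧ Dt (Dy e) = Dt (Dt b) ∧
      pd (.u0 0 0) g = -3 * Dy b ∧ pd .x g = Dt b - 2 * Dy e ∧ pd .y g = -Dt e := by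
  have hb_y := Dx_Dy_eq_zero hb
  have hb_yy := Dx_Dy_eq_zero hb_y
  have hb_yyy := Dx_Dy_eq_zero hb_yy
  have hb_t := Dx_Dt_eq_zero hb
  have hb_yt := Dx_Dt_eq_zero hb_y
  have he_y := Dx_Dy_eq_zero he
  have he_yy := Dx_Dy_eq_zero he_y
  have he_t := Dx_Dt_eq_zero he
  have hb_tt := Dx_Dt_eq_zero hb_t
  have he_yt := Dx_Dt_eq_zero he_y
  rw [linOp_add, linOp_of_isLow hg] at hf
  simp only [linOp, coordinate_names, derivation_rules, total_derivatives, Derivation.map_intCast,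
    Nat.reduceAdd, Nat.reduceSub, trivial_rules, hb, hb_y, hb_yy, hb_yyy, hb_t, hb_yt, he, he_y,
    he_yy, he_t, Int.cast_neg, Int.cast_one] at hf
  have h1 := congrArg (pd (.u1 1 0)) hf
  have h2 := congrArg (pd (.u0 2 0)) hf
  simp only [derivation_rules, pd_co, Coord.u1.injEq, Coord.u0.injEq, reduceCtorEq, if_false,
    and_true, and_false, Nat.reduceEqDiff, OfNat.one_ne_ofNat, OfNat.ofNat_ne_one, one_ne_zero,
    zero_ne_one, if_true, Nat.reduceSub, trivial_rules, pd_u_of_Dx_eq_zero hb,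
    pd_u_of_Dx_eq_zero hb_y, pd_u_of_Dx_eq_zero hb_yy, pd_u_of_Dx_eq_zero hb_yyy,
    pd_u_of_Dx_eq_zero hb_t, pd_u_of_Dx_eq_zero hb_yt, pd_u_of_Dx_eq_zero he,
    pd_u_of_Dx_eq_zero he_y, pd_u_of_Dx_eq_zero he_yy, pd_u_of_Dx_eq_zero he_t, isLow_pd_u hg,
    isLow_pd_u (isLow_pd hg _), isLow_pd_u (isLow_pd (isLow_pd hg _) _)] at h1 h2
  have hgu : pd (.u0 0 0) g = -3 * Dy b := by
    have h3 := congrArg (pd (.u0 1 0)) h1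
    simp only [derivation_rules, pd_co, Coord.u1.injEq, Coord.u0.injEq, reduceCtorEq, if_false,
      and_true, and_false, Nat.reduceEqDiff, OfNat.one_ne_ofNat, OfNat.ofNat_ne_one, one_ne_zero,
      zero_ne_one, if_true, Nat.reduceSub, trivial_rules, pd_u_of_Dx_eq_zero hb,
      pd_u_of_Dx_eq_zero hb_y, pd_u_of_Dx_eq_zero hb_yy, pd_u_of_Dx_eq_zero hb_yyy,
      pd_u_of_Dx_eq_zero hb_t, pd_u_of_Dx_eq_zero hb_yt, pd_u_of_Dx_eq_zero he,
      pd_u_of_Dx_eq_zero he_y, pd_u_of_Dx_eq_zero he_yy, pd_u_of_Dx_eq_zero he_t, isLow_pd_u hg,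
      isLow_pd_u (isLow_pd hg _), isLow_pd_u (isLow_pd (isLow_pd hg _) _)] at h3
    linear_combination h3
  have hgx : pd .x g = Dt b - 2 * Dy e - 4 * X * Dy (Dy b) := by
    simp only [coordinate_names]
    linear_combination h1 - co (.u0 1 0) * hgu
  have hgy : pd .y g = -Dt e - 2 * X * Dt (Dy b) := by
    simp only [coordinate_names]
    linear_combination -h2 - co (.u1 0 0) * hgu
  -- Mixed derivatives of g along u and y: the formula for `pd .y g` contains no u.
  have b_yy : Dy (Dy b) = 0 := by
    have h3 := pd_comm (.u0 0 0) .y g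
    rw [hgu, hgy] at h3
    simp only [derivation_rules, coordinate_names, pd_co, trivial_rules, pd_u_of_Dx_eq_zero he_t,
      pd_u_of_Dx_eq_zero hb_yt, pd_eq_total_of_Dx hb_y, reduceCtorEq, if_false] at h3
    refine eq_zero_of_ofNat_mul 3 ?_
    linear_combination h3
  rw [b_yy, mul_zero, sub_zero] at hgx
  have b_yty : Dy (Dt (Dy b)) = 0 := Dy_Dt_eq_zero b_yy
  have hxy := pd_comm .x .y g
  rw [pd_comm .x .t g] at hf
  simp only [hgx, hgy, hgu, derivation_rules, coordinate_names, pd_co, trivial_rules,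
    pd_eq_total_of_Dx hb_y, pd_eq_total_of_Dx hb_t, pd_eq_total_of_Dx he_t, pd_eq_total_of_Dx he_y,
    pd_eq_total_of_Dx hb_yt, pd_u_of_Dx_eq_zero hb_y, reduceCtorEq, if_false, if_true, b_yy, b_yty,
    ← Dt_Dy b, ← Dt_Dy e] at hf hxy
  have hf' : co (.u0 1 0) * (Dy (Dy e) - Dt (Dy b)) + (Dt (Dy e) - Dt (Dt b)) = 0 := by
    linear_combination hf
  have h3 := congrArg (pd (.u0 1 0)) hf'
  simp only [derivation_rules, pd_co, if_true, trivial_rules, pd_u_of_Dx_eq_zero hb_yt,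
    pd_u_of_Dx_eq_zero he_yy, pd_u_of_Dx_eq_zero hb_tt, pd_u_of_Dx_eq_zero he_yt] at h3
  -- The coefficient of u_x says that `Dy (Dy e)` and `Dt (Dy b)` agree, whereas the mixed
  -- derivatives of g along x and y say that twice the former is three times the latter.
  have b_yt : Dt (Dy b) = 0 := by linear_combination 2 * h3 - hxy
  have e_yy : Dy (Dy e) = 0 := by linear_combination h3 + b_yt
  refine ⟨b_yy, b_yt, e_yy, ?_, hgu, hgx, by rw [hgy, b_yt, mul_zero, sub_zero]⟩
  linear_combination hf' + co (.u0 1 0) * (b_yt - e_yy)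

/-- The coefficients of u_xx and u_xy are again split by powers of u_x. In contrast to c = -1,
already b itself cannot depend on y. -/
theorem coefficients_of_linOp_two {b e g s : FE} (hs : 6 * s = 1) (hZ : ∀ Z : VF, Z s = 0)
    (hb : Dx b = 0) (he : Dx e = 0) (hg : IsLow g)
    (hf : linOp 2 (u_y * b + 9 * s * u_x ^ 2 * b + u_x * (2 * X * Dy b + e) + g) = 0) :
    Dy b = 0 ∧ Dy e = Dt b ∧
      pd (.u0 0 0) g = 0 ∧ 2 * pd .x g = Dt b ∧ 2 * pd .y g = Dt e := by
  have hb_y := Dx_Dy_eq_zero hb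
  have hb_yy := Dx_Dy_eq_zero hb_y
  have hb_yyy := Dx_Dy_eq_zero hb_yy
  have hb_t := Dx_Dt_eq_zero hb
  have hb_yt := Dx_Dt_eq_zero hb_y
  have he_y := Dx_Dy_eq_zero he
  have he_yy := Dx_Dy_eq_zero he_y
  have he_t := Dx_Dt_eq_zero he
  have hb_tt := Dx_Dt_eq_zero hb_t
  have he_yt := Dx_Dt_eq_zero he_y
  rw [linOp_add, linOp_of_isLow hg] at hf
  simp only [linOp, coordinate_names, derivation_rules, total_derivatives, Nat.reduceAdd,
    Nat.reduceSub, trivial_rules, hb, hb_y, hb_yy, hb_yyy, hb_t, hb_yt, he, he_y, he_yy, he_t, hZ,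
    Int.cast_ofNat] at hf
  have h1 := congrArg (pd (.u1 1 0)) hf
  have h2 := congrArg (pd (.u0 2 0)) hf
  simp only [derivation_rules, pd_co, Coord.u1.injEq, Coord.u0.injEq, reduceCtorEq, if_false,
    and_true, and_false, Nat.reduceEqDiff, OfNat.one_ne_ofNat, OfNat.ofNat_ne_one, one_ne_zero,
    zero_ne_one, if_true, Nat.reduceSub, trivial_rules, hZ, Derivation.map_intCast, pd_u_of_Dx_eq_zero hb,
    pd_u_of_Dx_eq_zero hb_y, pd_u_of_Dx_eq_zero hb_yy, pd_u_of_Dx_eq_zero hb_yyy,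
    pd_u_of_Dx_eq_zero hb_t, pd_u_of_Dx_eq_zero hb_yt, pd_u_of_Dx_eq_zero he,
    pd_u_of_Dx_eq_zero he_y, pd_u_of_Dx_eq_zero he_yy, pd_u_of_Dx_eq_zero he_t, isLow_pd_u hg,
    isLow_pd_u (isLow_pd hg _), isLow_pd_u (isLow_pd (isLow_pd hg _) _)] at h1 h2
  have h3 := congrArg (pd (.u0 1 0)) h2
  simp only [derivation_rules, pd_co, Coord.u1.injEq, Coord.u0.injEq, reduceCtorEq, if_false,
    and_true, and_false, Nat.reduceEqDiff, OfNat.one_ne_ofNat, OfNat.ofNat_ne_one, one_ne_zero,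
    zero_ne_one, if_true, Nat.reduceSub, trivial_rules, hZ, pd_u_of_Dx_eq_zero hb,
    pd_u_of_Dx_eq_zero hb_y, pd_u_of_Dx_eq_zero hb_yy, pd_u_of_Dx_eq_zero hb_yyy,
    pd_u_of_Dx_eq_zero hb_t, pd_u_of_Dx_eq_zero hb_yt, pd_u_of_Dx_eq_zero he,
    pd_u_of_Dx_eq_zero he_y, pd_u_of_Dx_eq_zero he_yy, pd_u_of_Dx_eq_zero he_t, isLow_pd_u hg,
    isLow_pd_u (isLow_pd hg _), isLow_pd_u (isLow_pd (isLow_pd hg _) _)] at h3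

  have h4 : 3 * (co (.u0 1 0) * (4 * Dy b) + (2 * co .x * Dy (Dy b) + Dy e - Dt b)) = 0 := by
    linear_combination h3 + (3 * Dt b - 12 * Dy b * co (.u0 1 0) - 3 * b * co (.u1 1 0)) * hs
  have h5 := congrArg (pd (.u0 1 0)) (eq_zero_of_ofNat_mul 3 h4)
  simp only [derivation_rules, pd_co, if_true, trivial_rules, pd_u_of_Dx_eq_zero hb_y,
    pd_u_of_Dx_eq_zero hb_yy, pd_u_of_Dx_eq_zero hb_t, pd_u_of_Dx_eq_zero he_y, reduceCtorEq,
    if_false] at h5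
  have b_y : Dy b = 0 := eq_zero_of_ofNat_mul 4 (by linear_combination h5)
  rw [b_y, map_zero] at h4
  have e_y : Dy e = Dt b :=
    sub_eq_zero.1 (eq_zero_of_ofNat_mul 3 (by linear_combination h4))
  rw [b_y, map_zero, e_y] at h1
  have h6 : co (.u0 1 0) * (2 * pd (.u0 0 0) g) + (2 * pd .x g - Dt b) = 0 := by
    linear_combination -h1 + (3 * co (.u0 1 0) * b * co (.u0 2 0) + 6 * b * co (.u1 1 0)) * hs
  have h7 := congrArg (pd (.u0 1 0)) h6
  simp only [derivation_rules, pd_co, if_true, trivial_rules, pd_u_of_Dx_eq_zero hb_t,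
    isLow_pd_u (isLow_pd hg _)] at h7
  have hgu : pd (.u0 0 0) g = 0 := eq_zero_of_ofNat_mul 2 (by linear_combination h7)
  rw [b_y, map_zero, map_zero, e_y] at h2
  refine ⟨b_y, e_y, hgu, ?_, ?_⟩
  · linear_combination h6 - 2 * co (.u0 1 0) * hgu
  · linear_combination h2 - 2 * co (.u1 0 0) * hgu - (3 * co (.u0 1 0) * b * co (.u1 1 0)
      - 3 * co (.u0 1 0) * Dt b - 6 * b * co (.u0 2 0) * co (.u1 0 0)
      - 3 * b * co (.u0 1 1)) * hs

/-! ## Classification of the solutions of first order -/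

theorem pd_u_components (ϑ : TFun) :
    (pd (.u0 0 1) (phi6 ϑ).1 = lift ϑ) ∧
    (pd (.u0 0 1) (phi5 ϑ).1 = 0 ∧ pd (.u1 0 0) (phi5 ϑ).1 = lift ϑ) ∧
    (pd (.u0 0 1) (phi4 ϑ).1 = 0 ∧ pd (.u1 0 0) (phi4 ϑ).1 = 0 ∧
      pd (.u0 1 0) (phi4 ϑ).1 = lift ϑ) ∧
    (pd (.u0 0 1) phi2.1 = 0 ∧ pd (.u1 0 0) phi2.1 = Y) ∧
    (pd (.u0 0 1) phi1.1 = 0 ∧ pd (.u1 0 0) phi1.1 = 0 ∧ pd (.u0 1 0) phi1.1 = Y) := by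
  refine ⟨?_, ⟨?_, ?_⟩, ⟨?_, ?_, ?_⟩, ⟨?_, ?_⟩, ?_, ?_, ?_⟩ <;>
    simp [phi1, phi2, phi4, phi5, phi6, coordinate_names, derivation_rules, pd_co, VF.apply_lift]

theorem pd_v_components (ϑ : TFun) :
    (pd (.u0 0 1) (phi18 ϑ).2 = lift ϑ) ∧
    (pd (.u0 0 1) (phi17 ϑ).2 = 0 ∧ pd (.u1 0 0) (phi17 ϑ).2 = lift ϑ) ∧
    (pd (.u0 0 1) (phi16 ϑ).2 = 0 ∧ pd (.u1 0 0) (phi16 ϑ).2 = 0 ∧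
      pd (.u0 1 0) (phi16 ϑ).2 = lift ϑ) := by
  refine ⟨?_, ⟨?_, ?_⟩, ?_, ?_, ?_⟩ <;>
    simp [phi16, phi17, phi18, coordinate_names, derivation_rules, pd_co, VF.apply_lift]

theorem apply_at4_eq_zero {Z : VF} (hx : Z (co .x) = 0) (hy : Z (co .y) = 0) (ht : Z (co .t) = 0)
    (h0 : ∀ k l, k + l ≤ 1 → Z (co (.u0 k l)) = 0) (h1 : Z (co (.u1 0 0)) = 0) (ϑ : TFun) :
    Z (phi15 ϑ).2 = 0 ∧ Z (phi16 ϑ).2 = 0 ∧ Z (phi17 ϑ).2 = 0 ∧ Z (phi18 ϑ).2 = 0 := by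
  simp only [phi15, phi16, phi17, phi18, coordinate_names, derivation_rules, trivial_rules,
    VF.apply_lift, hx, hy, ht, h0 0 0 (by simp), h0 1 0 (by simp), h0 0 1 (by simp), h1, and_self]

theorem hasOrder_at4 (ϑ : TFun) : HasOrder false 1 (phi15 ϑ).2 ∧ HasOrder false 1 (phi16 ϑ).2 ∧
    HasOrder false 1 (phi17 ϑ).2 ∧ HasOrder false 1 (phi18 ϑ).2 := by
  have hP := fun a b (hab : 1 < a + b) => apply_at4_eq_zero (Z := pj false false a b)
    (pj_xyt _ _ _ _).1 (pj_xyt _ _ _ _).2.1 (pj_xyt _ _ _ _).2.2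
    (fun k l hkl => by rw [(pj_u_coordinates _ _ a b k l).1, if_neg (by omega)])
    (by rw [(pj_u_coordinates _ _ a b 0 0).2, if_neg (by simp)]) ϑ
  have hQ := fun a b (hab : 1 - 1 < a + b) => apply_at4_eq_zero (Z := pj false true a b)
    (pj_xyt _ _ _ _).1 (pj_xyt _ _ _ _).2.1 (pj_xyt _ _ _ _).2.2
    (fun k l hkl => by rw [(pj_u_coordinates _ _ a b k l).1, if_neg (by simp)])
    (by rw [(pj_u_coordinates _ _ a b 0 0).2, if_neg (by omega)]) ϑ
  have hv := fun i a b => apply_at4_eq_zero (Z := pj true i a b)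
    (pj_xyt _ _ _ _).1 (pj_xyt _ _ _ _).2.1 (pj_xyt _ _ _ _).2.2
    (fun k l hkl => by rw [(pj_u_coordinates _ _ a b k l).1, if_neg (by simp)])
    (by rw [(pj_u_coordinates _ _ a b 0 0).2, if_neg (by simp)]) ϑ
  exact ⟨⟨fun a b h => (hP a b h).1, fun a b h => (hQ a b h).1, fun _ i a b => (hv i a b).1⟩,
    ⟨fun a b h => (hP a b h).2.1, fun a b h => (hQ a b h).2.1, fun _ i a b => (hv i a b).2.1⟩,
    ⟨fun a b h => (hP a b h).2.2.1, fun a b h => (hQ a b h).2.2.1,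
      fun _ i a b => (hv i a b).2.2.1⟩,
    ⟨fun a b h => (hP a b h).2.2.2, fun a b h => (hQ a b h).2.2.2,
      fun _ i a b => (hv i a b).2.2.2⟩⟩

/-- The constant slope in y is the source of the two constants in the u-component: φ₂ for the
coefficient of u_y, φ₁ for that of u_x. -/
theorem exists_smul_Y_add_lift {b : FE} (hx : Dx b = 0) (hy : Dy (Dy b) = 0)
    (ht : Dt (Dy b) = 0) : ∃ (r : ℝ) (ϑ : TFun), b = r • Y + lift ϑ := by
  obtain ⟨r, hr⟩ := exists_eq_const (Dx_Dy_eq_zero hx) hy ht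
  obtain ⟨ϑ, hϑ⟩ := exists_eq_lift_of_Dx_of_Dy (f := b - r • Y)
    (by simp [hx, coordinate_names]) (by simp [hr, coordinate_names, Algebra.algebraMap_eq_smul_one])
  exact ⟨r, ϑ, by rw [← hϑ, add_sub_cancel]⟩

theorem exists_lift_of_isLow {g : FE} (hg : IsLow g) (hx : pd .x g = 0) (hy : pd .y g = 0)
    (hu : pd (.u0 0 0) g = 0) : ∃ ϑ : TFun, g = lift ϑ := by
  refine exists_eq_lift fun c hc => ?_
  rw [isLow_apply hg (pd c), hx, hy, hu, pd_co_of_ne hc]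
  ring

theorem exists_form_neg_one {f : FE} (hf : linOp (-1) f = 0) (hT : pd (.u0 0 1) f = 0) :
    ∃ b e g, Dx b = 0 ∧ Dx e = 0 ∧ IsLow g ∧ pd (.u1 0 0) f = b ∧
      pd (.u0 1 0) f = 2 * X * Dy b + e ∧ f = u_y * b + u_x * (2 * X * Dy b + e) + g := by
  obtain ⟨s, hs, hZ⟩ := exists_sixth
  obtain ⟨b, e, g, hb, he, hg, hQ, hP, h⟩ :=
    exists_form_of_pd_u_t (hasOrder_one_of_linOp_neg_one hf) hf hs hZ hT
  push_cast at hP h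
  exact ⟨b, e, g, hb, he, hg, hQ, hP.trans (by ring), h.trans (by ring)⟩

/-- The `u`-components of symmetries. -/
theorem exists_u_component {f : FE} (hf : linOp (-1) f = 0) :
    ∃ (r₁ r₂ : ℝ) (ϑ₃ ϑ₄ ϑ₅ ϑ₆ : TFun), f = r₁ • phi1.1 + r₂ • phi2.1 + (phi3 ϑ₃).1 + (phi4 ϑ₄).1
      + (phi5 ϑ₅).1 + (phi6 ϑ₆).1 := by
  have h1 := linOp_neg_one_of_isGenerating isGenerating_phi1_phi2_phi7.1
  have h2 := linOp_neg_one_of_isGenerating isGenerating_phi1_phi2_phi7.2.1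
  have h4 := fun ϑ => linOp_neg_one_of_isGenerating (isGenerating_gt4_at4 ϑ).2.1
  have h5 := fun ϑ => linOp_neg_one_of_isGenerating (isGenerating_gt4_at4 ϑ).2.2.1
  have h6 := fun ϑ => linOp_neg_one_of_isGenerating (isGenerating_gt4_at4 ϑ).2.2.2.1
  have hord := hasOrder_one_of_linOp_neg_one hf
  obtain ⟨ϑ₆, hϑ₆⟩ := exists_eq_lift_of_Dx_of_Dy (first_order_derivatives hord hf).1
    (Dy_pd_u_t_eq_zero hord hf)
  -- The generators are removed along u_t, u_y, u_x in this order. Each one subtracted has zero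
  -- derivative along the coordinates already treated, and in the end a function of t is left.
  obtain ⟨f₁, hf₁⟩ : ∃ f₁, f₁ = f - (phi6 ϑ₆).1 := ⟨_, rfl⟩
  have l₁ : linOp (-1) f₁ = 0 := by rw [hf₁, linOp_sub, hf, h6, sub_zero]
  have t₁ : pd (.u0 0 1) f₁ = 0 := by rw [hf₁, map_sub, (pd_u_components ϑ₆).1, hϑ₆, sub_self]
  obtain ⟨b, e, g, hb, he, hg, hQ, hP, h⟩ := exists_form_neg_one l₁ t₁
  obtain ⟨b_yy, b_yt, -⟩ := coefficients_of_linOp_neg_one hb he hg (h ▸ l₁)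
  obtain ⟨r₂, ϑ₅, hϑ₅⟩ := exists_smul_Y_add_lift hb b_yy b_yt
  obtain ⟨f₂, hf₂⟩ : ∃ f₂, f₂ = f₁ - (r₂ • phi2.1 + (phi5 ϑ₅).1) := ⟨_, rfl⟩
  have l₂ : linOp (-1) f₂ = 0 := by
    rw [hf₂, linOp_sub, linOp_add, linOp_smul, l₁, h2, h5, smul_zero, add_zero, sub_zero]
  obtain ⟨-, p5, p4, p2, p1⟩ := pd_u_components ϑ₅
  have t₂ : pd (.u0 0 1) f₂ = 0 := by
    rw [hf₂]
    simp only [derivation_rules, trivial_rules, t₁, p5, p2]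
  have y₂ : pd (.u1 0 0) f₂ = 0 := by
    rw [hf₂]
    simp only [derivation_rules, hQ, p5, p2, hϑ₅, sub_self]
  obtain ⟨b', e', g', hb', he', hg', hQ', hP', h'⟩ := exists_form_neg_one l₂ t₂
  obtain rfl : b' = 0 := by rw [← hQ', y₂]
  obtain ⟨-, -, e_yy, e_yt, -⟩ := coefficients_of_linOp_neg_one hb' he' hg' (h' ▸ l₂)
  obtain ⟨r₁, ϑ₄, hϑ₄⟩ := exists_smul_Y_add_lift he' e_yy (by rw [e_yt]; simp)
  obtain ⟨f₃, hf₃⟩ : ∃ f₃, f₃ = f₂ - (r₁ • phi1.1 + (phi4 ϑ₄).1) := ⟨_, rfl⟩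
  have l₃ : linOp (-1) f₃ = 0 := by
    rw [hf₃, linOp_sub, linOp_add, linOp_smul, l₂, h1, h4, smul_zero, add_zero, sub_zero]
  obtain ⟨-, -, p4, -, -⟩ := pd_u_components ϑ₄
  have t₃ : pd (.u0 0 1) f₃ = 0 := by
    rw [hf₃]
    simp only [derivation_rules, trivial_rules, t₂, p4, p1]
  have y₃ : pd (.u1 0 0) f₃ = 0 := by
    rw [hf₃]
    simp only [derivation_rules, trivial_rules, y₂, p4, p1]
  have x₃ : pd (.u0 1 0) f₃ = 0 := by
    rw [hf₃]
    simp only [derivation_rules, trivial_rules, hP', p4, p1, hϑ₄, sub_self]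
  obtain ⟨b'', e'', g'', hb'', he'', hg'', hQ'', hP'', h''⟩ := exists_form_neg_one l₃ t₃
  obtain rfl : b'' = 0 := by rw [← hQ'', y₃]
  obtain rfl : e'' = 0 := by simpa [x₃] using hP''.symm
  obtain ⟨-, -, -, -, gu, gx, gy⟩ := coefficients_of_linOp_neg_one hb'' he'' hg'' (h'' ▸ l₃)
  obtain ⟨ϑ₃, hϑ₃⟩ := exists_lift_of_isLow hg'' (by simpa using gx) (by simpa using gy)
    (by simpa using gu)
  refine ⟨r₁, r₂, ϑ₃, ϑ₄, ϑ₅, ϑ₆, ?_⟩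
  have h3 : f₃ = (phi3 ϑ₃).1 := by
    rw [h'', hϑ₃]
    simp [phi3]
  linear_combination -hf₁ - hf₂ - hf₃ + h3

theorem exists_form_two {f : FE} (h : HasOrder false 1 f) (hf : linOp 2 f = 0)
    (hT : pd (.u0 0 1) f = 0) :
    ∃ b e g, Dx b = 0 ∧ Dx e = 0 ∧ IsLow g ∧ pd (.u1 0 0) f = b ∧ Dy b = 0 ∧ Dy e = Dt b ∧
      pd (.u0 0 0) g = 0 ∧ 2 * pd .x g = Dt b ∧ 2 * pd .y g = Dt e ∧
      pd (.u0 1 0) f = 3 * u_x * b + e ∧ (b = 0 → f = u_x * e + g) := by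
  obtain ⟨s, hs, hZ⟩ := exists_sixth
  obtain ⟨b, e, g, hb, he, hg, hQ, hP, h⟩ := exists_form_of_pd_u_t h hf hs hZ hT
  push_cast at hP h
  obtain ⟨b_y, e_y, gu, gx, gy⟩ := coefficients_of_linOp_two hs hZ hb he hg
    (by rw [← hf, h]; congr 1; ring)
  refine ⟨b, e, g, hb, he, hg, hQ, b_y, e_y, gu, gx, gy, ?_, ?_⟩
  · rw [hP, b_y]
    ring
  · rintro rfl
    rw [h]
    simp

/-- The `v`-components of first order of symmetries with trivial `u`-component. -/
theorem exists_v_component {f : FE} (hord : HasOrder false 1 f) (hf : linOp 2 f = 0) :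
    ∃ ϑ₁₅ ϑ₁₆ ϑ₁₇ ϑ₁₈ : TFun, f = (phi15 ϑ₁₅).2 + (phi16 ϑ₁₆).2 + (phi17 ϑ₁₇).2
      + (phi18 ϑ₁₈).2 := by
  have h6 := fun ϑ => isGenerating_zero_left.1 (isGenerating_gt4_at4 ϑ).2.2.2.2.2.1
  have h7 := fun ϑ => isGenerating_zero_left.1 (isGenerating_gt4_at4 ϑ).2.2.2.2.2.2.1
  have h8 := fun ϑ => isGenerating_zero_left.1 (isGenerating_gt4_at4 ϑ).2.2.2.2.2.2.2
  obtain ⟨ϑ₁₈, hϑ₁₈⟩ := exists_eq_lift_of_Dx_of_Dy (first_order_derivatives hord hf).1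
    (Dy_pd_u_t_eq_zero hord hf)
  -- The same elimination along u_t, u_y, u_x; here the coefficients are functions of t without
  -- slope in y.
  obtain ⟨f₁, hf₁⟩ : ∃ f₁, f₁ = f - (phi18 ϑ₁₈).2 := ⟨_, rfl⟩
  have l₁ : linOp 2 f₁ = 0 := by rw [hf₁, linOp_sub, hf, phi18, h8, sub_zero]
  have o₁ : HasOrder false 1 f₁ := hf₁ ▸ hord.sub (hasOrder_at4 ϑ₁₈).2.2.2
  have t₁ : pd (.u0 0 1) f₁ = 0 := by rw [hf₁, map_sub, (pd_v_components ϑ₁₈).1, hϑ₁₈, sub_self]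
  obtain ⟨b, e, g, hb, -, -, hQ, b_y, -⟩ := exists_form_two o₁ l₁ t₁
  obtain ⟨ϑ₁₇, hϑ₁₇⟩ := exists_eq_lift_of_Dx_of_Dy hb b_y
  obtain ⟨f₂, hf₂⟩ : ∃ f₂, f₂ = f₁ - (phi17 ϑ₁₇).2 := ⟨_, rfl⟩
  have l₂ : linOp 2 f₂ = 0 := by rw [hf₂, linOp_sub, l₁, phi17, h7, sub_zero]
  have o₂ : HasOrder false 1 f₂ := hf₂ ▸ o₁.sub (hasOrder_at4 ϑ₁₇).2.2.1
  obtain ⟨-, p7, -⟩ := pd_v_components ϑ₁₇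
  have t₂ : pd (.u0 0 1) f₂ = 0 := by rw [hf₂, map_sub, t₁, p7.1, sub_self]
  have y₂ : pd (.u1 0 0) f₂ = 0 := by rw [hf₂, map_sub, hQ, p7.2, hϑ₁₇, sub_self]
  obtain ⟨b', e', g', -, he', -, hQ', -, e_y, -, -, -, hP', -⟩ := exists_form_two o₂ l₂ t₂
  obtain rfl : b' = 0 := by rw [← hQ', y₂]
  rw [map_zero] at e_y
  obtain ⟨ϑ₁₆, hϑ₁₆⟩ := exists_eq_lift_of_Dx_of_Dy he' e_y
  obtain ⟨f₃, hf₃⟩ : ∃ f₃, f₃ = f₂ - (phi16 ϑ₁₆).2 := ⟨_, rfl⟩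
  have l₃ : linOp 2 f₃ = 0 := by rw [hf₃, linOp_sub, l₂, phi16, h6, sub_zero]
  have o₃ : HasOrder false 1 f₃ := hf₃ ▸ o₂.sub (hasOrder_at4 ϑ₁₆).2.1
  obtain ⟨-, -, p6⟩ := pd_v_components ϑ₁₆
  have t₃ : pd (.u0 0 1) f₃ = 0 := by rw [hf₃, map_sub, t₂, p6.1, sub_self]
  have y₃ : pd (.u1 0 0) f₃ = 0 := by rw [hf₃, map_sub, y₂, p6.2.1, sub_self]
  have x₃ : pd (.u0 1 0) f₃ = 0 := by
    rw [hf₃, map_sub, hP', p6.2.2, hϑ₁₆, mul_zero, zero_add, sub_self]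
  obtain ⟨b'', e'', g'', -, -, hg'', hQ'', -, -, gu, gx, gy, hP'', h''⟩ := exists_form_two o₃ l₃ t₃
  obtain rfl : b'' = 0 := by rw [← hQ'', y₃]
  obtain rfl : e'' = 0 := by simpa [x₃] using hP''.symm
  rw [map_zero] at gx gy
  obtain ⟨ϑ₁₅, hϑ₁₅⟩ := exists_lift_of_isLow hg'' (eq_zero_of_ofNat_mul 2 gx)
    (eq_zero_of_ofNat_mul 2 gy) gu
  refine ⟨ϑ₁₅, ϑ₁₆, ϑ₁₇, ϑ₁₈, ?_⟩
  have h5 : f₃ = (phi15 ϑ₁₅).2 := by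
    rw [h'' rfl, hϑ₁₅]
    simp [phi15]
  linear_combination -hf₁ - hf₂ - hf₃ + h5

/-! ## The general symmetry -/

theorem fst_eq_zero : phi7.1 = 0 ∧ phi8.1 = 0 ∧ phi9.1 = 0 ∧ phi10.1 = 0 ∧ phi11.1 = 0 ∧
    phi12.1 = 0 ∧ phi13.1 = 0 ∧ phi14.1 = 0 ∧ (∀ ϑ, (phi15 ϑ).1 = 0) ∧ (∀ ϑ, (phi16 ϑ).1 = 0) ∧
    (∀ ϑ, (phi17 ϑ).1 = 0) ∧ ∀ ϑ, (phi18 ϑ).1 = 0 :=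
  ⟨rfl, rfl, rfl, rfl, rfl, rfl, rfl, rfl, fun _ => rfl, fun _ => rfl, fun _ => rfl, fun _ => rfl⟩

theorem combination_fst (c : Fin 10 → ℝ) (ϑ : Fin 8 → TFun) : (combination c ϑ).1 =
    c 0 • phi1.1 + c 1 • phi2.1 + (phi3 (ϑ 0)).1 + (phi4 (ϑ 1)).1 + (phi5 (ϑ 2)).1
      + (phi6 (ϑ 3)).1 := by
  simp only [combination, Prod.fst_add, Prod.smul_fst, fst_eq_zero, smul_zero, add_zero]

theorem combination_snd (c : Fin 10 → ℝ) (ϑ : Fin 8 → TFun) : (combination c ϑ).2 =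
    c 0 • phi1.2 + c 1 • phi2.2 + (phi3 (ϑ 0)).2 + (phi4 (ϑ 1)).2 + (phi5 (ϑ 2)).2
      + (phi6 (ϑ 3)).2 + c 2 • v + (c 3 • phi8.2 + c 4 • phi9.2 + c 5 • phi10.2 + c 6 • phi11.2
        + c 7 • phi12.2 + c 8 • phi13.2 + c 9 • phi14.2)
      + ((phi15 (ϑ 4)).2 + (phi16 (ϑ 5)).2 + (phi17 (ϑ 6)).2 + (phi18 (ϑ 7)).2) := by
  simp only [combination, Prod.snd_add, Prod.smul_snd, phi7]
  ring

theorem gen_index :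
    (∀ (k : Fin 10) (ϑ η : TFun), gen (![1, 2, 7, 8, 9, 10, 11, 12, 13, 14] k) ϑ
      = gen (![1, 2, 7, 8, 9, 10, 11, 12, 13, 14] k) η) ∧
    (∀ (k : Fin 8) (ϑ η : TFun), gen (![3, 4, 5, 6, 15, 16, 17, 18] k) (ϑ + η)
      = gen (![3, 4, 5, 6, 15, 16, 17, 18] k) ϑ + gen (![3, 4, 5, 6, 15, 16, 17, 18] k) η) ∧
    (∀ (k : Fin 8) (r : ℝ) (ϑ : TFun), gen (![3, 4, 5, 6, 15, 16, 17, 18] k) (r • ϑ)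
      = r • gen (![3, 4, 5, 6, 15, 16, 17, 18] k) ϑ) := by
  refine ⟨fun k ϑ η => ?_, fun k ϑ η => ?_, fun k r ϑ => ?_⟩ <;> fin_cases k <;> try rfl
  all_goals
    refine Prod.ext (FE.ext_evalAt fun p => ?_) (FE.ext_evalAt fun p => ?_) <;>
    simp [gen, phi3, phi4, phi5, phi6, phi15, phi16, phi17, phi18, evaluation_rules] <;> ring

theorem combination_eq_sum (c : Fin 10 → ℝ) (ϑ : Fin 8 → TFun) : combination c ϑ =
    ∑ k, c k • gen (![1, 2, 7, 8, 9, 10, 11, 12, 13, 14] k) 0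
      + ∑ k, gen (![3, 4, 5, 6, 15, 16, 17, 18] k) (ϑ k) := by
  simp [Fin.sum_univ_succ, combination, gen]
  abel

theorem combination_add (c c' : Fin 10 → ℝ) (ϑ ϑ' : Fin 8 → TFun) :
    combination (c + c') (ϑ + ϑ') = combination c ϑ + combination c' ϑ' := by
  simp only [combination_eq_sum, Pi.add_apply, gen_index.2.1, add_smul, Finset.sum_add_distrib]
  abel

theorem combination_smul (r : ℝ) (c : Fin 10 → ℝ) (ϑ : Fin 8 → TFun) :
    combination (r • c) (r • ϑ) = r • combination c ϑ := by
  simp only [combination_eq_sum, Pi.smul_apply, gen_index.2.2, smul_add, Finset.smul_sum,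
    smul_eq_mul, mul_smul]

theorem isGenerating_combination (c : Fin 10 → ℝ) (ϑ : Fin 8 → TFun) :
    IsGenerating (combination c ϑ) := by
  rw [combination_eq_sum]
  have hsum {n : ℕ} (φ : Fin n → Section) (h : ∀ k, IsGenerating (φ k)) :
      IsGenerating (∑ k, φ k) :=
    Finset.sum_induction _ _ (fun _ _ => IsGenerating.add) isGenerating_zero fun k _ => h k
  exact (hsum _ fun k => (isGenerating_gen _ _).smul _).add (hsum _ fun k => isGenerating_gen _ _)

/-- Every symmetry is a combination of the generators. -/
theorem IsGenerating.exists_combination {φ : Section} (h : IsGenerating φ) :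
    ∃ (c : Fin 10 → ℝ) (ϑ : Fin 8 → TFun), φ = combination c ϑ := by
  obtain ⟨r₁, r₂, ϑ₃, ϑ₄, ϑ₅, ϑ₆, hu⟩ := exists_u_component (linOp_neg_one_of_isGenerating h)
  -- Every admissible u-component is that of a symmetry of the full system. Subtracting this
  -- symmetry leaves a section (0, g), to which the analysis of `linOp 2` applies.
  obtain ⟨ψ, hψ⟩ : ∃ ψ, ψ = combination ![r₁, r₂, 0, 0, 0, 0, 0, 0, 0, 0]
    ![ϑ₃, ϑ₄, ϑ₅, ϑ₆, 0, 0, 0, 0] := ⟨_, rfl⟩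
  have hψ1 : ψ.1 = φ.1 := by
    rw [hu, hψ, combination_fst]
    rfl
  have hg : IsGenerating (φ + (-1 : ℝ) • ψ) :=
    h.add ((hψ ▸ isGenerating_combination _ _).smul _)
  obtain ⟨g, hφ⟩ : ∃ g, φ + (-1 : ℝ) • ψ = (0, g) :=
    ⟨(φ + (-1 : ℝ) • ψ).2, Prod.ext (by simp [hψ1]) rfl⟩
  rw [hφ, isGenerating_zero_left] at hg
  obtain ⟨r₇, hr₇⟩ := exists_sub_smul_v hg
  obtain ⟨r, hord, hl⟩ := exists_sub_a7 (f := g - r₇ • v)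
    (by rw [linOp_sub, linOp_smul, hg, linOp_v, smul_zero, sub_zero]) hr₇
  obtain ⟨ϑ₁₅, ϑ₁₆, ϑ₁₇, ϑ₁₈, hv⟩ := exists_v_component hord hl
  have e : φ = combination ![0, 0, r₇, r 0, r 1, r 2, r 3, r 4, r 5, r 6]
      ![0, 0, 0, 0, ϑ₁₅, ϑ₁₆, ϑ₁₇, ϑ₁₈] + ψ := by
    have h0 : φ = (0, g) + ψ := by rw [← hφ]; simp
    have z : (phi3 0).2 = 0 ∧ (phi4 0).2 = 0 ∧ (phi5 0).2 = 0 ∧ (phi6 0).2 = 0 := by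
      simp [phi3, phi4, phi5, phi6]
    have z' : (phi3 0).1 = 0 ∧ (phi4 0).1 = 0 ∧ (phi5 0).1 = 0 ∧ (phi6 0).1 = 0 := by
      simp [phi3, phi4, phi5, phi6]
    rw [h0]
    congr 1
    refine Prod.ext ?_ ?_
    · rw [combination_fst]
      simp [z']
    · rw [combination_snd]
      simp [z]
      linear_combination hv
  rw [e, hψ, ← combination_add]
  exact ⟨_, _, rfl⟩

theorem smul_Y_add_lift_eq_zero {r : ℝ} {ϑ : TFun} (h : r • Y + lift ϑ = 0) : r = 0 ∧ ϑ = 0 := by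
  have h1 := congrArg Dy h
  simp only [coordinate_names, derivation_rules, total_derivatives, trivial_rules] at h1
  have hr : r = 0 := by
    rwa [← Algebra.algebraMap_eq_smul_one, ← map_zero (algebraMap ℝ FE),
      (algebraMap ℝ FE).injective.eq_iff] at h1
  refine ⟨hr, lift_injective ?_⟩
  rw [hr, zero_smul, zero_add] at h
  exact h

open Polynomial in
/-- The generators are independent. -/
theorem eq_zero_of_combination_eq_zero {c : Fin 10 → ℝ} {ϑ : Fin 8 → TFun}
    (h : combination c ϑ = 0) : c = 0 ∧ ϑ = 0 := by
  have h1 := congrArg Prod.fst h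
  rw [combination_fst, Prod.fst_zero] at h1
  obtain ⟨-, -, -, p2, p1⟩ := pd_u_components 0
  have z {Z : VF} (hZ : Z (co .t) = 0) (η : TFun) : Z (phi3 η).1 = 0 := by
    rw [phi3, VF.apply_lift, hZ, zero_mul]
  have zero : (phi3 0).1 = 0 ∧ (phi4 0).1 = 0 ∧ (phi5 0).1 = 0 ∧ (phi6 0).1 = 0 := by
    simp [phi3, phi4, phi5, phi6]
  -- The parameters of the u-component are recovered in the order of the classification, from the
  -- derivatives along u_t, u_y, u_x.
  have t3 : ϑ 3 = 0 := by
    have := congrArg (pd (.u0 0 1)) h1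
    simp only [derivation_rules, p1, p2, pd_u_components, z (pd_co_of_ne (show Coord.u0 0 1 ≠ .t by simp)),
      smul_zero, zero_add] at this
    exact lift_injective this
  rw [t3, zero.2.2.2, add_zero] at h1
  obtain ⟨c1, t2⟩ : c 1 = 0 ∧ ϑ 2 = 0 := by
    have := congrArg (pd (.u1 0 0)) h1
    simp only [derivation_rules, p1, p2, pd_u_components, z (pd_co_of_ne (show Coord.u1 0 0 ≠ .t by simp)),
      smul_zero, zero_add, add_zero] at this
    exact smul_Y_add_lift_eq_zero this
  rw [t2, zero.2.2.1, c1, zero_smul, add_zero, add_zero] at h1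
  obtain ⟨c0, t1⟩ : c 0 = 0 ∧ ϑ 1 = 0 := by
    have := congrArg (pd (.u0 1 0)) h1
    simp only [derivation_rules, p1, p2, pd_u_components, z (pd_co_of_ne (show Coord.u0 1 0 ≠ .t by simp)),
      zero_add, add_zero] at this
    exact smul_Y_add_lift_eq_zero this
  rw [t1, zero.2.1, c0, zero_smul, add_zero, zero_add] at h1
  have t0 : ϑ 0 = 0 := lift_injective h1
  have h2 := congrArg Prod.snd h
  have zero2 : (phi3 0).2 = 0 ∧ (phi4 0).2 = 0 ∧ (phi5 0).2 = 0 ∧ (phi6 0).2 = 0 := by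
    simp [phi3, phi4, phi5, phi6]
  rw [combination_snd, Prod.snd_zero] at h2
  simp only [t0, t1, t2, t3, c0, c1, zero2, zero_smul, zero_add] at h2
  have c2 : c 2 = 0 := by
    have := congrArg (pd (.v0 0 0)) h2
    obtain ⟨z8, z9, z10, z11, z12, z13, z14⟩ := apply_a7_eq_zero (Z := pd (.v0 0 0))
      (fun k l _ => pd_co_of_ne (by simp)) (fun k l _ => pd_co_of_ne (by simp))
    have z15 := fun η => apply_at4_eq_zero (Z := pd (.v0 0 0)) (pd_co_of_ne (by simp))
      (pd_co_of_ne (by simp)) (pd_co_of_ne (by simp)) (fun k l _ => pd_co_of_ne (by simp))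
      (pd_co_of_ne (by simp)) η
    simp only [derivation_rules, z8, z9, z10, z11, z12, z13, z14, z15, smul_zero, add_zero, v,
      pd_co_self] at this
    rwa [← Algebra.algebraMap_eq_smul_one, ← map_zero (algebraMap ℝ FE),
      (algebraMap ℝ FE).injective.eq_iff] at this
  rw [c2, zero_smul, zero_add] at h2
  obtain ⟨s8, s9, s10, s11, s12, s13, s14⟩ := symbol_a7
  have hs (η : TFun) : symbol false 3 (phi15 η).2 = 0 ∧ symbol false 3 (phi16 η).2 = 0 ∧
      symbol false 3 (phi17 η).2 = 0 ∧ symbol false 3 (phi18 η).2 = 0 := by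
    simp only [symbol_three]
    refine ⟨?_, ?_, ?_, ?_⟩ <;>
      simp [phi15, phi16, phi17, phi18, coordinate_names, derivation_rules, pd_co, VF.apply_lift]
  -- The symbol of order three ignores the generators of `at4` and places those of `a7` in different
  -- powers of X.
  have h3 := congrArg (symbol false 3) h2
  simp only [symbol_three_add, symbol_three_smul, s8, s9, s10, s11, s12, s13, s14, hs, mul_one,
    add_zero] at h3
  rw [show symbol false 3 (0 : FE) = 0 by simp [symbol_three]] at h3
  have hc (n : ℕ) := congrArg (fun P : FE[X] => P.coeff n) h3
  have hinj {r : ℝ} (hr : algebraMap ℝ FE r = 0) : r = 0 :=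
    (map_eq_zero_iff _ (algebraMap ℝ FE).injective).1 hr
  have c3 : c 3 = 0 := hinj (by simpa [coeff_C, coeff_X, coeff_X_pow] using hc 0)
  have c4 : c 4 = 0 := hinj (by simpa [coeff_C, coeff_X, coeff_X_pow] using hc 1)
  have c5 : c 5 = 0 := hinj (by simpa [coeff_C, coeff_X, coeff_X_pow] using hc 2)
  have c6 : c 6 = 0 := hinj (by simpa [coeff_C, coeff_X, coeff_X_pow] using hc 3)
  have c7 : c 7 = 0 := hinj (by simpa [coeff_C, coeff_X, coeff_X_pow] using hc 4)
  have c8 : c 8 = 0 := hinj (by simpa [coeff_C, coeff_X, coeff_X_pow] using hc 5)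
  have c9 : c 9 = 0 := hinj (by simpa [coeff_C, coeff_X, coeff_X_pow] using hc 6)
  simp only [c3, c4, c5, c6, c7, c8, c9, zero_smul, zero_add] at h2
  have z' {Z : VF} (hZ : Z (co .t) = 0) (η : TFun) : Z (phi15 η).2 = 0 := by
    rw [phi15, VF.apply_lift, hZ, zero_mul]
  have zero' : (phi15 0).2 = 0 ∧ (phi16 0).2 = 0 ∧ (phi17 0).2 = 0 ∧ (phi18 0).2 = 0 := by
    simp [phi15, phi16, phi17, phi18]
  have t7 : ϑ 7 = 0 := by
    have := congrArg (pd (.u0 0 1)) h2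
    simp only [derivation_rules, pd_v_components,
      z' (pd_co_of_ne (show Coord.u0 0 1 ≠ .t by simp)), zero_add] at this
    exact lift_injective this
  rw [t7, zero'.2.2.2, add_zero] at h2
  have t6 : ϑ 6 = 0 := by
    have := congrArg (pd (.u1 0 0)) h2
    simp only [derivation_rules, pd_v_components,
      z' (pd_co_of_ne (show Coord.u1 0 0 ≠ .t by simp)), zero_add] at this
    exact lift_injective this
  rw [t6, zero'.2.2.1, add_zero] at h2
  have t5 : ϑ 5 = 0 := by
    have := congrArg (pd (.u0 1 0)) h2
    simp only [derivation_rules, pd_v_components,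
      z' (pd_co_of_ne (show Coord.u0 1 0 ≠ .t by simp)), zero_add] at this
    exact lift_injective this
  rw [t5, zero'.2.1, add_zero] at h2
  have t4 : ϑ 4 = 0 := lift_injective h2
  refine ⟨funext fun k => ?_, funext fun k => ?_⟩
  · fin_cases k <;> assumption
  · fin_cases k <;> assumption

theorem combination_injective {c c' : Fin 10 → ℝ} {ϑ ϑ' : Fin 8 → TFun}
    (h : combination c ϑ = combination c' ϑ') : c = c' ∧ ϑ = ϑ' := by
  have := eq_zero_of_combination_eq_zero (c := c + (-1 : ℝ) • c') (ϑ := ϑ + (-1 : ℝ) • ϑ') (by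
    rw [combination_add, combination_smul, h]
    simp)
  refine ⟨by simpa [add_neg_eq_zero] using this.1, funext fun k => lift_injective ?_⟩
  simpa [add_neg_eq_zero] using congrArg lift (congrFun this.2 k)

/-! ## The structure of the symmetry algebra -/

theorem spanGen_union (I J : Set ℕ) : spanGen (I ∪ J) = spanGen I ⊔ spanGen J := by
  rw [spanGen, spanGen, spanGen, ← Submodule.span_union]
  congr 1
  ext Z
  simp only [Set.mem_ofPred_eq, Set.mem_union]
  constructor
  · rintro ⟨i, hi | hi, h⟩
    · exact .inl ⟨i, hi, h⟩
    · exact .inr ⟨i, hi, h⟩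
  · rintro (⟨i, hi, h⟩ | ⟨i, hi, h⟩)
    · exact ⟨i, .inl hi, h⟩
    · exact ⟨i, .inr hi, h⟩

theorem Ev_gen_mem_spanGen {I : Set ℕ} {i : ℕ} (hi : i ∈ I) (ϑ : TFun) :
    Ev (gen i ϑ) ∈ spanGen I :=
  Submodule.subset_span ⟨i, hi, ϑ, rfl⟩

theorem Ev_combination_mem_spanGen {I : Set ℕ} {c : Fin 10 → ℝ} {ϑ : Fin 8 → TFun}
    (hc : ∀ k, ![1, 2, 7, 8, 9, 10, 11, 12, 13, 14] k ∈ I)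
    (hϑ : ∀ k, ![3, 4, 5, 6, 15, 16, 17, 18] k ∈ I) : Ev (combination c ϑ) ∈ spanGen I := by
  change EvHom _ ∈ _
  rw [combination_eq_sum, map_add, map_sum, map_sum]
  refine add_mem (sum_mem fun k _ => ?_) (sum_mem fun k _ => Ev_gen_mem_spanGen (hϑ k) _)
  rw [map_smul]
  exact Submodule.smul_mem _ _ (Ev_gen_mem_spanGen (hc k) _)

theorem spanGen_Icc_eq : spanGen (Set.Icc 1 18) = symE.toSubmodule := by
  refine le_antisymm (Submodule.span_le.2 ?_) fun Z hZ => ?_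
  · rintro _ ⟨i, -, ϑ, rfl⟩
    exact Ev_mem_symE (isGenerating_gen i ϑ)
  · obtain ⟨φ, hφ, rfl⟩ := mem_symE_iff.1 hZ
    obtain ⟨c, ϑ, rfl⟩ := hφ.exists_combination
    refine Ev_combination_mem_spanGen (fun k => ?_) fun k => ?_ <;> fin_cases k <;> simp

/-- The coefficients of the elements of the span of some generators. -/
theorem exists_combination_of_mem_spanGen {I : Set ℕ} {Z : VF} (hZ : Z ∈ spanGen I) :
    ∃ (c : Fin 10 → ℝ) (ϑ : Fin 8 → TFun), Z = Ev (combination c ϑ) ∧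
      (∀ k, ![1, 2, 7, 8, 9, 10, 11, 12, 13, 14] k ∉ I → c k = 0) ∧
      ∀ k, ![3, 4, 5, 6, 15, 16, 17, 18] k ∉ I → ϑ k = 0 := by
  have hgen0 (k : Fin 8) : gen (![3, 4, 5, 6, 15, 16, 17, 18] k) 0 = 0 := by
    simpa using gen_index.2.2 k 0 0
  have hzero : combination 0 0 = 0 := by simp [combination_eq_sum, hgen0]
  induction hZ using Submodule.span_induction with
  | zero => exact ⟨0, 0, by rw [hzero]; exact (map_zero EvHom).symm, fun _ _ => rfl, fun _ _ => rfl⟩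
  | add Z W _ _ hZ hW =>
    obtain ⟨c, ϑ, rfl, h, k⟩ := hZ
    obtain ⟨c', ϑ', rfl, h', k'⟩ := hW
    refine ⟨c + c', ϑ + ϑ', by rw [combination_add, Ev_add], fun i hi => ?_, fun i hi => ?_⟩
    · rw [Pi.add_apply, h i hi, h' i hi, add_zero]
    · rw [Pi.add_apply, k i hi, k' i hi, add_zero]
  | smul r Z _ hZ =>
    obtain ⟨c, ϑ, rfl, h, k⟩ := hZ
    refine ⟨r • c, r • ϑ, by rw [combination_smul, Ev_smul], fun i hi => ?_, fun i hi => ?_⟩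
    · rw [Pi.smul_apply, h i hi, smul_zero]
    · rw [Pi.smul_apply, k i hi, smul_zero]
  | mem Z hZ =>
    obtain ⟨i, hi, ϑ, rfl⟩ := hZ
    have h1 : (∃ k : Fin 10, i = ![1, 2, 7, 8, 9, 10, 11, 12, 13, 14] k) ∨
        (∃ k : Fin 8, i = ![3, 4, 5, 6, 15, 16, 17, 18] k) ∨ gen i ϑ = 0 := by
      rcases Nat.lt_or_ge 18 i with h | h
      · refine .inr (.inr ?_)
        unfold gen
        split <;> first | omega | rfl
      · interval_cases i <;>
          first
          | exact .inr (.inr rfl)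
          | exact .inl (by decide)
          | exact .inr (.inl (by decide))
    obtain ⟨k, rfl⟩ | ⟨k, rfl⟩ | h := h1
    · refine ⟨Pi.single k 1, 0, ?_, fun j hj => ?_, fun _ _ => rfl⟩
      · rw [combination_eq_sum, Finset.sum_eq_single k]
        · simp [hgen0, gen_index.1 k ϑ 0]
        · intro j _ hj
          simp [hj]
        · simp
      · rw [Pi.single_apply, if_neg]
        rintro rfl
        exact hj hi
    · refine ⟨0, Pi.single k ϑ, ?_, fun _ _ => rfl, fun j hj => ?_⟩
      · rw [combination_eq_sum, Finset.sum_eq_single (a := k) (s := Finset.univ)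
          (f := fun j => gen (![3, 4, 5, 6, 15, 16, 17, 18] j) (Pi.single (M := fun _ => TFun) k ϑ j))]
        · simp
        · intro j _ hj
          simp [hj, hgen0]
        · simp
      · rw [Pi.single_apply, if_neg]
        rintro rfl
        exact hj hi
    · refine ⟨0, 0, ?_, fun _ _ => rfl, fun _ _ => rfl⟩
      rw [h, hzero]

/-- By uniqueness of the parameters, a common element has parameters supported in I and in J at
once, hence none. -/
theorem disjoint_spanGen {I J : Set ℕ} (h : Disjoint I J) : Disjoint (spanGen I) (spanGen J) := by
  rw [Submodule.disjoint_def]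
  intro Z hI hJ
  obtain ⟨c, ϑ, rfl, hc, hϑ⟩ := exists_combination_of_mem_spanGen hI
  obtain ⟨c', ϑ', e, hc', hϑ'⟩ := exists_combination_of_mem_spanGen hJ
  obtain ⟨rfl, rfl⟩ := combination_injective (Ev_injective e)
  have hc0 : c = 0 := funext fun k => by
    by_cases hk : ![1, 2, 7, 8, 9, 10, 11, 12, 13, 14] k ∈ I
    · exact hc' k (Set.disjoint_left.1 h hk)
    · exact hc k hk
  have hϑ0 : ϑ = 0 := funext fun k => by
    by_cases hk : ![3, 4, 5, 6, 15, 16, 17, 18] k ∈ I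
    · exact hϑ' k (Set.disjoint_left.1 h hk)
    · exact hϑ k hk
  have := combination_smul 0 c ϑ
  rw [zero_smul ℝ (combination c ϑ)] at this
  rw [hc0, hϑ0, smul_zero, smul_zero] at this
  rw [hc0, hϑ0, this]
  exact map_zero EvHom

theorem linearIndependent_Ev_gen : LinearIndependent ℝ fun k : Fin 10 =>
    Ev (gen (![1, 2, 7, 8, 9, 10, 11, 12, 13, 14] k) 0) := by
  rw [Fintype.linearIndependent_iff]
  intro g hg k
  have h1 : ∑ k, g k • EvHom (gen (![1, 2, 7, 8, 9, 10, 11, 12, 13, 14] k) 0) = 0 := hg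
  have h2 : combination g 0 = 0 := Ev_injective (by
    change EvHom _ = EvHom 0
    rw [map_zero, ← h1, combination_eq_sum]
    have hgen0 (k : Fin 8) : gen (![3, 4, 5, 6, 15, 16, 17, 18] k) 0 = 0 := by
      simpa using gen_index.2.2 k 0 0
    simp [hgen0])
  exact congrFun (eq_zero_of_combination_eq_zero h2).1 k

theorem finrank_spanGen {n : ℕ} (ι : Fin n → Fin 10) (hι : Function.Injective ι) :
    Module.finrank ℝ
      (spanGen (Set.range fun k => ![1, 2, 7, 8, 9, 10, 11, 12, 13, 14] (ι k))) = n := by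
  have h := finrank_span_eq_card (linearIndependent_Ev_gen.comp ι hι)
  rw [Fintype.card_fin] at h
  have hset : {Z | ∃ i ∈ Set.range fun k => ![1, 2, 7, 8, 9, 10, 11, 12, 13, 14] (ι k), ∃ ϑ : TFun,
      Z = Ev (gen i ϑ)} =
      Set.range ((fun k : Fin 10 => Ev (gen (![1, 2, 7, 8, 9, 10, 11, 12, 13, 14] k) 0)) ∘ ι) := by
    ext Z
    simp only [Set.mem_ofPred_eq, Set.mem_range, exists_exists_eq_and, Function.comp_apply]
    constructor
    · rintro ⟨k, ϑ, rfl⟩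
      exact ⟨k, by rw [gen_index.1]⟩
    · rintro ⟨k, rfl⟩
      exact ⟨k, 0, rfl⟩
  rw [spanGen, hset]
  exact h

theorem finrank_summands : Module.finrank ℝ s2 = 2 ∧ Module.finrank ℝ a1 = 1 ∧
    Module.finrank ℝ a7 = 7 := by
  have key {n : ℕ} {I : Set ℕ} (ι : Fin n → Fin 10) (hι : Function.Injective ι)
      (hI : I = Set.range fun k => ![1, 2, 7, 8, 9, 10, 11, 12, 13, 14] (ι k)) :
      Module.finrank ℝ (spanGen I) = n := hI ▸ finrank_spanGen ι hι
  refine ⟨key ![0, 1] (by decide) ?_, key ![2] (by decide) ?_,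
    key ![3, 4, 5, 6, 7, 8, 9] (by decide) ?_⟩
  · ext i
    simp [Fin.exists_fin_succ, eq_comm]
  · ext i
    simp [eq_comm]
  · ext i
    simp [Fin.exists_fin_succ]
    omega

/-! ### Brackets of spans of generators -/

theorem lie_mem_of_gen {I J : Set ℕ} {S : Submodule ℝ VF}
    (h : ∀ i ∈ I, ∀ j ∈ J, ∀ ϑ η, Ev (jacobi (gen i ϑ) (gen j η)) ∈ S) :
    ∀ a ∈ spanGen I, ∀ b ∈ spanGen J, ⁅a, b⁆ ∈ S := by
  intro a ha b hb
  induction ha using Submodule.span_induction with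
  | zero => simp
  | add a a' _ _ h h' => rw [add_lie]; exact add_mem h h'
  | smul r a _ h => rw [smul_lie]; exact S.smul_mem r h
  | mem a ha =>
    obtain ⟨i, hi, ϑ, rfl⟩ := ha
    induction hb using Submodule.span_induction with
    | zero => simp
    | add b b' _ _ h h' => rw [lie_add]; exact add_mem h h'
    | smul r b _ h => rw [lie_smul]; exact S.smul_mem r h
    | mem b hb =>
      obtain ⟨j, hj, η, rfl⟩ := hb
      rw [lie_Ev (isGenerating_gen i ϑ) (isGenerating_gen j η)]
      exact h i hi j hj ϑ η

theorem jacobi_mem_of_ideal {S : Submodule ℝ Section} (hS : ∀ k ∈ Set.Icc 8 18, ∀ ζ, gen k ζ ∈ S)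
    {i j : ℕ} (hi : i ∈ Set.Icc 1 7) (hj : j ∈ Set.Icc 8 18) (ϑ η : TFun) :
    jacobi (gen i ϑ) (gen j η) ∈ S := by
  by_cases h7 : i = 7
  · subst h7
    exact (jacobi_phi7 hj η).symm ▸ neg_mem (hS j hj η)
  have m8 : phi8 ∈ S := hS 8 (by simp) 0
  have m9 : phi9 ∈ S := hS 9 (by simp) 0
  have m10 : phi10 ∈ S := hS 10 (by simp) 0
  have m11 : phi11 ∈ S := hS 11 (by simp) 0
  have m12 : phi12 ∈ S := hS 12 (by simp) 0
  have m13 : phi13 ∈ S := hS 13 (by simp) 0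
  have m14 : phi14 ∈ S := hS 14 (by simp) 0
  have m15 : ∀ ζ, phi15 ζ ∈ S := hS 15 (by simp)
  have m16 : ∀ ζ, phi16 ζ ∈ S := hS 16 (by simp)
  have m17 : ∀ ζ, phi17 ζ ∈ S := hS 17 (by simp)
  have m18 : ∀ ζ, phi18 ζ ∈ S := hS 18 (by simp)
  have key : ∀ i ∈ [1, 2, 3, 4, 5, 6], ∀ j ∈ [8, 9, 10, 11, 12, 13, 14, 15, 16, 17, 18],
      jacobi (gen i ϑ) (gen j η) ∈ S := by
    have e1 := jacobi_phi1 η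
    have e2 := jacobi_phi2 η
    have e3 := jacobi_gt4_ideal ϑ η
    have e4 := jacobi_s2_eq_zero η
    have e5 := jacobi_gt4_eq_zero ϑ η
    simp only [List.forall_mem_cons, gen_eq, e1, e2, e3, e4, e5, neg_mem_iff, S.smul_mem, m8, m9, m10,
      m11, m12, m13, m14, m15, m16, m17, m18, S.zero_mem, true_and, List.not_mem_nil,
      IsEmpty.forall_iff, implies_true]
  obtain ⟨hi1, hi2⟩ := hi
  obtain ⟨hj1, hj2⟩ := hj
  exact key i (by simp; omega) j (by simp; omega)

/-- The pairs `(i, j)` with `i ≤ j ≤ 7` for which `i` or `j` is an index of `gt4`. -/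
def gt4Pairs : List (ℕ × ℕ) :=
  [(1, 3), (1, 4), (1, 5), (1, 6), (2, 3), (2, 4), (2, 5), (2, 6),
    (3, 3), (3, 4), (3, 5), (3, 6), (4, 4), (4, 5), (4, 6), (5, 5), (5, 6), (6, 6),
    (3, 7), (4, 7), (5, 7), (6, 7)]

theorem jacobi_mem_of_gt4 {S : Submodule ℝ Section} (hS : ∀ k ∈ Set.Icc 3 6, ∀ ζ, gen k ζ ∈ S)
    {i j : ℕ} (hi : i ∈ Set.Icc 1 7) (hj : j ∈ Set.Icc 3 6) (ϑ η : TFun) :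
    jacobi (gen i ϑ) (gen j η) ∈ S := by
  have m3 : ∀ ζ, phi3 ζ ∈ S := hS 3 (by simp)
  have m4 : ∀ ζ, phi4 ζ ∈ S := hS 4 (by simp)
  have m5 : ∀ ζ, phi5 ζ ∈ S := hS 5 (by simp)
  have m6 : ∀ ζ, phi6 ζ ∈ S := hS 6 (by simp)
  have key (ϑ η : TFun) : ∀ q ∈ gt4Pairs, jacobi (gen q.1 ϑ) (gen q.2 η) ∈ S := by
    have e1 := jacobi_phi1 η
    have e2 := jacobi_phi2 η
    have e3 := jacobi_gt4 ϑ η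
    have e4 := jacobi_s2_eq_zero η
    have e5 := jacobi_gt4_eq_zero ϑ η
    simp only [gt4Pairs, List.forall_mem_cons, gen_eq, e1, e2, e3, e4, e5, S.smul_mem, m3, m4, m5, m6,
      S.zero_mem, true_and, List.not_mem_nil, IsEmpty.forall_iff, implies_true]
  -- The table lists pairs with i ≤ j; antisymmetry covers the others.
  obtain ⟨h1, h2⟩ : (i ≤ j → (i, j) ∈ gt4Pairs) ∧ (j < i → (j, i) ∈ gt4Pairs) := by
    obtain ⟨hi1, hi2⟩ := hi
    obtain ⟨hj1, hj2⟩ := hj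
    unfold gt4Pairs
    interval_cases i <;> interval_cases j <;> decide
  rcases le_or_gt i j with h | h
  · exact key ϑ η (i, j) (h1 h)
  · rw [jacobi_swap]
    exact neg_mem (key η ϑ (j, i) (h2 h))

section
variable {L : Type*} [LieRing L] [LieAlgebra ℝ L]

theorem lie_mem_of_sup_left {A B C S : Submodule ℝ L} (hA : ∀ a ∈ A, ∀ c ∈ C, ⁅a, c⁆ ∈ S)
    (hB : ∀ b ∈ B, ∀ c ∈ C, ⁅b, c⁆ ∈ S) : ∀ a ∈ A ⊔ B, ∀ c ∈ C, ⁅a, c⁆ ∈ S := by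
  intro x hx c hc
  obtain ⟨a, ha, b, hb, rfl⟩ := Submodule.mem_sup.1 hx
  rw [add_lie]
  exact add_mem (hA a ha c hc) (hB b hb c hc)

theorem lie_mem_of_sup_right {A B C S : Submodule ℝ L} (hA : ∀ c ∈ C, ∀ a ∈ A, ⁅c, a⁆ ∈ S)
    (hB : ∀ c ∈ C, ∀ b ∈ B, ⁅c, b⁆ ∈ S) : ∀ c ∈ C, ∀ a ∈ A ⊔ B, ⁅c, a⁆ ∈ S := by
  intro c hc x hx
  obtain ⟨a, ha, b, hb, rfl⟩ := Submodule.mem_sup.1 hx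
  rw [lie_add]
  exact add_mem (hA c hc a ha) (hB c hc b hb)

theorem IsSubalg.sup {A B : Submodule ℝ L} (hA : IsSubalg A) (hB : IsSubalg B)
    (h : ∀ a ∈ A, ∀ b ∈ B, ⁅a, b⁆ ∈ A ⊔ B) : IsSubalg (A ⊔ B) := by
  refine lie_mem_of_sup_left (lie_mem_of_sup_right ?_ h) (lie_mem_of_sup_right ?_ ?_)
  · exact fun a ha b hb => Submodule.mem_sup_left (hA a ha b hb)
  · intro b hb a ha
    rw [← lie_skew]
    exact neg_mem (h a ha b hb)
  · exact fun a ha b hb => Submodule.mem_sup_right (hB a ha b hb)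

end

theorem lie_eq_zero_of_gen {I J : Set ℕ}
    (h : ∀ i ∈ I, ∀ j ∈ J, ∀ ϑ η, jacobi (gen i ϑ) (gen j η) = 0) :
    ∀ a ∈ spanGen I, ∀ b ∈ spanGen J, ⁅a, b⁆ = 0 := by
  intro a ha b hb
  have := lie_mem_of_gen (S := ⊥) (fun i hi j hj ϑ η => by
    rw [h i hi j hj ϑ η]
    exact (Submodule.mem_bot ℝ).2 (map_zero EvHom)) a ha b hb
  exact (Submodule.mem_bot ℝ).1 this

theorem lie_a7_sup_at4 {I J : Set ℕ} (hI : I ⊆ Set.Icc 8 18) (hJ : J ⊆ Set.Icc 8 18) :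
    ∀ a ∈ spanGen I, ∀ b ∈ spanGen J, ⁅a, b⁆ = 0 :=
  lie_eq_zero_of_gen fun _ hi _ hj => jacobi_ideal (hI hi) (hJ hj)

/-! ### The direct and semidirect decompositions -/

theorem at4_sup_a7 : at4 ⊔ a7 = spanGen (Set.Icc 8 18) := by
  rw [at4, a7, ← spanGen_union]
  congr 1
  ext i
  simp
  omega

theorem s2_sup_a1 : s2 ⊔ a1 = spanGen {1, 2, 7} := by
  rw [s2, a1, ← spanGen_union]
  congr 1
  ext i
  simp only [Set.mem_union, Set.mem_insert_iff, Set.mem_singleton_iff, or_assoc]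

theorem gt4_sup : gt4 ⊔ (at4 ⊔ a7) = spanGen (Set.Icc 3 6 ∪ Set.Icc 8 18) := by
  rw [at4_sup_a7, gt4, ← spanGen_union]

theorem s2_sup_a1_sup_gt4 : s2 ⊔ a1 ⊔ gt4 = spanGen (Set.Icc 1 7) := by
  rw [s2_sup_a1, gt4, ← spanGen_union]
  congr 1
  ext i
  simp
  omega

theorem lie_mem_at4_sup_a7 {I : Set ℕ} (hI : I ⊆ Set.Icc 1 7) :
    ∀ a ∈ spanGen I, ∀ b ∈ at4 ⊔ a7, ⁅a, b⁆ ∈ at4 ⊔ a7 := by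
  rw [at4_sup_a7]
  exact lie_mem_of_gen fun i hi j hj ϑ η =>
    jacobi_mem_of_ideal (S := (spanGen (Set.Icc 8 18)).comap EvHom)
      (fun _ hk => Ev_gen_mem_spanGen hk) (hI hi) hj ϑ η

theorem lie_mem_gt4 {I : Set ℕ} (hI : I ⊆ Set.Icc 1 7) :
    ∀ a ∈ spanGen I, ∀ b ∈ gt4, ⁅a, b⁆ ∈ gt4 :=
  lie_mem_of_gen fun _ hi _ hj ϑ η =>
    jacobi_mem_of_gt4 (S := gt4.comap EvHom)
      (fun _ hk => Ev_gen_mem_spanGen hk) (hI hi) hj ϑ η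

/-- The bracket of `s2` takes values in the span of `phi1`. -/
theorem lie_s2_mem : ∀ a ∈ s2, ∀ b ∈ s2, ⁅a, b⁆ ∈ spanGen {1} := by
  have h1 : Ev phi1 ∈ spanGen {1} := Ev_gen_mem_spanGen (Set.mem_singleton 1) 0
  have h0 : Ev 0 ∈ spanGen {1} := by
    rw [show Ev 0 = 0 from map_zero EvHom]
    exact zero_mem _
  have h2 : Ev (-phi1) ∈ spanGen {1} := by
    rw [← neg_one_smul ℝ, Ev_smul]
    exact Submodule.smul_mem _ _ h1
  refine lie_mem_of_gen ?_
  rintro i (rfl | rfl) j (rfl | rfl) ϑ η <;>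
    simp only [gen, jacobi_self, jacobi_phi2_phi1, jacobi_swap phi2 phi1, h0, h1, h2]

theorem isSubalg_s2 : IsSubalg s2 := fun a ha b hb =>
  have hle : spanGen {1} ≤ s2 := by
    rw [s2, Set.insert_eq, spanGen_union]
    exact le_sup_left
  hle (lie_s2_mem a ha b hb)

theorem lie_s2_a1 : ∀ a ∈ s2, ∀ b ∈ a1, ⁅a, b⁆ = 0 := by
  refine lie_eq_zero_of_gen ?_
  have := jacobi_s2_eq_zero 0
  rintro i (rfl | rfl) j rfl ϑ η <;> simp only [gen, this]

theorem isAbelianOn_summands : IsAbelianOn a1 ∧ IsAbelianOn at4 ∧ IsAbelianOn a7 := by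
  refine ⟨lie_eq_zero_of_gen ?_, lie_a7_sup_at4 ?_ ?_, lie_a7_sup_at4 ?_ ?_⟩
  · rintro i rfl j rfl ϑ η
    exact jacobi_self phi7
  all_goals exact Set.Icc_subset_Icc (by norm_num) (by norm_num)

theorem IsAbelianOn.isSubalg {L : Type*} [LieRing L] [LieAlgebra ℝ L] {V : Submodule ℝ L}
    (h : IsAbelianOn V) : IsSubalg V := fun a ha b hb => h a ha b hb ▸ V.zero_mem

theorem isDirectSum_s2_a1 : IsDirectSum (s2 ⊔ a1) s2 a1 :=
  ⟨isSubalg_s2, isAbelianOn_summands.1.isSubalg, lie_s2_a1, disjoint_spanGen (by simp), rfl⟩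

theorem isDirectSum_at4_a7 : IsDirectSum (at4 ⊔ a7) at4 a7 :=
  ⟨isAbelianOn_summands.2.1.isSubalg, isAbelianOn_summands.2.2.isSubalg,
    lie_a7_sup_at4 (Set.Icc_subset_Icc (by norm_num) (by norm_num))
      (Set.Icc_subset_Icc (by norm_num) (by norm_num)),
    disjoint_spanGen (Set.disjoint_left.2 fun i => by simp; omega), rfl⟩

theorem isSubalg_s2_sup_a1 : IsSubalg (s2 ⊔ a1) :=
  isSubalg_s2.sup isAbelianOn_summands.1.isSubalg fun a ha b hb =>
    lie_s2_a1 a ha b hb ▸ zero_mem _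

theorem isSubalg_at4_sup_a7 : IsSubalg (at4 ⊔ a7) := by
  rw [at4_sup_a7]
  exact fun a ha b hb => lie_a7_sup_at4 le_rfl le_rfl a ha b hb ▸ zero_mem _

theorem isSubalg_gt4 : IsSubalg gt4 := lie_mem_gt4 (Set.Icc_subset_Icc (by norm_num) (by norm_num))

theorem lie_s2_sup_a1_gt4 : ∀ a ∈ s2 ⊔ a1, ∀ b ∈ gt4, ⁅a, b⁆ ∈ gt4 := by
  rw [s2_sup_a1]
  exact lie_mem_gt4 (by rintro i (rfl | rfl | rfl) <;> simp)

theorem isSemidirect_s2_a1_gt4 : IsSemidirect (s2 ⊔ a1 ⊔ gt4) (s2 ⊔ a1) gt4 := by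
  refine ⟨isSubalg_s2_sup_a1, isSubalg_gt4, lie_s2_sup_a1_gt4, ?_, rfl⟩
  rw [s2_sup_a1]
  exact disjoint_spanGen (by simp)

theorem lie_gt4_at4_sup_a7 : ∀ a ∈ gt4, ∀ b ∈ at4 ⊔ a7, ⁅a, b⁆ ∈ at4 ⊔ a7 :=
  lie_mem_at4_sup_a7 (Set.Icc_subset_Icc (by norm_num) (by norm_num))

theorem isSemidirect_gt4_at4_a7 : IsSemidirect (gt4 ⊔ (at4 ⊔ a7)) gt4 (at4 ⊔ a7) := by
  refine ⟨isSubalg_gt4, isSubalg_at4_sup_a7, lie_gt4_at4_sup_a7, ?_, rfl⟩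
  rw [at4_sup_a7]
  exact disjoint_spanGen (Set.disjoint_left.2 fun i => by simp; omega)

theorem isSemidirect_symE :
    IsSemidirect symE.toSubmodule (s2 ⊔ a1) (gt4 ⊔ (at4 ⊔ a7)) := by
  refine ⟨isSubalg_s2_sup_a1, isSubalg_gt4.sup isSubalg_at4_sup_a7 fun a ha b hb =>
    Submodule.mem_sup_right (lie_gt4_at4_sup_a7 a ha b hb), lie_mem_of_sup_right ?_ ?_, ?_, ?_⟩
  · exact fun a ha b hb => Submodule.mem_sup_left (lie_s2_sup_a1_gt4 a ha b hb)
  · intro a ha b hb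
    refine Submodule.mem_sup_right (lie_mem_at4_sup_a7 (I := {1, 2, 7}) ?_ a (s2_sup_a1 ▸ ha) b hb)
    rintro i (rfl | rfl | rfl) <;> simp
  · rw [gt4_sup, s2_sup_a1]
    exact disjoint_spanGen (by simp)
  · rw [gt4_sup, s2_sup_a1, ← spanGen_union, ← spanGen_Icc_eq]
    congr 1
    ext i
    simp
    omega

theorem isSemidirect_symE' :
    IsSemidirect symE.toSubmodule (s2 ⊔ a1 ⊔ gt4) (at4 ⊔ a7) := by
  refine ⟨isSubalg_s2_sup_a1.sup isSubalg_gt4 fun a ha b hb =>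
    Submodule.mem_sup_right (lie_s2_sup_a1_gt4 a ha b hb), isSubalg_at4_sup_a7, ?_, ?_, ?_⟩
  · rw [s2_sup_a1_sup_gt4]
    exact lie_mem_at4_sup_a7 le_rfl
  · rw [at4_sup_a7, s2_sup_a1_sup_gt4]
    exact disjoint_spanGen (Set.disjoint_left.2 fun i => by simp; omega)
  · rw [at4_sup_a7, s2_sup_a1_sup_gt4, ← spanGen_union, ← spanGen_Icc_eq]
    congr 1
    ext i
    simp
    omega

/-- The derived algebra lies in the span of φ₁, which is Abelian, so the second derived algebra
vanishes. -/
theorem exists_isSolvable_s2 :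
    ∃ S : LieSubalgebra ℝ VF, S.toSubmodule = s2 ∧ LieAlgebra.IsSolvable S := by
  refine ⟨{ s2 with lie_mem' := fun {a b} ha hb => isSubalg_s2 a ha b hb }, rfl, ?_⟩
  set S : LieSubalgebra ℝ VF := { s2 with lie_mem' := fun {a b} ha hb => isSubalg_s2 a ha b hb }
  let K : LieIdeal ℝ S :=
    { (spanGen {1}).comap S.toSubmodule.subtype with
      lie_mem := fun {x y} hy => lie_s2_mem x.1 x.2 y.1 y.2 }
  have h1 : LieAlgebra.derivedSeries ℝ S 1 ≤ K := by
    rw [LieAlgebra.derivedSeries_def, LieAlgebra.derivedSeriesOfIdeal_succ,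
      LieAlgebra.derivedSeriesOfIdeal_zero, LieSubmodule.lie_le_iff]
    exact fun x _ y _ => lie_s2_mem x.1 x.2 y.1 y.2
  have h2 : LieAlgebra.derivedSeries ℝ S 2 = ⊥ := by
    rw [LieAlgebra.derivedSeries_def, LieAlgebra.derivedSeriesOfIdeal_succ, eq_bot_iff,
      LieSubmodule.lie_le_iff]
    intro x hx y hy
    rw [LieSubmodule.mem_bot]
    refine Subtype.ext (lie_eq_zero_of_gen (I := {1}) (J := {1}) ?_ x.1 (h1 hx) y.1 (h1 hy))
    rintro i rfl j rfl ϑ η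
    exact jacobi_self phi1
  exact LieAlgebra.IsSolvable.mk h2

end PavlovMikhalev

theorem proposition1 :
    -- the symmetry algebra consists of the combinations of the generators, without repetitions
    (∀ Z : VF, Z ∈ symE ↔
      ∃ (c : Fin 10 → ℝ) (ϑ : Fin 8 → TFun), Z = Ev (combination c ϑ)) ∧
    (∀ (c c' : Fin 10 → ℝ) (ϑ ϑ' : Fin 8 → TFun),
      Ev (combination c ϑ) = Ev (combination c' ϑ') → c = c' ∧ ϑ = ϑ') ∧
    -- commutators of symmetries are given by Jacobi brackets of generating sections
    (∀ φ ψ : Section, Ev φ ∈ symE → Ev ψ ∈ symE → ⁅Ev φ, Ev ψ⁆ = Ev (jacobi φ ψ)) ∧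
    -- the decomposition of the symmetry algebra
    IsDirectSum (s2 ⊔ a1) s2 a1 ∧
    IsDirectSum (at4 ⊔ a7) at4 a7 ∧
    IsSemidirect (s2 ⊔ a1 ⊔ gt4) (s2 ⊔ a1) gt4 ∧
    IsSemidirect (gt4 ⊔ (at4 ⊔ a7)) gt4 (at4 ⊔ a7) ∧
    IsSemidirect symE.toSubmodule (s2 ⊔ a1) (gt4 ⊔ (at4 ⊔ a7)) ∧
    IsSemidirect symE.toSubmodule (s2 ⊔ a1 ⊔ gt4) (at4 ⊔ a7) ∧
    -- the summands
    Module.finrank ℝ s2 = 2 ∧ Module.finrank ℝ a1 = 1 ∧ Module.finrank ℝ a7 = 7 ∧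
    (∃ S : LieSubalgebra ℝ (VF), S.toSubmodule = s2 ∧ LieAlgebra.IsSolvable S) ∧
    IsAbelianOn a1 ∧ IsAbelianOn at4 ∧ IsAbelianOn a7 ∧
    -- the structure of the first summand
    jacobi phi2 phi1 = phi1 ∧
    -- the structure of `gt4`
    (∀ ϑ η : TFun,
      jacobi (phi3 ϑ) (phi6 η) = phi3 (d ϑ * η - ϑ * d η) ∧
      jacobi (phi4 ϑ) (phi5 η) = phi3 (ϑ * d η - d ϑ * η) ∧
      jacobi (phi4 ϑ) (phi6 η) = phi4 (d ϑ * η - ϑ * d η) ∧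
      jacobi (phi5 ϑ) (phi5 η) = phi4 (d ϑ * η - ϑ * d η) ∧
      jacobi (phi5 ϑ) (phi6 η) = phi5 (d ϑ * η - ϑ * d η) ∧
      jacobi (phi6 ϑ) (phi6 η) = phi6 (d ϑ * η - ϑ * d η)) ∧
    -- the action of `phi1`
    (∀ ϑ : TFun,
      jacobi phi1 (phi4 ϑ) = (-2 : ℝ) • phi3 ϑ ∧
      jacobi phi1 (phi5 ϑ) = phi4 ϑ ∧
      jacobi phi1 phi9 = -phi8 ∧
      jacobi phi1 phi10 = (-2 : ℝ) • phi9 ∧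
      jacobi phi1 phi11 = (-3 : ℝ) • phi10 ∧
      jacobi phi1 phi12 = (-4 : ℝ) • phi11 ∧
      jacobi phi1 phi13 = (-5 : ℝ) • phi12 ∧
      jacobi phi1 phi14 = (-6 : ℝ) • phi13 ∧
      jacobi phi1 (phi16 ϑ) = (-2 : ℝ) • phi15 ϑ ∧
      jacobi phi1 (phi17 ϑ) = (-5 : ℝ) • phi16 ϑ ∧
      jacobi phi1 (phi18 ϑ) = (-6 : ℝ) • phi17 ϑ) ∧
    -- the action of `phi2`
    (∀ ϑ : TFun,
      jacobi phi2 (phi3 ϑ) = (3 : ℝ) • phi3 ϑ ∧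
      jacobi phi2 (phi4 ϑ) = (2 : ℝ) • phi4 ϑ ∧
      jacobi phi2 (phi5 ϑ) = phi5 ϑ ∧
      jacobi phi2 phi8 = (3 : ℝ) • phi8 ∧
      jacobi phi2 phi9 = (2 : ℝ) • phi9 ∧
      jacobi phi2 phi10 = phi10 ∧
      jacobi phi2 phi12 = -phi12 ∧
      jacobi phi2 phi13 = (-2 : ℝ) • phi13 ∧
      jacobi phi2 phi14 = (-3 : ℝ) • phi14 ∧
      jacobi phi2 (phi16 ϑ) = -phi16 ϑ ∧
      jacobi phi2 (phi17 ϑ) = (-2 : ℝ) • phi17 ϑ ∧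
      jacobi phi2 (phi18 ϑ) = (-3 : ℝ) • phi18 ϑ) ∧
    -- the action of `phi7`
    (∀ i ∈ Set.Icc 8 18, ∀ ϑ : TFun, jacobi phi7 (gen i ϑ) = -gen i ϑ) ∧
    -- the action of `gt4` on `a7` and `at4`
    (∀ ϑ η : TFun,
      jacobi (phi3 ϑ) phi14 = phi15 (d (d (d ϑ))) ∧
      jacobi (phi3 ϑ) (phi18 η) = phi15 ((1 / 2 : ℝ) • (ϑ * d η) + d ϑ * η) ∧
      jacobi (phi4 ϑ) phi13 = -phi15 (d (d (d ϑ))) ∧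
      jacobi (phi4 ϑ) phi14 = (-2 : ℝ) • phi16 (d (d (d ϑ))) ∧
      jacobi (phi4 ϑ) (phi17 η) = -phi15 (d ϑ * η + (1 / 2 : ℝ) • (ϑ * d η)) ∧
      jacobi (phi4 ϑ) (phi18 η) = -phi16 (2 * d ϑ * η + ϑ * d η) ∧
      jacobi (phi5 ϑ) phi12 = -phi15 (d (d (d ϑ))) ∧
      jacobi (phi5 ϑ) phi13 = (-2 : ℝ) • phi16 (d (d (d ϑ))) ∧
      jacobi (phi5 ϑ) phi14 = (-2 : ℝ) • phi17 (d (d (d ϑ))) ∧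
      jacobi (phi5 ϑ) (phi16 η) = -phi15 (d ϑ * η + (1 / 2 : ℝ) • (ϑ * d η)) ∧
      jacobi (phi5 ϑ) (phi17 η) = -phi16 (2 * d ϑ * η + ϑ * d η) ∧
      jacobi (phi5 ϑ) (phi18 η) = -phi17 (2 * d ϑ * η + ϑ * d η) ∧
      jacobi (phi6 ϑ) phi11 = -phi15 (d (d (d ϑ))) ∧
      jacobi (phi6 ϑ) phi12 = (-2 : ℝ) • phi16 (d (d (d ϑ))) ∧
      jacobi (phi6 ϑ) phi13 = (-2 : ℝ) • phi17 (d (d (d ϑ))) ∧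
      jacobi (phi6 ϑ) phi14 = (-2 : ℝ) • phi18 (d (d (d ϑ))) ∧
      jacobi (phi6 ϑ) (phi15 η) = -phi15 (2 * d ϑ * η + ϑ * d η) ∧
      jacobi (phi6 ϑ) (phi16 η) = -phi16 (2 * d ϑ * η + ϑ * d η) ∧
      jacobi (phi6 ϑ) (phi17 η) = -phi17 (2 * d ϑ * η + ϑ * d η) ∧
      jacobi (phi6 ϑ) (phi18 η) = -phi18 (2 * d ϑ * η + ϑ * d η)) ∧
    -- all the remaining brackets vanish
    (∀ i j : ℕ, 1 ≤ i → i ≤ j → j ≤ 18 → (i, j) ∉ listedPairs →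
      ∀ ϑ η : TFun, jacobi (gen i ϑ) (gen j η) = 0) := by
  obtain ⟨f2, f1, f7⟩ := finrank_summands
  obtain ⟨ab1, ab4, ab7⟩ := isAbelianOn_summands
  refine ⟨fun Z => ⟨fun h => ?_, ?_⟩, fun c c' ϑ ϑ' h => combination_injective (Ev_injective h),
    fun φ ψ hφ hψ => lie_Ev (Ev_mem_symE_iff.1 hφ) (Ev_mem_symE_iff.1 hψ),
    isDirectSum_s2_a1, isDirectSum_at4_a7, isSemidirect_s2_a1_gt4, isSemidirect_gt4_at4_a7,
    isSemidirect_symE, isSemidirect_symE', f2, f1, f7, exists_isSolvable_s2, ab1, ab4, ab7,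
    jacobi_phi2_phi1, jacobi_gt4, jacobi_phi1, jacobi_phi2, fun _ hi => jacobi_phi7 hi,
    jacobi_gt4_ideal, fun _ _ => jacobi_eq_zero⟩
  · obtain ⟨φ, hφ, rfl⟩ := mem_symE_iff.1 h
    obtain ⟨c, ϑ, rfl⟩ := hφ.exists_combination
    exact ⟨c, ϑ, rfl⟩
  · rintro ⟨c, ϑ, rfl⟩
    exact Ev_mem_symE (isGenerating_combination c ϑ)
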